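/- Let $K$ be a differential field of characteristic $0$ with four commuting derivations $\partial_1,\dots,\partial_4$ (for instance $K=\mathbb{Q}$ or $\mathbb{R}$ with $\partial_i=0$, or $K=\mathbb{R}(x^1,\dots,x^4)$ with $\partial_i=\partial/\partial x^i$), and let $\omega=(\omega_{ij})$ be a symmetric $4\times 4$ matrix over $K$ with $\det\omega\neq 0$ and inverse $(\omega^{ij})$. Let $T=K^4$ with dual $T^*$. Let $\hat g_1\subset T^*\otimes T$ be the symbol of the conformal Killing equations, $$\omega_{rj}\xi^r_i+\omega_{ir}\xi^r_j-\tfrac{2}{n}\,\omega_{ij}\,\xi^r_r=0\qquad (n=4),$$ and let $\hat g_{1+r}\subset S_{1+r}T^*\otimes T$ be its $r$-th prolongation. A symbol $g_q$ with prolongations $g_{q+r}$ is called $s$-acyclic if for all $1\le t\le s$ and $r\ge 0$ the cohomology of the Spencer sequence $$\wedge^{t-1}T^*\otimes g_{q+r+1}\xrightarrow{\ \delta\ }\wedge^{t}T^*\otimes g_{q+r}\xrightarrow{\ \delta\ }\wedge^{t+1}T^*\otimes S_{q+r-1}T^*\otimes T,\qquad (\delta\alpha)^k_\mu=dx^i\wedge\alpha^k_{\mu+1_i},$$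 at the middle term vanishes. Then $\hat g_2$ is $2$-acyclic but not $3$-acyclic. Suppose in addition that $\omega$ has zero Weyl tensor (for example, $\omega$ is constant, such as the Minkowski metric, or has constant Riemannian curvature). Let $D=K[d_1,\dots,d_4]$ be the ring of linear differential operators, with $d_ia=ad_i+\partial_ia$ for $a\in K$ and $d_id_j=d_jd_i$. For a matrix $P\in D^{p\times m}$, regarded as an operator with $m$ unknowns and $p$ equations, a compatibility condition (CC) is a row $c\in D^{1\times p}$ with $cP=0$. We say that $Q\in D^{l\times p}$ is an operator of generating CC of $P$ of order $k$ if its rows form a left $K$-basis of the space of CC of $P$ of order $\le k$, if every CC of $P$ is a left $D$-linear combination of its rows, and if the CC of order less than $k$ do not generate all CC over $D$. Let $\mathcal{L}(\xi)$ be the Lie derivative, $(\mathcal{L}(\xi)\omega)_{ij}=\omega_{rj}d_i\xi^r+\omega_{ir}d_j\xi^r+\xi^r\partial_r\omega_{ij}$. The conformal Killing equations $$(\mathcal{L}(\xi)\omega)_{ij}-\tfrac1n\,\omega_{ij}\,\omega^{kl}(\mathcal{L}(\xi)\omega)_{kl}=0\qquad(n=4)$$ for $\xi=(\xi^1,\dots,\xi^4)$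 span a left $K$-space of dimension $9$. There are a matrix $CKilling\in D^{9\times 4}$ whose rows form a left $K$-basis of this space and matrices $Weyl\in D^{10\times 9}$, $Bianchi\in D^{9\times 10}$ and $\mathcal{D}_3\in D^{4\times 9}$ such that: 1. $Weyl$ is an operator of generating CC of $CKilling$ of order $2$ ($10$ components), and $CKilling$ has no nonzero CC of order $\le 1$; 2. $Bianchi$ is an operator of generating CC of $Weyl$ of order $2$ ($9$ components), and $Weyl$ has no nonzero CC of order $\le 1$; 3. $\mathcal{D}_3$ is an operator of generating CC of $Bianchi$ of order $1$ ($4$ components), and $Bianchi$ has no nonzero CC of order $0$; 4. $\mathcal{D}_3$ has no nonzero CC. That is, one has the formally exact differential sequence $$0\to\hat\Theta\to 4\xrightarrow{CKilling}9\xrightarrow{Weyl}10\xrightarrow{Bianchi}9\xrightarrow{\ \mathcal{D}_3\ }4\to 0,$$ where the numbers are the numbers of components and $\hat\Theta$ denotes the solutions of the conformal Killing equations. -/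

import Mathlib

open scoped BigOperators Matrix

namespace FormalTheory

noncomputable section

/-! ### Symbols, their prolongations, and Spencer `δ`-cohomology

`K` is the ground field, `n` the number of independent variables, and the fibre of `E` is `K^m`. -/

/-- Families `v = (v^k_μ)` indexed by all multi-indices `μ ∈ ℕ^n` and all `k = 1, …, m`. -/
abbrev Jets (K : Type*) (n m : ℕ) : Type _ := (Fin n →₀ ℕ) → Fin m → K

/-- `S_q T^* ⊗ E`: the families `(v^k_μ)` that live on the multi-indices of length `q`. -/
def symSpace (K : Type*) [Field K] (n m q : ℕ) : Submodule K (Jets K n m) where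
  carrier := {v | ∀ μ, μ.degree ≠ q → v μ = 0}
  add_mem' := by
    intro v w hv hw μ hμ
    simp [hv μ hμ, hw μ hμ]
  zero_mem' := by
    intro μ _
    rfl
  smul_mem' := by
    intro c v hv μ hμ
    simp [hv μ hμ]

/-- The shift `(v^k_μ) ↦ (v^k_{μ+ν})`. -/
def shift {K : Type*} [Field K] {n m : ℕ} (ν : Fin n →₀ ℕ) : Jets K n m →ₗ[K] Jets K n m where
  toFun v := fun μ => v (μ + ν)
  map_add' _ _ := rfl
  map_smul' _ _ := rfl

/-- The symbol `g_{q+r}` defined by `g_q ⊆ S_q T^* ⊗ E`: if `g_q` is given by linear equations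
`a^{τμ}_k v^k_μ = 0`, then `g_{q+r} ⊆ S_{q+r} T^* ⊗ E` is given by the equations
`a^{τμ}_k v^k_{μ+ν} = 0` for all `|ν| = r`. -/
def prolong {K : Type*} [Field K] {n m : ℕ} (q : ℕ) (g : Submodule K (Jets K n m)) (r : ℕ) :
    Submodule K (Jets K n m) :=
  symSpace K n m (q + r) ⊓
    ⨅ (ν : Fin n →₀ ℕ) (_ : ν.degree = r), g.comap (shift ν)

/-- Families of jets indexed by all sets `I = {i_1 < … < i_s}`, the coefficients of
`dx^I = dx^{i_1} ∧ … ∧ dx^{i_s}`. -/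
abbrev Forms (K : Type*) (n m : ℕ) : Type _ := Finset (Fin n) → Jets K n m

/-- `∧^s T^* ⊗ g`. -/
def formsIn {K : Type*} [Field K] {n m : ℕ} (s : ℕ) (g : Submodule K (Jets K n m)) :
    Submodule K (Forms K n m) where
  carrier := {α | ∀ I, α I ∈ g ∧ (I.card ≠ s → α I = 0)}
  add_mem' := by
    intro α β hα hβ I
    refine ⟨g.add_mem (hα I).1 (hβ I).1, fun h => ?_⟩
    simp [(hα I).2 h, (hβ I).2 h]
  zero_mem' := fun I => ⟨g.zero_mem, fun _ => rfl⟩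
  smul_mem' := by
    intro c α hα I
    refine ⟨g.smul_mem c (hα I).1, fun h => ?_⟩
    simp [(hα I).2 h]

/-- The map `δ`, `(δα)^k_μ = dx^i ∧ α^k_{μ+1_i}`. Its component on `dx^J` uses
`dx^i ∧ dx^{J∖i} = (-1)^{#{j ∈ J : j < i}} dx^J`. -/
def delta (K : Type*) [Field K] (n m : ℕ) : Forms K n m →ₗ[K] Forms K n m where
  toFun α := fun J => ∑ i ∈ J,
    ((-1 : K) ^ (J.filter (fun j => j < i)).card) • shift (Finsupp.single i 1) (α (J.erase i))
  map_add' α β := by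
    funext J
    simp [smul_add, Finset.sum_add_distrib]
  map_smul' c α := by
    funext J
    simp [Finset.smul_sum, smul_comm c]

/-- The cocycles `Z^s_{q+r}(g_q)` at `∧^s T^* ⊗ g_{q+r}`. -/
def cocycles {K : Type*} [Field K] {n m : ℕ} (q : ℕ) (g : Submodule K (Jets K n m)) (s r : ℕ) :
    Submodule K (Forms K n m) :=
  formsIn s (prolong q g r) ⊓ LinearMap.ker (delta K n m)

/-- The coboundaries `B^s_{q+r}(g_q) = δ(∧^{s-1} T^* ⊗ g_{q+r+1})`, for `s ≥ 1`. -/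
def coboundaries {K : Type*} [Field K] {n m : ℕ} (q : ℕ) (g : Submodule K (Jets K n m))
    (s r : ℕ) : Submodule K (Forms K n m) :=
  (formsIn (s - 1) (prolong q g (r + 1))).map (delta K n m)

/-- The Spencer `δ`-cohomology `H^s_{q+r}(g_q) = Z^s_{q+r}(g_q) / B^s_{q+r}(g_q)`, for `s ≥ 1`. -/
abbrev Cohomology {K : Type*} [Field K] {n m : ℕ} (q : ℕ) (g : Submodule K (Jets K n m))
    (s r : ℕ) : Type _ :=
  ↥(cocycles q g s r) ⧸ (coboundaries q g s r).submoduleOf (cocycles q g s r)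

/-- The symbol `g_q` is `s`-acyclic: `H^1_{q+r} = … = H^s_{q+r} = 0` for all `r ≥ 0`. -/
def Acyclic {K : Type*} [Field K] {n m : ℕ} (q : ℕ) (g : Submodule K (Jets K n m)) (s : ℕ) :
    Prop :=
  ∀ t, 1 ≤ t → t ≤ s → ∀ r, Subsingleton (Cohomology q g t r)

/-! ### The conformal Killing symbol -/

/-- `ĝ_1 ⊆ T^* ⊗ T`: `ω_{rj} ξ^r_i + ω_{ir} ξ^r_j - (2/n) ω_{ij} ξ^r_r = 0`. -/
def confSymbolOne {K : Type*} [Field K] {n : ℕ} (ω : Matrix (Fin n) (Fin n) K) :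
    Submodule K (Jets K n n) where
  carrier := {v | v ∈ symSpace K n n 1 ∧ ∀ i j,
    ∑ r, ω r j * v (Finsupp.single i 1) r + ∑ r, ω i r * v (Finsupp.single j 1) r
      - 2 / (n : K) * ω i j * ∑ r, v (Finsupp.single r 1) r = 0}
  add_mem' := by
    rintro v w ⟨hv, hv'⟩ ⟨hw, hw'⟩
    refine ⟨Submodule.add_mem _ hv hw, fun i j => ?_⟩
    have h1 := hv' i j
    have h2 := hw' i j
    simp only [Pi.add_apply, mul_add, Finset.sum_add_distrib]
    linear_combination h1 + h2
  zero_mem' := ⟨Submodule.zero_mem _, fun i j => by simp⟩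
  smul_mem' := by
    rintro c v ⟨hv, hv'⟩
    refine ⟨Submodule.smul_mem _ c hv, fun i j => ?_⟩
    have h1 := hv' i j
    simp only [Pi.smul_apply, smul_eq_mul, mul_left_comm _ c, ← Finset.mul_sum]
    linear_combination c * h1

/-- `ĝ_2 ⊆ S_2 T^* ⊗ T`, the first prolongation of `ĝ_1`. -/
def confSymbolTwo {K : Type*} [Field K] {n : ℕ} (ω : Matrix (Fin n) (Fin n) K) :
    Submodule K (Jets K n n) :=
  prolong 1 (confSymbolOne ω) 1

/-! ### Curvature of a metric over a differential field

`pd = (∂_1, …, ∂_n)` are the derivations of `K`, and `ω⁻¹` has the entries `ω^{ij}`. -/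

section Curvature

variable {K : Type*} [Field K] {n : ℕ} (pd : Fin n → Derivation ℤ K K)
  (ω : Matrix (Fin n) (Fin n) K)

/-- Christoffel symbols `γ^k_{ij}`. -/
def christoffel (k i j : Fin n) : K :=
  1 / 2 * ∑ r, ω⁻¹ k r * (pd i (ω r j) + pd j (ω r i) - pd r (ω i j))

/-- Riemann tensor `ρ^k_{l,ij}`. -/
def riemann (k l i j : Fin n) : K :=
  pd i (christoffel pd ω k l j) - pd j (christoffel pd ω k l i)
    + ∑ r, (christoffel pd ω r l j * christoffel pd ω k r i
      - christoffel pd ω r l i * christoffel pd ω k r j)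

/-- Ricci tensor `ρ_{ij} = ρ^r_{i,rj}`. -/
def ricci (i j : Fin n) : K := ∑ r, riemann pd ω r i r j

/-- Scalar curvature `ρ = ω^{ij} ρ_{ij}`. -/
def scalarCurvature : K := ∑ i, ∑ j, ω⁻¹ i j * ricci pd ω i j

/-- Weyl tensor `τ^k_{l,ij}`. -/
def weylTensor (k l i j : Fin n) : K :=
  let δ : Fin n → Fin n → K := fun a b => if a = b then 1 else 0
  riemann pd ω k l i j
    - 1 / ((n : K) - 2) * (δ k i * ricci pd ω l j - δ k j * ricci pd ω l i
        + ω l j * ∑ s, ω⁻¹ k s * ricci pd ω s i - ω l i * ∑ s, ω⁻¹ k s * ricci pd ω s j)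
    + 1 / (((n : K) - 1) * ((n : K) - 2)) * (δ k i * ω l j - δ k j * ω l i)
        * scalarCurvature pd ω

end Curvature

/-! ### The ring `K[d_1, …, d_n]` of linear differential operators

An operator `P = ∑ a_μ d^μ` is determined by its normal form `∑ a_μ χ^μ ∈ K[χ_1, …, χ_n]`.
Left multiplication by `a ∈ K` acts on normal forms as multiplication by `a`; because of
`d_i a = a d_i + ∂_i a`, left multiplication by `d_i` acts on them as
`∑ a_μ χ^μ ↦ ∑ (a_μ χ_i χ^μ + (∂_i a_μ) χ^μ)`. The ring is realised by these left multiplications. -/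

section DiffOp

variable {K : Type*} [Field K] {n : ℕ}

/-- Left multiplication by `d_i` on normal forms. -/
def leftD (pd : Fin n → Derivation ℤ K K) (i : Fin n) : AddMonoid.End (MvPolynomial (Fin n) K) :=
  AddMonoidHom.mulLeft (MvPolynomial.X i) +
    { toFun := fun p => AddMonoidAlgebra.map (pd i : K →+ K) p
      map_zero' := AddMonoidAlgebra.map_zero _
      map_add' := AddMonoidAlgebra.map_add _ }

/-- Left multiplication by `a ∈ K` on normal forms. -/
def leftK (n : ℕ) (a : K) : AddMonoid.End (MvPolynomial (Fin n) K) :=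
  AddMonoidHom.mulLeft (MvPolynomial.C a)

/-- The ring generated by `K` and `d_1, …, d_n`, as a ring of additive maps of normal forms. -/
def diffOpSubring (pd : Fin n → Derivation ℤ K K) :
    Subring (AddMonoid.End (MvPolynomial (Fin n) K)) :=
  Subring.closure (Set.range (leftK n) ∪ Set.range (leftD pd))

/-- The ring `D = K[d_1, …, d_n]` of linear differential operators with coefficients in `K`. -/
def DiffOp (pd : Fin n → Derivation ℤ K K) : Type _ := ↥(diffOpSubring pd)

variable {pd : Fin n → Derivation ℤ K K}

instance : Ring (DiffOp pd) := inferInstanceAs (Ring ↥(diffOpSubring pd))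

variable (pd) in
/-- The operator `d_i`. -/
def dOp (i : Fin n) : DiffOp pd :=
  ⟨leftD pd i, Subring.subset_closure (Or.inr ⟨i, rfl⟩)⟩

variable (pd) in
/-- The inclusion of `K` into the ring of differential operators. -/
def ofK : K →+* DiffOp pd where
  toFun a := ⟨leftK n a, Subring.subset_closure (Or.inl ⟨a, rfl⟩)⟩
  map_one' := by
    apply Subtype.ext
    ext1 p
    exact (congrArg (· * p) MvPolynomial.C_1).trans (one_mul p)
  map_mul' a b := by
    apply Subtype.ext
    ext1 p
    exact (congrArg (· * p) (MvPolynomial.C_mul)).trans (mul_assoc _ _ p)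
  map_zero' := by
    apply Subtype.ext
    ext1 p
    exact (congrArg (· * p) MvPolynomial.C_0).trans (zero_mul p)
  map_add' a b := by
    apply Subtype.ext
    ext1 p
    exact (congrArg (· * p) (MvPolynomial.C_add)).trans (add_mul _ _ p)

/-- `K` acts on `D` by left multiplication. -/
instance : Module K (DiffOp pd) := Module.compHom (DiffOp pd) (ofK pd)

theorem smul_def (a : K) (P : DiffOp pd) : a • P = ofK pd a * P := rfl

/-- The normal form `∑ a_μ χ^μ` of `P = ∑ a_μ d^μ`. -/
def normalForm : DiffOp pd →+ MvPolynomial (Fin n) K where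
  toFun P := P.1 1
  map_zero' := rfl
  map_add' _ _ := rfl

theorem normalForm_ofK_mul (a : K) (P : DiffOp pd) :
    normalForm (ofK pd a * P) = MvPolynomial.C a * normalForm P := rfl

theorem normalForm_dOp_mul (i : Fin n) (P : DiffOp pd) :
    normalForm (dOp pd i * P) = MvPolynomial.X i * normalForm P
      + AddMonoidAlgebra.map (pd i : K →+ K) (normalForm P) := rfl

/-- `P = ∑ a_μ d^μ` has order at most `k`: `a_μ = 0` for `|μ| > k`. -/
def OrderLE (P : DiffOp pd) (k : ℕ) : Prop := (normalForm P).totalDegree ≤ k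

/-- The commutation rule `d_i a = a d_i + ∂_i a`. -/
theorem dOp_mul_ofK (i : Fin n) (a : K) :
    dOp pd i * ofK pd a = ofK pd a * dOp pd i + ofK pd (pd i a) := by
  apply Subtype.ext
  ext1 p
  change MvPolynomial.X i * (MvPolynomial.C a * p)
      + AddMonoidAlgebra.map (pd i : K →+ K) (MvPolynomial.C a * p)
    = MvPolynomial.C a * (MvPolynomial.X i * p + AddMonoidAlgebra.map (pd i : K →+ K) p)
      + MvPolynomial.C (pd i a) * p
  have h : AddMonoidAlgebra.map (pd i : K →+ K) (MvPolynomial.C a * p)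
      = MvPolynomial.C a * AddMonoidAlgebra.map (pd i : K →+ K) p
        + MvPolynomial.C (pd i a) * p := by
    ext μ
    have e (q : MvPolynomial (Fin n) K) :
        MvPolynomial.coeff μ (AddMonoidAlgebra.map (pd i : K →+ K) q)
          = pd i (MvPolynomial.coeff μ q) := rfl
    rw [e, MvPolynomial.coeff_add, MvPolynomial.coeff_C_mul, MvPolynomial.coeff_C_mul,
      MvPolynomial.coeff_C_mul, e, Derivation.leibniz]
    simp [mul_comm]
  rw [h]
  ring

/-- The commutation rule `d_i d_j = d_j d_i`. -/
theorem dOp_mul_comm (hcomm : ∀ i j a, pd i (pd j a) = pd j (pd i a)) (i j : Fin n) :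
    dOp pd i * dOp pd j = dOp pd j * dOp pd i := by
  apply Subtype.ext
  ext1 p
  change MvPolynomial.X i * (MvPolynomial.X j * p + AddMonoidAlgebra.map (pd j : K →+ K) p)
      + AddMonoidAlgebra.map (pd i : K →+ K)
        (MvPolynomial.X j * p + AddMonoidAlgebra.map (pd j : K →+ K) p)
    = MvPolynomial.X j * (MvPolynomial.X i * p + AddMonoidAlgebra.map (pd i : K →+ K) p)
      + AddMonoidAlgebra.map (pd j : K →+ K)
        (MvPolynomial.X i * p + AddMonoidAlgebra.map (pd i : K →+ K) p)
  have hX (k l : Fin n) (q : MvPolynomial (Fin n) K) :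
      AddMonoidAlgebra.map (pd k : K →+ K) (MvPolynomial.X l * q)
        = MvPolynomial.X l * AddMonoidAlgebra.map (pd k : K →+ K) q := by
    ext μ
    have e (μ : Fin n →₀ ℕ) (q : MvPolynomial (Fin n) K) :
        MvPolynomial.coeff μ (AddMonoidAlgebra.map (pd k : K →+ K) q)
          = pd k (MvPolynomial.coeff μ q) := rfl
    rw [e, MvPolynomial.coeff_X_mul', MvPolynomial.coeff_X_mul']
    split_ifs
    · rw [e]
    · simp
  have hc : AddMonoidAlgebra.map (pd i : K →+ K) (AddMonoidAlgebra.map (pd j : K →+ K) p)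
      = AddMonoidAlgebra.map (pd j : K →+ K) (AddMonoidAlgebra.map (pd i : K →+ K) p) := by
    ext μ
    exact hcomm i j _
  rw [AddMonoidAlgebra.map_add, AddMonoidAlgebra.map_add, hX, hX, hc]
  ring

/-! ### Compatibility conditions

A matrix `P ∈ D^{p×m}` is the operator `ξ ↦ η = P ξ` with `m` unknowns and `p` equations. A
compatibility condition (CC) of `P` is a row `c ∈ D^{1×p}` with `c P = 0`, so that
`P ξ = η` implies `c η = 0`. -/

/-- The compatibility conditions of `P` of order at most `k`, a left `K`-space. -/
def compat {p m : ℕ} (P : Matrix (Fin p) (Fin m) (DiffOp pd)) (k : ℕ) :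
    Submodule K (Fin p → DiffOp pd) where
  carrier := {c | (∀ a, OrderLE (c a) k) ∧ c ᵥ* P = 0}
  add_mem' := by
    rintro c c' ⟨h1, h2⟩ ⟨h1', h2'⟩
    refine ⟨fun a => ?_, by rw [Matrix.add_vecMul, h2, h2', add_zero]⟩
    have : normalForm ((c + c') a) = normalForm (c a) + normalForm (c' a) :=
      map_add normalForm _ _
    unfold OrderLE
    rw [this]
    exact (MvPolynomial.totalDegree_add _ _).trans (max_le (h1 a) (h1' a))
  zero_mem' := by
    refine ⟨fun a => ?_, Matrix.zero_vecMul P⟩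
    have : normalForm ((0 : Fin p → DiffOp pd) a) = 0 := map_zero normalForm
    unfold OrderLE
    rw [this, MvPolynomial.totalDegree_zero]
    exact Nat.zero_le k
  smul_mem' := by
    rintro b c ⟨h1, h2⟩
    refine ⟨fun a => ?_, ?_⟩
    · have : normalForm ((b • c) a) = b • normalForm (c a) :=
        (normalForm_ofK_mul b (c a)).trans (MvPolynomial.C_mul')
      unfold OrderLE
      rw [this]
      exact (MvPolynomial.totalDegree_smul_le b _).trans (h1 a)
    · funext j
      have h3 := congrFun h2 j
      simp only [Matrix.vecMul, dotProduct, Pi.smul_apply, smul_def, Pi.zero_apply] at h3 ⊢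
      simp only [mul_assoc]
      rw [← Finset.mul_sum, h3, mul_zero]

/-- The rows of `Q` form a left `K`-basis of `S`. -/
def IsRowBasis {p m : ℕ} (Q : Matrix (Fin p) (Fin m) (DiffOp pd))
    (S : Submodule K (Fin m → DiffOp pd)) : Prop :=
  LinearIndependent K Q.row ∧ Submodule.span K (Set.range Q.row) = S

/-- `Q` is the operator of generating compatibility conditions of `P`, of order exactly `k`:
its rows are a basis of the CC of `P` of order at most `k`, every CC of `P` is a
differential consequence of them, and the CC of smaller order do not suffice. -/
structure IsGeneratingCC {l p m : ℕ} (P : Matrix (Fin p) (Fin m) (DiffOp pd))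
    (Q : Matrix (Fin l) (Fin p) (DiffOp pd)) (k : ℕ) : Prop where
  basis : IsRowBasis Q (compat P k)
  generates : ∀ c : Fin p → DiffOp pd, c ᵥ* P = 0 → ∃ b : Fin l → DiffOp pd, c = b ᵥ* Q
  minimal : ∀ j < k, ¬ ∀ c : Fin p → DiffOp pd, c ᵥ* P = 0 →
    c ∈ Submodule.span (DiffOp pd) (compat P j : Set (Fin p → DiffOp pd))

/-! ### The conformal Killing operator -/

variable (pd) in
/-- The row of `ξ ↦ (L(ξ)ω)_{ij} = ω_{rj} d_i ξ^r + ω_{ir} d_j ξ^r + ξ^r ∂_r ω_{ij}`. -/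
def lieRow (ω : Matrix (Fin n) (Fin n) K) (i j : Fin n) : Fin n → DiffOp pd := fun r =>
  ofK pd (ω r j) * dOp pd i + ofK pd (ω i r) * dOp pd j + ofK pd (pd r (ω i j))

variable (pd) in
/-- The row of `ξ ↦ (L(ξ)ω)_{ij} - (1/n) ω_{ij} ω^{kl} (L(ξ)ω)_{kl}`, which results from
`L(ξ)ω = A ω` by eliminating `A`. -/
def confKillingRow (ω : Matrix (Fin n) (Fin n) K) (i j : Fin n) : Fin n → DiffOp pd :=
  lieRow pd ω i j - ∑ k, ∑ l, (1 / (n : K) * ω i j * ω⁻¹ k l) • lieRow pd ω k l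

variable (pd) in
/-- The left `K`-space spanned by the conformal Killing equations, the dual of
`F̂_0 = J_1(T) / R̂_1`. -/
def confKillingEqs (ω : Matrix (Fin n) (Fin n) K) : Submodule K (Fin n → DiffOp pd) :=
  Submodule.span K (Set.range fun ij : Fin n × Fin n => confKillingRow pd ω ij.1 ij.2)

end DiffOp

end

end FormalTheory

/-! The symbols of the conformal Killing equations are dual to a graded module `M` over `S = K[χ_1,
…, χ_4]` that lives in degrees 0, 1, 2 only, with pieces of dimension 4, 7 = 6 + 1 and 4; its
multiplications are `mulZero` and `mulOne`. The sequence 4, 9, 10, 9, 4 is a lift of the minimal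
free resolution of `M` from symbols to differential operators.

Resolution. In the double complex of the spaces `S ⊗ ∧ ⊗ M_j` the three rows are polynomial Koszul
complexes, exact in positive form degree by the Euler homotopy (`koszul_exact`). The columns come
from `∧^k ⊗ M_0 → ∧^(k-1) ⊗ M_1 → ∧^(k-2) ⊗ M_2`, which is linear algebra over `K`. The first map is
injective for `k ≥ 2`, the second is surjective for `2 ≤ k ≤ 4`, and counting dimensions shows that
homology survives only for `k = 0, 1, 3, 5, 6`, with dimensions 4, 9, 10, 9, 4. The columns `k = 2`
and `k = 4` are exact, so that passing from `k = 3` to `k = 1`, and from `k = 5` to `k = 3`, takes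
two Koszul steps. The diagram chase in `ThreeRows` yields the resolution with maps of degrees 1, 2,
2, 1; these are the orders of the operators (`exists_symbol_resolution`).

Lifting. Induction on the order, removing leading parts, shows that operators whose symbols are
exact and whose composition vanishes form an exact sequence, with control of the order of the
coefficients (`strictlyGenerates_of_symbol`). A matrix of symbols lifts to an operator of CC if
every combination of the equations whose leading part cancels can be rewritten with coefficients of
lower order (`exists_lift_of_symbol`). For `Weyl` and `Bianchi` this follows from the strict
exactness one place earlier. For `CKilling` it is formal integrability, and only here is the Weyl
tensor used.

Integrability. If the Weyl tensor vanishes, so does the Cotton tensor by the Bianchi identity, and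
the tractor connection is flat (`tractorCurv_eq_zero`). Its covariant derivatives on bivectors then
commute and make the bivectors a left `D`-module. Evaluating a row of operators on the bivectors
`ω^{rs} X ∧ Z_s` is `D`-linear and kills the conformal Killing equations (`IsEvaluation.lieRow`).
Conversely, a row of order at most 2 killed by the evaluation is a combination of these equations
with coefficients of order at most 1 (`exists_sub_rowLT_two`, `exists_sub_rowLT_one`, `eq_zero`),
which is the required rewriting.

Acyclicity. An element of `ĝ_2` is determined by its trace, a covector (`confSymbolTwo_apply`). For
a form with values in `ĝ_2`, being `δ`-closed makes the raised traces `B^k` satisfy `dx^p ∧ B^q =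
dx^q ∧ B^p`, and this forces them to vanish in form degrees 1 and 2 when `n = 4`
(`eq_zero_of_wedge_symm`). Degree 1 also gives `ĝ_3 = 0`, so there are no coboundaries. In degree 3
the forms `B^k = T^{ki} i_i vol` with `T` symmetric and trace-free are nonzero cocycles. -/

namespace FormalTheory

noncomputable section

/-! ### Contraction and exterior multiplication on families indexed by finite sets -/

section Exterior

variable {K : Type*} [Field K] {n : ℕ} {X Y : Type*} [AddCommGroup X] [Module K X]
  [AddCommGroup Y] [Module K Y]

variable (K) in
/-- The sign of moving `dx^i` past the factors of `dx^J` with smaller index. -/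
def moveSign (i : Fin n) (J : Finset (Fin n)) : K := (-1 : K) ^ (J.filter (fun j => j < i)).card

theorem moveSign_mul_self (i : Fin n) (J : Finset (Fin n)) :
    moveSign K i J * moveSign K i J = 1 := by
  rw [moveSign, ← mul_pow]
  simp

theorem moveSign_insert {i j : Fin n} {J : Finset (Fin n)} (hj : j ∉ J) :
    moveSign K i (insert j J) = if j < i then -moveSign K i J else moveSign K i J := by
  unfold moveSign
  rw [Finset.filter_insert]
  split_ifs with h
  · rw [Finset.card_insert_of_notMem (by simp [hj]), pow_succ]
    ring
  · rfl

theorem moveSign_erase {i j : Fin n} {J : Finset (Fin n)} (hj : j ∈ J) :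
    moveSign K i (J.erase j) = if j < i then -moveSign K i J else moveSign K i J := by
  have h := moveSign_insert (K := K) (i := i) (Finset.notMem_erase j J)
  rw [Finset.insert_erase hj] at h
  split_ifs at h ⊢ with h'
  · rw [h, neg_neg]
  · exact h.symm

theorem moveSign_anticomm {i j : Fin n} (hij : i ≠ j) {J : Finset (Fin n)} (hi : i ∉ J)
    (hj : j ∉ J) :
    moveSign K i J * moveSign K j (insert i J) = -(moveSign K j J * moveSign K i (insert j J)) := by
  rw [moveSign_insert hi, moveSign_insert hj]
  rcases lt_or_gt_of_ne hij with h | h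
  · rw [if_pos h, if_neg h.not_gt]
    ring
  · rw [if_neg h.not_gt, if_pos h]
    ring

variable (K X) in
/-- The contraction with the `i`-th coordinate vector. -/
def contr (i : Fin n) : (Finset (Fin n) → X) →ₗ[K] (Finset (Fin n) → X) where
  toFun α := fun J => if i ∈ J then 0 else moveSign K i J • α (insert i J)
  map_add' α β := by
    funext J
    by_cases h : i ∈ J <;> simp [h]
  map_smul' c α := by
    funext J
    by_cases h : i ∈ J <;> simp [h, smul_comm c]

variable (K X) in
/-- The exterior multiplication by `dx^i`. -/
def wedge (i : Fin n) : (Finset (Fin n) → X) →ₗ[K] (Finset (Fin n) → X) where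
  toFun α := fun J => if i ∈ J then moveSign K i J • α (J.erase i) else 0
  map_add' α β := by
    funext J
    by_cases h : i ∈ J <;> simp [h]
  map_smul' c α := by
    funext J
    by_cases h : i ∈ J <;> simp [h, smul_comm c]

theorem contr_apply (i : Fin n) (α : Finset (Fin n) → X) (J : Finset (Fin n)) :
    contr K X i α J = if i ∈ J then 0 else moveSign K i J • α (insert i J) := rfl

theorem wedge_apply (i : Fin n) (α : Finset (Fin n) → X) (J : Finset (Fin n)) :
    wedge K X i α J = if i ∈ J then moveSign K i J • α (J.erase i) else 0 := rfl

theorem contr_contr (i j : Fin n) (α : Finset (Fin n) → X) :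
    contr K X i (contr K X j α) = -contr K X j (contr K X i α) := by
  funext J
  rw [Pi.neg_apply]
  simp only [contr_apply]
  by_cases hij : i = j
  · subst hij
    simp
  by_cases hi : i ∈ J
  · simp [hi]
  by_cases hj : j ∈ J
  · simp [hj]
  simp only [hi, hj, Finset.mem_insert, hij, Ne.symm hij, or_self, if_false, smul_smul]
  rw [moveSign_anticomm hij hi hj, Finset.insert_comm, neg_smul]

theorem wedge_wedge (i j : Fin n) (α : Finset (Fin n) → X) :
    wedge K X i (wedge K X j α) = -wedge K X j (wedge K X i α) := by
  funext J
  rw [Pi.neg_apply]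
  simp only [wedge_apply]
  by_cases hij : i = j
  · subst hij
    simp
  by_cases hi : i ∈ J
  swap
  · simp [hi]
  by_cases hj : j ∈ J
  swap
  · simp [hj]
  simp only [hi, hj, Finset.mem_erase, ne_eq, hij, Ne.symm hij, not_false_eq_true, and_self,
    if_true, smul_smul]
  rw [Finset.erase_right_comm, moveSign_erase hi, moveSign_erase hj, ← neg_smul]
  congr 1
  rcases lt_or_gt_of_ne hij with h | h
  · rw [if_pos h, if_neg h.not_gt]
    ring
  · rw [if_neg h.not_gt, if_pos h]
    ring

/-- All homotopies and traces below rest on this relation. For `i ≠ j` the two terms cancel because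
exactly one of `i < j` and `j < i` produces an extra sign. -/
theorem contr_wedge (i j : Fin n) (α : Finset (Fin n) → X) :
    contr K X i (wedge K X j α) + wedge K X j (contr K X i α) = if i = j then α else 0 := by
  funext J
  simp only [Pi.add_apply, contr_apply, wedge_apply]
  by_cases hij : i = j
  · subst hij
    by_cases hi : i ∈ J
    · simp only [hi, if_true, Finset.notMem_erase, if_false, Finset.insert_erase, zero_add,
        smul_smul]
      rw [moveSign_erase hi, if_neg (lt_irrefl i), moveSign_mul_self, one_smul]
    · simp only [hi, if_false, Finset.mem_insert_self, if_true, Finset.erase_insert,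
        not_false_eq_true, add_zero, smul_smul]
      rw [moveSign_insert hi, if_neg (lt_irrefl i), moveSign_mul_self, one_smul]
  rw [if_neg hij, Pi.zero_apply]
  by_cases hj : j ∈ J
  swap
  · simp [hj, Ne.symm hij]
  by_cases hi : i ∈ J
  · simp [hi, hij]
  simp only [hi, hj, Finset.mem_insert, Finset.mem_erase, or_true, and_false, if_false, if_true,
    smul_smul]
  rw [Finset.erase_insert_of_ne hij, moveSign_insert hi, moveSign_erase hj, ← add_smul]
  have : (moveSign K i J * if i < j then -moveSign K j J else moveSign K j J) +
      moveSign K j J * (if j < i then -moveSign K i J else moveSign K i J) = 0 := by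
    rcases lt_or_gt_of_ne hij with h | h
    · rw [if_pos h, if_neg h.not_gt]
      ring
    · rw [if_neg h.not_gt, if_pos h]
      ring
  rw [this, zero_smul]

theorem sum_wedge_contr (α : Finset (Fin n) → X) (J : Finset (Fin n)) :
    (∑ i, wedge K X i (contr K X i α)) J = (J.card : K) • α J := by
  rw [Finset.sum_apply]
  have (i : Fin n) : wedge K X i (contr K X i α) J = if i ∈ J then α J else 0 := by
    rw [wedge_apply]
    split_ifs with h
    · rw [contr_apply, if_neg (Finset.notMem_erase i J), Finset.insert_erase h, smul_smul,
        moveSign_erase h, if_neg (lt_irrefl i), moveSign_mul_self, one_smul]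
    · rfl
  simp only [this, Finset.sum_ite_mem, Finset.univ_inter, Finset.sum_const, Nat.cast_smul_eq_nsmul]

variable (K n X) in
/-- The families of degree `k`, that is `∧^k ⊗ X`. -/
def extPow (k : ℕ) : Submodule K (Finset (Fin n) → X) where
  carrier := {α | ∀ J, J.card ≠ k → α J = 0}
  add_mem' := by
    intro α β hα hβ J hJ
    simp [hα J hJ, hβ J hJ]
  zero_mem' := fun _ _ => rfl
  smul_mem' := by
    intro c α hα J hJ
    simp [hα J hJ]

theorem contr_mem {k : ℕ} (i : Fin n) {α : Finset (Fin n) → X} (hα : α ∈ extPow K n X (k + 1)) :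
    contr K X i α ∈ extPow K n X k := by
  intro J hJ
  rw [contr_apply]
  split_ifs with h
  · rfl
  · rw [hα _ (by rw [Finset.card_insert_of_notMem h]; omega), smul_zero]

theorem contr_eq_zero (i : Fin n) {α : Finset (Fin n) → X} (hα : α ∈ extPow K n X 0) :
    contr K X i α = 0 := by
  funext J
  rw [contr_apply]
  split_ifs with h
  · rfl
  · rw [hα _ (by rw [Finset.card_insert_of_notMem h]; omega), smul_zero, Pi.zero_apply]

theorem wedge_mem {k : ℕ} (i : Fin n) {α : Finset (Fin n) → X} (hα : α ∈ extPow K n X k) :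
    wedge K X i α ∈ extPow K n X (k + 1) := by
  intro J hJ
  rw [wedge_apply]
  split_ifs with h
  · have := Finset.card_erase_add_one h
    rw [hα _ (by omega), smul_zero]
  · rfl

theorem extPow_eq_zero {k : ℕ} (hk : n < k) {α : Finset (Fin n) → X} (hα : α ∈ extPow K n X k) :
    α = 0 := by
  funext J
  have := Finset.card_le_univ J
  rw [Fintype.card_fin] at this
  exact hα J (by omega)

/-- The contraction lowers the degree by one. -/
def contrL (k : ℕ) (i : Fin n) : extPow K n X (k + 1) →ₗ[K] extPow K n X k :=
  (contr K X i).restrict fun _ => contr_mem i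

/-- The exterior multiplication raises the degree by one. -/
def wedgeL (k : ℕ) (i : Fin n) : extPow K n X k →ₗ[K] extPow K n X (k + 1) :=
  (wedge K X i).restrict fun _ => wedge_mem i

theorem contrL_contrL (k : ℕ) (i j : Fin n) (α : extPow K n X (k + 2)) :
    contrL k i (contrL (k + 1) j α) = -contrL k j (contrL (k + 1) i α) :=
  Subtype.ext (contr_contr i j α.1)

theorem contrL_wedgeL (k : ℕ) (i j : Fin n) (α : extPow K n X (k + 1)) :
    contrL (k + 1) i (wedgeL (k + 1) j α) + wedgeL k j (contrL k i α) = if i = j then α else 0 := by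
  apply Subtype.ext
  refine (contr_wedge i j α.1).trans ?_
  split_ifs <;> rfl

theorem contrL_wedgeL_zero (i j : Fin n) (α : extPow K n X 0) :
    contrL 0 i (wedgeL 0 j α) = if i = j then α else 0 := by
  apply Subtype.ext
  have h := contr_wedge (K := K) i j α.1
  rw [contr_eq_zero i α.2, map_zero, add_zero] at h
  refine h.trans ?_
  split_ifs <;> rfl

theorem sum_wedgeL_contrL (k : ℕ) (α : extPow K n X (k + 1)) :
    ∑ i, wedgeL k i (contrL k i α) = ((k + 1 : ℕ) : K) • α := by
  apply Subtype.ext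
  have : ((∑ i, wedgeL k i (contrL k i α) : extPow K n X (k + 1)) : Finset (Fin n) → X)
      = ∑ i, wedge K X i (contr K X i α.1) := by
    rw [AddSubmonoidClass.coe_finsetSum]
    rfl
  rw [this]
  funext J
  rw [sum_wedge_contr]
  by_cases h : J.card = k + 1
  · rw [h]
    rfl
  · rw [α.2 J h, smul_zero]
    exact ((((k + 1 : ℕ) : K) • α).2 J h).symm

/-- A form of degree at least one with vanishing contractions is zero. -/
theorem eq_zero_of_contrL [CharZero K] {k : ℕ} {α : extPow K n X (k + 1)}
    (h : ∀ i, contrL k i α = 0) : α = 0 := by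
  have h1 := sum_wedgeL_contrL k α
  simp only [h, map_zero, Finset.sum_const_zero] at h1
  exact (smul_eq_zero.1 h1.symm).resolve_left (Nat.cast_ne_zero.2 k.succ_ne_zero)

/-- A linear map acts on the coefficients of forms. -/
def extMap (k : ℕ) (f : X →ₗ[K] Y) : extPow K n X k →ₗ[K] extPow K n Y k :=
  (LinearMap.compLeft f (Finset (Fin n))).restrict fun α hα J hJ => by
    change f (α J) = 0
    rw [hα J hJ, map_zero]

theorem contrL_extMap (k : ℕ) (i : Fin n) (f : X →ₗ[K] Y) (α : extPow K n X (k + 1)) :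
    contrL k i (extMap (k + 1) f α) = extMap k f (contrL k i α) := by
  apply Subtype.ext
  funext J
  change (if i ∈ J then 0 else moveSign K i J • f (α.1 (insert i J)))
    = f (if i ∈ J then 0 else moveSign K i J • α.1 (insert i J))
  split_ifs <;> simp

theorem wedgeL_extMap (k : ℕ) (i : Fin n) (f : X →ₗ[K] Y) (α : extPow K n X k) :
    wedgeL k i (extMap k f α) = extMap (k + 1) f (wedgeL k i α) := by
  apply Subtype.ext
  funext J
  change (if i ∈ J then moveSign K i J • f (α.1 (J.erase i)) else 0)
    = f (if i ∈ J then moveSign K i J • α.1 (J.erase i) else 0)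
  split_ifs <;> simp

/-- The coordinates of a form of degree `k`. -/
def extPowEquiv (k : ℕ) :
    extPow K n X k ≃ₗ[K] ({J : Finset (Fin n) // J.card = k} → X) where
  toFun α := fun J => α.1 J.1
  map_add' _ _ := rfl
  map_smul' _ _ := rfl
  invFun f := ⟨fun J => if h : J.card = k then f ⟨J, h⟩ else 0, fun J hJ => dif_neg hJ⟩
  left_inv α := by
    apply Subtype.ext
    funext J
    by_cases h : J.card = k
    · simp [h]
    · simp [h, α.2 J h]
  right_inv f := by
    funext J
    simp [J.2]

instance [Module.Finite K X] (k : ℕ) : Module.Finite K (extPow K n X k) :=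
  Module.Finite.equiv (extPowEquiv k).symm

theorem finrank_extPow [Module.Finite K X] (k : ℕ) :
    Module.finrank K (extPow K n X k) = n.choose k * Module.finrank K X := by
  rw [LinearEquiv.finrank_eq (extPowEquiv k), Module.finrank_pi_fintype, Finset.sum_const,
    Finset.card_univ, smul_eq_mul]
  congr 1
  rw [Fintype.card_subtype, ← Finset.card_fin n, ← Finset.card_powersetCard, Finset.card_fin]
  congr 1
  ext J
  simp [Finset.mem_powersetCard]

end Exterior

/-! ### The polynomial Koszul complex -/

section Koszul

open TensorProduct MvPolynomial

variable {K : Type*} [Field K] {n : ℕ} {U W : Type*} [AddCommGroup U] [Module K U]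
  [AddCommGroup W] [Module K W]

/-- The Koszul differential on `K[χ] ⊗ ∧ ⊗ X`. -/
def koszul (k : ℕ) : MvPolynomial (Fin n) K ⊗[K] extPow K n U (k + 1)
    →ₗ[MvPolynomial (Fin n) K] MvPolynomial (Fin n) K ⊗[K] extPow K n U k :=
  ∑ i, (X i : MvPolynomial (Fin n) K) • (contrL k i).baseChange (MvPolynomial (Fin n) K)

theorem koszul_tmul (k : ℕ) (f : MvPolynomial (Fin n) K) (α : extPow K n U (k + 1)) :
    koszul k (f ⊗ₜ α) = ∑ i, (X i * f) ⊗ₜ[K] contrL k i α := by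
  rw [koszul, LinearMap.sum_apply]
  refine Finset.sum_congr rfl fun i _ => ?_
  rw [LinearMap.smul_apply, LinearMap.baseChange_tmul, TensorProduct.smul_tmul', smul_eq_mul]

theorem koszul_koszul [CharZero K] (k : ℕ) (α : MvPolynomial (Fin n) K ⊗[K] extPow K n U (k + 2)) :
    koszul k (koszul (k + 1) α) = 0 := by
  induction α using TensorProduct.induction_on with
  | zero => simp
  | tmul p α =>
    simp only [koszul_tmul, map_sum]
    -- Exchanging the two summation indices changes the sign: the variables commute and the
    -- contractions anticommute.
    have h : ∑ i : Fin n, ∑ j : Fin n, (X j * (X i * p)) ⊗ₜ[K] contrL k j (contrL (k + 1) i α)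
        = -∑ i : Fin n, ∑ j : Fin n, (X j * (X i * p)) ⊗ₜ[K] contrL k j (contrL (k + 1) i α) := by
      conv_lhs => rw [Finset.sum_comm]
      rw [← Finset.sum_neg_distrib]
      refine Finset.sum_congr rfl fun i _ => ?_
      rw [← Finset.sum_neg_distrib]
      refine Finset.sum_congr rfl fun j _ => ?_
      rw [contrL_contrL, TensorProduct.tmul_neg, mul_left_comm]
    refine (smul_eq_zero.1 ?_).resolve_left (two_ne_zero (α := K))
    rw [two_smul]
    exact add_eq_zero_iff_eq_neg.2 h
  | add a b ha hb => simp [ha, hb]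

/-- The contracting homotopy of the Koszul complex. -/
def koszulHomotopy (k : ℕ) : MvPolynomial (Fin n) K ⊗[K] extPow K n U k
    →ₗ[K] MvPolynomial (Fin n) K ⊗[K] extPow K n U (k + 1) :=
  ∑ i, TensorProduct.map (pderiv i : Derivation K _ _).toLinearMap (wedgeL k i)

theorem koszulHomotopy_tmul (k : ℕ) (f : MvPolynomial (Fin n) K) (α : extPow K n U k) :
    koszulHomotopy k (f ⊗ₜ α) = ∑ i, (pderiv i f) ⊗ₜ[K] wedgeL k i α := by
  rw [koszulHomotopy, LinearMap.sum_apply]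
  rfl

/-- Cartan's formula: the anticommutator of the Koszul differential and the de Rham-type homotopy is
the Euler operator, which on polynomial degree `p` and form degree `k + 1` is multiplication by `p +
k + 1`. -/
theorem koszul_koszulHomotopy (k : ℕ) (f : MvPolynomial (Fin n) K) (α : extPow K n U (k + 1)) :
    koszul (k + 1) (koszulHomotopy (k + 1) (f ⊗ₜ[K] α)) + koszulHomotopy k (koszul k (f ⊗ₜ[K] α))
      = (∑ i, X i * pderiv i f + ((k + 1 : ℕ) : K) • f) ⊗ₜ[K] α := by
  simp only [koszul_tmul, koszulHomotopy_tmul, map_sum]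
  rw [Finset.sum_comm, ← Finset.sum_add_distrib]
  have (i : Fin n) :
      ∑ j, (X i * pderiv j f) ⊗ₜ[K] contrL (k + 1) i (wedgeL (k + 1) j α)
        + ∑ j, (pderiv j (X i * f)) ⊗ₜ[K] wedgeL k j (contrL k i α)
      = (X i * pderiv i f) ⊗ₜ[K] α + f ⊗ₜ[K] wedgeL k i (contrL k i α) := by
    have h (j : Fin n) : (X i * pderiv j f) ⊗ₜ[K] contrL (k + 1) i (wedgeL (k + 1) j α)
          + (pderiv j (X i * f)) ⊗ₜ[K] wedgeL k j (contrL k i α)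
        = (if i = j then (X i * pderiv i f) ⊗ₜ[K] α else 0)
          + if i = j then f ⊗ₜ[K] wedgeL k i (contrL k i α) else 0 := by
      have e := contrL_wedgeL k i j α
      rw [pderiv_mul, pderiv_X, TensorProduct.add_tmul, add_left_comm, ← TensorProduct.tmul_add, e]
      by_cases hij : i = j
      · subst hij
        simp [add_comm]
      · simp [hij]
    rw [← Finset.sum_add_distrib, Finset.sum_congr rfl fun j _ => h j, Finset.sum_add_distrib]
    simp
  rw [Finset.sum_congr rfl fun i _ => this i, Finset.sum_add_distrib, ← TensorProduct.tmul_sum,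
    sum_wedgeL_contrL, TensorProduct.add_tmul, TensorProduct.sum_tmul, TensorProduct.tmul_smul,
    TensorProduct.smul_tmul']

variable (K n) in
/-- Division of the part of degree `p` by `p + k`. -/
def degreeDiv (k : ℕ) : MvPolynomial (Fin n) K →ₗ[K] MvPolynomial (Fin n) K :=
  (basisMonomials (Fin n) K).constr K fun μ => ((μ.degree + k : ℕ) : K)⁻¹ • monomial μ 1

theorem degreeDiv_monomial (k : ℕ) (μ : Fin n →₀ ℕ) :
    degreeDiv K n k (monomial μ 1) = ((μ.degree + k : ℕ) : K)⁻¹ • monomial μ 1 := by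
  have := (basisMonomials (Fin n) K).constr_basis K
    (fun μ => ((μ.degree + k : ℕ) : K)⁻¹ • monomial μ (1 : K)) μ
  rwa [coe_basisMonomials] at this

/-- The Koszul differential raises the polynomial degree by one and lowers the form degree by one,
so their sum is unchanged. Hence division by this sum commutes with the differential. -/
theorem degreeDiv_X_mul (k : ℕ) (i : Fin n) (f : MvPolynomial (Fin n) K) :
    degreeDiv K n k (X i * f) = X i * degreeDiv K n (k + 1) f := by
  suffices h : degreeDiv K n k ∘ₗ LinearMap.mulLeft K (X i)
      = LinearMap.mulLeft K (X i) ∘ₗ degreeDiv K n (k + 1) from LinearMap.congr_fun h f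
  refine (basisMonomials (Fin n) K).ext fun μ => ?_
  have e : (X i : MvPolynomial (Fin n) K) * monomial μ 1 = monomial (Finsupp.single i 1 + μ) 1 := by
    rw [X, monomial_mul, one_mul]
  simp only [coe_basisMonomials, LinearMap.comp_apply, LinearMap.mulLeft_apply, e,
    degreeDiv_monomial, mul_smul_comm]
  rw [map_add, Finsupp.degree_single]
  congr 3
  ring

theorem euler_degreeDiv [CharZero K] (k : ℕ) (f : MvPolynomial (Fin n) K) :
    ∑ i, X i * pderiv i (degreeDiv K n (k + 1) f) + ((k + 1 : ℕ) : K) • degreeDiv K n (k + 1) f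
      = f := by
  suffices h : (∑ i, LinearMap.mulLeft K (X i) ∘ₗ (pderiv i : Derivation K _ _).toLinearMap
        + ((k + 1 : ℕ) : K) • LinearMap.id) ∘ₗ degreeDiv K n (k + 1) = LinearMap.id by
    have := LinearMap.congr_fun h f
    simpa [LinearMap.sum_apply] using this
  refine (basisMonomials (Fin n) K).ext fun μ => ?_
  have hne : ((μ.degree + (k + 1) : ℕ) : K) ≠ 0 := Nat.cast_ne_zero.2 (by omega)
  have e (i : Fin n) : X i * pderiv i (monomial μ (1 : K)) = (μ i : K) • monomial μ 1 := by
    rw [X_mul_pderiv_monomial, ← Nat.cast_smul_eq_nsmul K]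
  simp only [coe_basisMonomials, LinearMap.comp_apply, degreeDiv_monomial, LinearMap.add_apply,
    LinearMap.sum_apply, LinearMap.mulLeft_apply, map_smul, LinearMap.smul_apply,
    LinearMap.id_apply, Derivation.coeFn_coe, e]
  rw [← Finset.sum_smul, ← add_smul, smul_smul, ← Nat.cast_sum,
    ← Nat.cast_add, ← Finsupp.degree_eq_sum, inv_mul_cancel₀ hne, one_smul]

/-- The Koszul complex is exact in positive degree. -/
theorem koszul_exact [CharZero K] (k : ℕ)
    {α : MvPolynomial (Fin n) K ⊗[K] extPow K n U (k + 1)} (hα : koszul k α = 0) :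
    ∃ β, koszul (k + 1) β = α := by
  -- Rescaling by the inverse eigenvalues of the Euler operator turns the homotopy into a genuine
  -- contraction in positive form degree.
  let E (j : ℕ) : MvPolynomial (Fin n) K ⊗[K] extPow K n U j →ₗ[K]
      MvPolynomial (Fin n) K ⊗[K] extPow K n U j :=
    TensorProduct.map (degreeDiv K n j) LinearMap.id
  have h1 (a : MvPolynomial (Fin n) K ⊗[K] extPow K n U (k + 1)) :
      koszul k (E (k + 1) a) = E k (koszul k a) := by
    induction a using TensorProduct.induction_on with
    | zero => simp
    | tmul p a => simp [E, koszul_tmul, degreeDiv_X_mul]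
    | add a b ha hb => simp [ha, hb]
  have h2 (a : MvPolynomial (Fin n) K ⊗[K] extPow K n U (k + 1)) :
      koszul (k + 1) (koszulHomotopy (k + 1) (E (k + 1) a))
        + koszulHomotopy k (koszul k (E (k + 1) a)) = a := by
    induction a using TensorProduct.induction_on with
    | zero => simp
    | tmul p a =>
      have := koszul_koszulHomotopy k (degreeDiv K n (k + 1) p) a
      rwa [euler_degreeDiv] at this
    | add a b ha hb =>
      simp only [map_add] at ha hb ⊢
      rw [add_add_add_comm, ha, hb]
  refine ⟨koszulHomotopy (k + 1) (E (k + 1) α), ?_⟩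
  have := h2 α
  rwa [h1, hα, map_zero, map_zero, add_zero] at this

end Koszul

/-! ### The algebraic differential of a graded module -/

section Algebraic

open TensorProduct MvPolynomial

variable {K : Type*} [Field K] {n : ℕ} {U V W : Type*} [AddCommGroup U] [Module K U]
  [AddCommGroup V] [Module K V] [AddCommGroup W] [Module K W]

theorem extMap_extMap (k : ℕ) (g : V →ₗ[K] W) (f : U →ₗ[K] V) (α : extPow K n U k) :
    extMap k g (extMap k f α) = extMap k (g ∘ₗ f) α := rfl

/-- The differential `∑ x_i ⊗ i_{χ_i}` on forms defined by a family of maps `x_i`. -/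
def algDiff (x : Fin n → U →ₗ[K] V) (k : ℕ) : extPow K n U (k + 1) →ₗ[K] extPow K n V k :=
  ∑ i, extMap k (x i) ∘ₗ contrL k i

theorem algDiff_apply (x : Fin n → U →ₗ[K] V) (k : ℕ) (α : extPow K n U (k + 1)) :
    algDiff x k α = ∑ i, extMap k (x i) (contrL k i α) := by
  rw [algDiff, LinearMap.sum_apply]
  rfl

theorem algDiff_algDiff [CharZero K] {x : Fin n → U →ₗ[K] V} {y : Fin n → V →ₗ[K] W}
    (h : ∀ i j u, y i (x j u) = y j (x i u)) (k : ℕ) (α : extPow K n U (k + 2)) :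
    algDiff y k (algDiff x (k + 1) α) = 0 := by
  have h' (i j : Fin n) : y i ∘ₗ x j = y j ∘ₗ x i := LinearMap.ext fun u => h i j u
  simp only [algDiff_apply, map_sum, contrL_extMap, extMap_extMap]
  refine (smul_eq_zero.1 ?_).resolve_left (two_ne_zero (α := K))
  rw [two_smul]
  conv_lhs => enter [2]; rw [Finset.sum_comm]
  simp only [← Finset.sum_add_distrib]
  refine Finset.sum_eq_zero fun i _ => Finset.sum_eq_zero fun j _ => ?_
  rw [h', contrL_contrL, map_neg, neg_add_cancel]

theorem contrL_algDiff (x : Fin n → U →ₗ[K] V) (k : ℕ) (i : Fin n) (α : extPow K n U (k + 2)) :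
    contrL k i (algDiff x (k + 1) α) = -algDiff x k (contrL (k + 1) i α) := by
  simp only [algDiff_apply, map_sum, contrL_extMap, ← Finset.sum_neg_distrib]
  refine Finset.sum_congr rfl fun j _ => ?_
  rw [contrL_contrL, map_neg]

/-- Both differentials contract a form index, hence they anticommute; this is the sign convention of
the double complex. -/
theorem koszul_algDiff (x : Fin n → U →ₗ[K] V) (k : ℕ)
    (α : MvPolynomial (Fin n) K ⊗[K] extPow K n U (k + 2)) :
    koszul k ((algDiff x (k + 1)).baseChange (MvPolynomial (Fin n) K) α)
      = -(algDiff x k).baseChange (MvPolynomial (Fin n) K) (koszul (k + 1) α) := by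
  induction α using TensorProduct.induction_on with
  | zero => simp
  | tmul p α => simp [koszul_tmul, contrL_algDiff, TensorProduct.tmul_neg]
  | add a b ha hb => simp [ha, hb, add_comm]

/-- The scalar counts the indices that do not occur in a set of size `k`. -/
theorem sum_contr_wedge {k : ℕ} {α : Finset (Fin n) → U} (hα : α ∈ extPow K n U k) :
    ∑ i, contr K U i (wedge K U i α) = ((n : K) - k) • α := by
  have h (i : Fin n) : contr K U i (wedge K U i α) = α - wedge K U i (contr K U i α) := by
    rw [eq_sub_iff_add_eq, contr_wedge, if_pos rfl]
  rw [Finset.sum_congr rfl fun i _ => h i, Finset.sum_sub_distrib]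
  funext J
  rw [Pi.sub_apply, sum_wedge_contr, Finset.sum_const, Finset.card_univ, Fintype.card_fin]
  by_cases hJ : J.card = k
  · rw [hJ, Pi.smul_apply, Pi.smul_apply, sub_smul, Nat.cast_smul_eq_nsmul, Nat.cast_smul_eq_nsmul]
  · rw [Pi.smul_apply, Pi.smul_apply, hα J hJ, smul_zero, smul_zero, smul_zero, sub_zero]

/-- A short complex of finite-dimensional spaces with the right dimensions is exact. -/
theorem exact_of_finrank [Module.Finite K U] [Module.Finite K V] [Module.Finite K W]
    {f : U →ₗ[K] V} {g : V →ₗ[K] W} (hf : Function.Injective f) (hg : Function.Surjective g)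
    (hgf : ∀ u, g (f u) = 0)
    (hdim : Module.finrank K V = Module.finrank K U + Module.finrank K W) :
    Function.Exact f g := by
  have h1 : LinearMap.range f ≤ LinearMap.ker g := by
    rintro _ ⟨u, rfl⟩
    exact hgf u
  have h2 := LinearMap.finrank_range_add_finrank_ker g
  rw [LinearMap.range_eq_top.2 hg, finrank_top] at h2
  have h3 := LinearMap.finrank_range_of_inj hf
  have h4 := Submodule.eq_of_le_of_finrank_eq h1 (by omega)
  exact LinearMap.exact_iff.2 h4.symm

end Algebraic

/-! ### The graded module dual to the symbols of the conformal Killing equations -/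

section ConformalModule

variable {K : Type*} [Field K] {n : ℕ}

variable (K n) in
/-- Skew-symmetric matrices. -/
def skewMatrices : Submodule K (Fin n → Fin n → K) where
  carrier := {a | ∀ i j, a i j = -a j i}
  add_mem' := by
    intro a b ha hb i j
    rw [Pi.add_apply, Pi.add_apply, ha i j, hb i j, Pi.add_apply, Pi.add_apply]
    ring
  zero_mem' := fun i j => by simp
  smul_mem' := by
    intro c a ha i j
    rw [Pi.smul_apply, Pi.smul_apply, ha i j, Pi.smul_apply, Pi.smul_apply, smul_neg]

theorem finrank_skewMatrices [CharZero K] : Module.finrank K (skewMatrices K 4) = 6 := by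
  have e : skewMatrices K 4 ≃ₗ[K] (Fin 6 → K) :=
    { toFun := fun a => ![a.1 0 1, a.1 0 2, a.1 0 3, a.1 1 2, a.1 1 3, a.1 2 3]
      map_add' := fun a b => by
        ext i
        fin_cases i <;> rfl
      map_smul' := fun c a => by
        ext i
        fin_cases i <;> rfl
      invFun := fun v => ⟨![![0, v 0, v 1, v 2], ![-v 0, 0, v 3, v 4], ![-v 1, -v 3, 0, v 5],
        ![-v 2, -v 4, -v 5, 0]], fun i j => by fin_cases i <;> fin_cases j <;> simp⟩
      left_inv := fun a => by
        have h (i : Fin 4) : a.1 i i = 0 := self_eq_neg.1 (a.2 i i)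
        apply Subtype.ext
        funext i j
        fin_cases i <;> fin_cases j <;> simp [h, ← a.2 1 0, ← a.2 2 0, ← a.2 3 0, ← a.2 2 1,
          ← a.2 3 1, ← a.2 3 2]
      right_inv := fun v => by
        ext i
        fin_cases i <;> rfl }
  rw [e.finrank_eq, Module.finrank_fin_fun]

variable (ω : Matrix (Fin n) (Fin n) K)

/-- The multiplication `χ_i` from degree `0` to degree `1`. -/
def mulZero (i : Fin n) : (Fin n → K) →ₗ[K] skewMatrices K n × K where
  toFun u := (⟨fun s r => ω i s * u r - ω i r * u s, fun s r => by ring⟩, u i)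
  map_add' u v := by
    refine Prod.ext (Subtype.ext ?_) rfl
    funext s r
    change ω i s * (u r + v r) - ω i r * (u s + v s)
      = ω i s * u r - ω i r * u s + (ω i s * v r - ω i r * v s)
    ring
  map_smul' c u := by
    refine Prod.ext (Subtype.ext ?_) rfl
    funext s r
    change ω i s * (c * u r) - ω i r * (c * u s) = c * (ω i s * u r - ω i r * u s)
    ring

/-- The multiplication `χ_i` from degree `1` to degree `2`. -/
def mulOne (i : Fin n) : skewMatrices K n × K →ₗ[K] (Fin n → K) where
  toFun a := fun k => a.1.1 i k - ω i k * a.2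
  map_add' a b := by
    funext k
    change a.1.1 i k + b.1.1 i k - ω i k * (a.2 + b.2) = _
    simp only [Pi.add_apply]
    ring
  map_smul' c a := by
    funext k
    change c * a.1.1 i k - ω i k * (c * a.2) = c * (a.1.1 i k - ω i k * a.2)
    ring

variable {ω}

/-- With pieces in degrees 0, 1, 2 only, this is the one relation needed for a module over the
polynomial ring. It is also what makes the columns complexes. -/
theorem mulOne_mulZero (hω : ω.IsSymm) (i j : Fin n) (u : Fin n → K) :
    mulOne ω i (mulZero ω j u) = mulOne ω j (mulZero ω i u) := by
  funext k
  change ω j i * u k - ω j k * u i - ω i k * u j = ω i j * u k - ω i k * u j - ω j k * u i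
  rw [hω.apply i j]
  ring

/-- A tensor that is skew in the first two and symmetric in the last two indices vanishes. -/
theorem eq_zero_of_skew_of_symm [CharZero K] {U ι : Type*} [AddCommGroup U] [Module K U]
    {T : ι → ι → ι → U} (h1 : ∀ a b c, T a b c = -T b a c) (h2 : ∀ a b c, T a b c = T a c b)
    (a b c : ι) : T a b c = 0 := by
  have h : T a b c = -T a b c := by
    conv_lhs => rw [h1, h2, h1, h2, h1, h2]
    simp
  refine (smul_eq_zero.1 ?_).resolve_left (two_ne_zero (α := K))
  rw [two_smul]
  exact add_eq_zero_iff_eq_neg.2 h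

/-- The skew part of the equation says that `i_s a_r`, with the contraction index lowered by `ω`, is
symmetric in `s, r`. Then `i_s i_t a_r` is skew in `s, t` and symmetric in `t, r`, so it vanishes.
Forms of degree at least 2 are determined by their double contractions. -/
theorem algDiff_mulZero_injective [CharZero K] (hdet : ω.det ≠ 0) (k : ℕ) :
    Function.Injective (algDiff (mulZero ω) (k + 1)) := by
  rw [injective_iff_map_eq_zero]
  intro α hα
  let a (r : Fin n) : extPow K n K (k + 2) := extMap (k + 2) (LinearMap.proj r) α
  let ib (j : ℕ) (s : Fin n) : extPow K n K (j + 1) →ₗ[K] extPow K n K j :=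
    ∑ i, ω i s • contrL j i
  have hib (j : ℕ) (s : Fin n) (β : extPow K n K (j + 1)) :
      ib j s β = ∑ i, ω i s • contrL j i β := by
    simp [ib, LinearMap.sum_apply]
  have hskew (s t r : Fin n) : ib k s (ib (k + 1) t (a r)) = -ib k t (ib (k + 1) s (a r)) := by
    simp only [hib, map_sum, map_smul, Finset.smul_sum, ← Finset.sum_neg_distrib]
    rw [Finset.sum_comm]
    refine Finset.sum_congr rfl fun i _ => Finset.sum_congr rfl fun j _ => ?_
    rw [contrL_contrL, smul_neg, smul_neg, smul_comm]
  have hsymm (s r : Fin n) : ib (k + 1) s (a r) = ib (k + 1) r (a s) := by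
    let p : skewMatrices K n × K →ₗ[K] K :=
      LinearMap.proj r ∘ₗ LinearMap.proj s ∘ₗ (skewMatrices K n).subtype ∘ₗ LinearMap.fst K _ _
    have h := congrArg (extMap (k + 1) p) hα
    rw [map_zero, algDiff_apply, map_sum] at h
    have e (i : Fin n) : extMap (k + 1) p (extMap (k + 1) (mulZero ω i) (contrL (k + 1) i α))
        = ω i s • contrL (k + 1) i (a r) - ω i r • contrL (k + 1) i (a s) := by
      rw [contrL_extMap, contrL_extMap]
      rfl
    rw [Finset.sum_congr rfl fun i _ => e i, Finset.sum_sub_distrib, ← hib, ← hib] at h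
    exact sub_eq_zero.1 h
  have hzero (s t r : Fin n) : ib k s (ib (k + 1) t (a r)) = 0 :=
    eq_zero_of_skew_of_symm (K := K) (T := fun s t r => ib k s (ib (k + 1) t (a r))) hskew
      (fun s t r => by rw [hsymm]) s t r
  have hinv (j : ℕ) (i : Fin n) (β : extPow K n K (j + 1)) :
      contrL j i β = ∑ s, ω⁻¹ s i • ib j s β := by
    simp only [hib, Finset.smul_sum, smul_smul]
    rw [Finset.sum_comm]
    have h (l : Fin n) : ∑ s, (ω⁻¹ s i * ω l s) • contrL j l β
        = (1 : Matrix (Fin n) (Fin n) K) l i • contrL j l β := by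
      rw [← Matrix.mul_nonsing_inv ω (isUnit_iff_ne_zero.2 hdet), Matrix.mul_apply,
        Finset.sum_smul]
      exact Finset.sum_congr rfl fun s _ => by rw [mul_comm]
    rw [Finset.sum_congr rfl fun l _ => h l]
    simp [Matrix.one_apply]
  have hcontr (s : Fin n) (β : extPow K n K (k + 1)) (h : ∀ s, ib k s β = 0) : β = 0 :=
    eq_zero_of_contrL fun i => by rw [hinv]; simp [h]
  have ha (r : Fin n) : a r = 0 := eq_zero_of_contrL fun i => by
    rw [hinv]
    exact Finset.sum_eq_zero fun s _ => by
      rw [hcontr s _ (fun t => hzero t s r), smul_zero]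
  apply Subtype.ext
  funext J r
  exact congrFun (congrArg Subtype.val (ha r)) J

/-- The skew component alone suffices. From `λ_{jr} = dx^j ∧ w_r - dx^r ∧ w_j` one gets a nonzero
multiple of `w_r` plus an error `dx^r ∧ τ`, where `τ` is the trace of `w`; the same construction
applied to the error reproduces it up to a nonzero factor. -/
theorem algDiff_mulOne_surjective [CharZero K] {k : ℕ} (hk : k + 2 ≤ n) :
    Function.Surjective (algDiff (mulOne ω) k) := by
  intro v
  let lam (w : Fin n → Finset (Fin n) → K) (j r : Fin n) : Finset (Fin n) → K :=
    wedge K K j (w r) - wedge K K r (w j)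
  let w (r : Fin n) : Finset (Fin n) → K := fun J => v.1 J r
  have hw (r : Fin n) : w r ∈ extPow K n K k := fun J hJ => congrFun (v.2 J hJ) r
  let τ : Finset (Fin n) → K := ∑ j, contr K K j (w j)
  have hτ (r : Fin n) : wedge K K r τ ∈ extPow K n K k := by
    rw [map_sum]
    refine Submodule.sum_mem _ fun j _ => ?_
    cases k with
    | zero =>
      rw [contr_eq_zero j (hw j), map_zero]
      exact Submodule.zero_mem _
    | succ k => exact wedge_mem r (contr_mem j (hw j))
  have hlam (c : Fin n → Finset (Fin n) → K) (hc : ∀ r, c r ∈ extPow K n K k) :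
      ∃ α : extPow K n (skewMatrices K n × K) (k + 1), ∀ r,
        extMap k (LinearMap.proj r) (algDiff (mulOne ω) k α)
          = ∑ j, contr K K j (lam c j r) := by
    refine ⟨⟨fun J => (⟨fun j r => lam c j r J, fun j r => ?_⟩, 0), fun J hJ => ?_⟩, fun r => ?_⟩
    · simp [lam]
    · refine Prod.ext (Subtype.ext ?_) rfl
      funext j r
      simp [lam, wedge_mem j (hc r) J hJ, wedge_mem r (hc j) J hJ]
    · rw [algDiff_apply, map_sum, AddSubmonoidClass.coe_finsetSum]
      refine Finset.sum_congr rfl fun j _ => ?_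
      rw [extMap_extMap, ← contrL_extMap]
      change contr K K j _ = contr K K j _
      congr 1
      funext J
      change lam c j r J - ω j r * 0 = _
      rw [mul_zero, sub_zero]
  obtain ⟨α, hα⟩ := hlam w hw
  obtain ⟨β, hβ⟩ := hlam (fun r => wedge K K r τ) hτ
  have h1 (r : Fin n) : ∑ j, contr K K j (lam w j r) = ((n : K) - k - 1) • w r + wedge K K r τ := by
    simp only [lam, map_sub, Finset.sum_sub_distrib]
    rw [sum_contr_wedge (hw r)]
    have e (j : Fin n) : contr K K j (wedge K K r (w j))
        = (if j = r then w j else 0) - wedge K K r (contr K K j (w j)) :=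
      eq_sub_of_add_eq (contr_wedge j r (w j))
    rw [Finset.sum_congr rfl fun j _ => e j, Finset.sum_sub_distrib, ← map_sum]
    simp only [Finset.sum_ite_eq', Finset.mem_univ, if_true, sub_smul, one_smul]
    abel
  have h2 (r : Fin n) : ∑ j, contr K K j (lam (fun r => wedge K K r τ) j r)
      = (2 * ((n : K) - k)) • wedge K K r τ := by
    have e (j : Fin n) : lam (fun r => wedge K K r τ) j r
        = (2 : K) • wedge K K j (wedge K K r τ) := by
      simp only [lam]
      rw [wedge_wedge r j, sub_neg_eq_add, two_smul]
    rw [Finset.sum_congr rfl fun j _ => by rw [e, map_smul], ← Finset.smul_sum,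
      sum_contr_wedge (hτ r), smul_smul]
  have hn : (n : K) - k ≠ 0 := by
    rw [sub_ne_zero, Ne, Nat.cast_inj]
    omega
  have hn' : (n : K) - k - 1 ≠ 0 := by
    have : ((n : K) - k - 1) = (n : K) - ((k + 1 : ℕ) : K) := by
      push_cast
      ring
    rw [this, sub_ne_zero, Ne, Nat.cast_inj]
    omega
  -- By `h1` and `h2`, `α` gives `(n - k - 1) w_r + dx^r ∧ τ` and `β` gives `2 (n - k) dx^r ∧ τ`; `k
  -- + 2 ≤ n` keeps both constants nonzero.
  refine ⟨((n : K) - k - 1)⁻¹ • (α + (-(2 * ((n : K) - k))⁻¹) • β), ?_⟩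
  have h3 (r : Fin n) : (extMap k (LinearMap.proj r) (algDiff (mulOne ω) k
      (((n : K) - k - 1)⁻¹ • (α + (-(2 * ((n : K) - k))⁻¹) • β))) : Finset (Fin n) → K) = w r := by
    simp only [map_smul, map_add]
    change ((n : K) - k - 1)⁻¹ • ((extMap k (LinearMap.proj r) (algDiff (mulOne ω) k α)).1
      + (-(2 * ((n : K) - k))⁻¹) • (extMap k (LinearMap.proj r) (algDiff (mulOne ω) k β)).1) = w r
    rw [hα, hβ, h1, h2, smul_smul, neg_mul, inv_mul_cancel₀ (mul_ne_zero two_ne_zero hn), neg_smul,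
      one_smul, add_neg_cancel_right, smul_smul, inv_mul_cancel₀ hn', one_smul]
  apply Subtype.ext
  funext J r
  exact congrFun (h3 r) J

/-- An explicit right inverse: half of the skew matrix with its first index raised recovers the skew
part and has trace zero, while the scalar is recovered by the identity matrix divided by `n`, whose
skew part vanishes. -/
theorem algDiff_mulZero_surjective [CharZero K] (hω : ω.IsSymm) (hdet : ω.det ≠ 0) (hn : n ≠ 0) :
    Function.Surjective (algDiff (mulZero ω) 0) := by
  let f (i : Fin n) : skewMatrices K n × K →ₗ[K] (Fin n → K) :=
    { toFun := fun a r => (1 / 2) * ∑ s, ω⁻¹ i s * a.1.1 s r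
        + (if i = r then 1 / (n : K) else 0) * a.2
      map_add' := fun a b => by
        funext r
        change (1 / 2) * ∑ s, ω⁻¹ i s * (a.1.1 s r + b.1.1 s r) + _ * (a.2 + b.2) = _
        simp only [mul_add, Finset.sum_add_distrib, Pi.add_apply]
        ring
      map_smul' := fun c a => by
        funext r
        change (1 / 2) * ∑ s, ω⁻¹ i s * (c * a.1.1 s r) + _ * (c * a.2) = c * (_ + _)
        simp only [mul_left_comm _ c, ← Finset.mul_sum]
        ring }
  have hinv : ω * ω⁻¹ = 1 := Matrix.mul_nonsing_inv ω (isUnit_iff_ne_zero.2 hdet)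
  have hsum (a : skewMatrices K n × K) (s r : Fin n) :
      ∑ i, ω i s * f i a r = 1 / 2 * a.1.1 s r + ω s r * (1 / (n : K)) * a.2 := by
    have e1 : ∑ i, ω i s * ∑ t, ω⁻¹ i t * a.1.1 t r = a.1.1 s r := by
      have : ∑ i, ω i s * ∑ t, ω⁻¹ i t * a.1.1 t r = (ω * (ω⁻¹ * Matrix.of a.1.1)) s r := by
        simp only [Matrix.mul_apply, Matrix.of_apply]
        exact Finset.sum_congr rfl fun i _ => by rw [hω.apply s i]
      rw [this, ← Matrix.mul_assoc, hinv, Matrix.one_mul, Matrix.of_apply]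
    have e2 (i : Fin n) : ω i s * f i a r = 1 / 2 * (ω i s * ∑ t, ω⁻¹ i t * a.1.1 t r)
        + (if i = r then ω i s * (1 / (n : K)) * a.2 else 0) := by
      change ω i s * ((1 / 2) * _ + _) = _
      split_ifs <;> ring
    rw [Finset.sum_congr rfl fun i _ => e2 i, Finset.sum_add_distrib, ← Finset.mul_sum, e1,
      Finset.sum_ite_eq', if_pos (Finset.mem_univ r), hω.apply s r]
  have htrace (a : skewMatrices K n × K) : ∑ i, f i a i = a.2 := by
    have e1 : ∑ i, ∑ s, ω⁻¹ i s * a.1.1 s i = 0 := by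
      have hs : (ω⁻¹).IsSymm := by
        rw [Matrix.IsSymm, Matrix.transpose_nonsing_inv, hω.eq]
      have h : ∑ i, ∑ s, ω⁻¹ i s * a.1.1 s i = -∑ i, ∑ s, ω⁻¹ i s * a.1.1 s i := by
        conv_lhs => rw [Finset.sum_comm]
        simp only [← Finset.sum_neg_distrib]
        refine Finset.sum_congr rfl fun i _ => Finset.sum_congr rfl fun s _ => ?_
        rw [a.1.2 i s, hs.apply i s]
        ring
      exact self_eq_neg.1 h
    have hn' : (n : K) ≠ 0 := Nat.cast_ne_zero.2 hn
    change ∑ i, ((1 / 2) * ∑ s, ω⁻¹ i s * a.1.1 s i + (if i = i then 1 / (n : K) else 0) * a.2) = _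
    rw [Finset.sum_add_distrib, ← Finset.mul_sum, e1]
    simp
    field_simp
  have hid : ∑ i, mulZero ω i ∘ₗ f i = LinearMap.id := by
    refine LinearMap.ext fun a => ?_
    rw [LinearMap.sum_apply]
    refine Prod.ext (Subtype.ext ?_) ?_
    · rw [Prod.fst_sum, AddSubmonoidClass.coe_finsetSum]
      funext s r
      rw [Finset.sum_apply, Finset.sum_apply]
      change ∑ i, (ω i s * f i a r - ω i r * f i a s) = a.1.1 s r
      rw [Finset.sum_sub_distrib, hsum, hsum, hω.apply s r, a.1.2 r s]
      ring
    · rw [Prod.snd_sum]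
      exact htrace a
  intro a
  refine ⟨∑ i, wedgeL 0 i (extMap 0 (f i) a), ?_⟩
  have h1 (j : Fin n) : contrL 0 j (∑ i, wedgeL 0 i (extMap 0 (f i) a)) = extMap 0 (f j) a := by
    simp only [map_sum, contrL_wedgeL_zero]
    simp
  rw [algDiff_apply, Finset.sum_congr rfl fun j _ => by rw [h1, extMap_extMap]]
  apply Subtype.ext
  rw [AddSubmonoidClass.coe_finsetSum]
  funext J
  have := LinearMap.congr_fun hid (a.1 J)
  rw [LinearMap.sum_apply] at this
  rw [Finset.sum_apply]
  exact this

/-- In top degree `dx^j ∧ α = 0`, so `dx^j ∧ i_i α = δ_ij α`, and multiplying the equation by `dx^j`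
isolates the multiplication by `χ_j`. Each coefficient then has a skew part equal to a multiple of
the symmetric matrix `ω`, so both parts vanish. -/
theorem algDiff_mulOne_injective [CharZero K] (hω : ω.IsSymm) (hdet : ω.det ≠ 0) {k : ℕ}
    (hk : n = k + 1) : Function.Injective (algDiff (mulOne ω) k) := by
  rw [injective_iff_map_eq_zero]
  intro α hα
  have h1 (j : Fin n) : extMap (k + 1) (mulOne ω j) α = 0 := by
    have h := congrArg (wedgeL k j) hα
    rw [map_zero, algDiff_apply, map_sum] at h
    have e (i : Fin n) : wedgeL k j (contrL k i α) = if i = j then α else 0 := by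
      have h0 : wedgeL (k + 1) j α = 0 := Subtype.ext (extPow_eq_zero (by omega) (wedgeL _ j α).2)
      have := contrL_wedgeL k i j α
      rwa [h0, map_zero, zero_add] at this
    have e' (i : Fin n) : wedgeL k j (extMap k (mulOne ω i) (contrL k i α))
        = if i = j then extMap (k + 1) (mulOne ω i) α else 0 := by
      rw [wedgeL_extMap, e]
      split_ifs <;> simp
    rw [Finset.sum_congr rfl fun i _ => e' i] at h
    simpa using h
  have h2 (J : Finset (Fin n)) (i j : Fin n) : (α.1 J).1.1 i j = ω i j * (α.1 J).2 :=
    sub_eq_zero.1 (congrFun (congrFun (congrArg Subtype.val (h1 i)) J) j)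
  have h3 (J : Finset (Fin n)) (i j : Fin n) : ω i j * (α.1 J).2 = 0 := by
    have h := h2 J j i
    rw [(α.1 J).1.2 j i, hω.apply i j, h2 J i j] at h
    exact self_eq_neg.1 h.symm
  apply Subtype.ext
  funext J
  refine Prod.ext (Subtype.ext ?_) ?_
  · funext i j
    exact (h2 J i j).trans (h3 J i j)
  · by_contra hne
    have : ω = 0 := by
      ext i j
      exact (mul_eq_zero.1 (h3 J i j)).resolve_right hne
    rw [this] at hdet
    have : Nonempty (Fin n) := ⟨⟨0, by omega⟩⟩
    exact hdet Matrix.det_zero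

end ConformalModule

/-! ### Exact sequences obtained from a double complex with three rows -/

section DoubleComplex

/-- Three exact rows `A`, `B`, `C` (with last term in degree `4`) and column maps `p`, `q`, whose
homology is represented by `H₁` in `A 1`, `H₂` in `B 2`, `H₃` in `C 3`. -/
structure ThreeRows (S : Type*) [CommRing S] (A B C : ℕ → Type*) (H₁ H₂ H₃ : Type*)
    [∀ k, AddCommGroup (A k)] [∀ k, Module S (A k)] [∀ k, AddCommGroup (B k)]
    [∀ k, Module S (B k)] [∀ k, AddCommGroup (C k)] [∀ k, Module S (C k)] [AddCommGroup H₁]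
    [Module S H₁] [AddCommGroup H₂] [Module S H₂] [AddCommGroup H₃] [Module S H₃] where
  dA : ∀ k, A (k + 1) →ₗ[S] A k
  dB : ∀ k, B (k + 1) →ₗ[S] B k
  dC : ∀ k, C (k + 1) →ₗ[S] C k
  p : ∀ k, A (k + 1) →ₗ[S] B k
  q : ∀ k, B (k + 1) →ₗ[S] C k
  dA_dA : ∀ k x, dA k (dA (k + 1) x) = 0
  dB_dB : ∀ k x, dB k (dB (k + 1) x) = 0
  dC_dC : ∀ k x, dC k (dC (k + 1) x) = 0
  exactA : ∀ k x, dA k x = 0 → ∃ y, dA (k + 1) y = x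
  exactB : ∀ k x, dB k x = 0 → ∃ y, dB (k + 1) y = x
  exactC : ∀ k x, dC k x = 0 → ∃ y, dC (k + 1) y = x
  subsingletonA : Subsingleton (A 5)
  subsingletonB : Subsingleton (B 5)
  subsingletonC : Subsingleton (C 5)
  dB_p : ∀ k x, dB k (p (k + 1) x) = -p k (dA (k + 1) x)
  dC_q : ∀ k x, dC k (q (k + 1) x) = -q k (dB (k + 1) x)
  q_p : ∀ k x, q k (p (k + 1) x) = 0
  p_injective : ∀ k, Function.Injective (p (k + 1))
  q_surjective : ∀ x, ∃ y, q 2 y = x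
  exact_one : ∀ y, q 0 y = 0 → ∃ x, p 1 x = y
  exact_three : ∀ y, q 2 y = 0 → ∃ x, p 3 x = y
  i₁ : H₁ →ₗ[S] A 1
  i₂ : H₂ →ₗ[S] B 2
  i₃ : H₃ →ₗ[S] C 3
  j₁ : A 1 →ₗ[S] H₁
  j₂ : B 2 →ₗ[S] H₂
  j₃ : C 3 →ₗ[S] H₃
  j₁_i₁ : ∀ x, j₁ (i₁ x) = x
  p_i₁ : ∀ x, p 0 (i₁ x) = 0
  exists_i₁ : ∀ x, p 0 x = 0 → ∃ y, i₁ y = x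
  j₂_i₂ : ∀ x, j₂ (i₂ x) = x
  j₂_p : ∀ x, j₂ (p 2 x) = 0
  q_i₂ : ∀ x, q 1 (i₂ x) = 0
  exists_i₂ : ∀ x, q 1 x = 0 → ∃ y z, x = i₂ y + p 2 z
  j₃_i₃ : ∀ x, j₃ (i₃ x) = x
  j₃_q : ∀ x, j₃ (q 3 x) = 0
  exists_i₃ : ∀ x, ∃ y z, x = i₃ y + q 3 z
  s₁ : B 1 →ₗ[S] A 2
  s₁_p : ∀ x, s₁ (p 1 x) = x
  s₂ : C 2 →ₗ[S] B 3
  q_s₂ : ∀ x, q 2 (s₂ x) = x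

namespace ThreeRows

variable {S : Type*} [CommRing S] {A B C : ℕ → Type*} {H₁ H₂ H₃ : Type*}
  [∀ k, AddCommGroup (A k)] [∀ k, Module S (A k)] [∀ k, AddCommGroup (B k)]
  [∀ k, Module S (B k)] [∀ k, AddCommGroup (C k)] [∀ k, Module S (C k)] [AddCommGroup H₁]
  [Module S H₁] [AddCommGroup H₂] [Module S H₂] [AddCommGroup H₃] [Module S H₃]
  (R : ThreeRows S A B C H₁ H₂ H₃)

/-- The first differential. -/
def φ₁ : H₁ →ₗ[S] A 0 := R.dA 0 ∘ₗ R.i₁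

/-- The second differential. -/
def φ₂ : H₂ →ₗ[S] H₁ := R.j₁ ∘ₗ R.dA 1 ∘ₗ R.s₁ ∘ₗ R.dB 1 ∘ₗ R.i₂

/-- The third differential. -/
def φ₃ : H₃ →ₗ[S] H₂ := R.j₂ ∘ₗ R.dB 2 ∘ₗ R.s₂ ∘ₗ R.dC 2 ∘ₗ R.i₃

/-- The last differential. -/
def φ₄ : C 4 →ₗ[S] H₃ := R.j₃ ∘ₗ R.dC 3

/-- Describes the zigzag without the chosen splittings: any lift `u` gives the same value. The
chases use only this form. -/
theorem φ₂_eq_iff (b : H₂) (c : H₁) :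
    R.φ₂ b = c ↔ ∃ u, R.p 1 u = R.dB 1 (R.i₂ b) ∧ R.dA 1 u = R.i₁ c := by
  have key (u) (hu : R.p 1 u = R.dB 1 (R.i₂ b)) : R.φ₂ b = R.j₁ (R.dA 1 u) := by
    change R.j₁ (R.dA 1 (R.s₁ (R.dB 1 (R.i₂ b)))) = _
    rw [← hu, R.s₁_p]
  constructor
  · rintro rfl
    obtain ⟨u, hu⟩ := R.exact_one (R.dB 1 (R.i₂ b)) (by
      have := R.dC_q 0 (R.i₂ b)
      rw [R.q_i₂, map_zero] at this
      exact neg_eq_zero.1 this.symm)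
    refine ⟨u, hu, ?_⟩
    obtain ⟨y, hy⟩ := R.exists_i₁ (R.dA 1 u) (by
      have := R.dB_p 0 u
      rw [hu, R.dB_dB] at this
      exact neg_eq_zero.1 this.symm)
    rw [key u hu, ← hy, R.j₁_i₁]
  · rintro ⟨u, hu, hc⟩
    rw [key u hu, hc, R.j₁_i₁]

/-- Two lifts `v` differ by an element of the image of `p`, by exactness of the column; it is sent
to the image of `p` again, which `j₂` kills. -/
theorem φ₃_eq_iff (a : H₃) (b : H₂) :
    R.φ₃ a = b ↔ ∃ v w, R.q 2 v = R.dC 2 (R.i₃ a) ∧ R.dB 2 v = R.i₂ b + R.p 2 w := by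
  have key (v) (hv : R.q 2 v = R.dC 2 (R.i₃ a)) : R.φ₃ a = R.j₂ (R.dB 2 v) := by
    change R.j₂ (R.dB 2 (R.s₂ (R.dC 2 (R.i₃ a)))) = _
    rw [← sub_eq_zero, ← map_sub, ← map_sub]
    obtain ⟨x, hx⟩ := R.exact_three (R.s₂ (R.dC 2 (R.i₃ a)) - v) (by
      rw [map_sub, R.q_s₂, hv, sub_self])
    rw [← hx, R.dB_p, map_neg, R.j₂_p, neg_zero]
  constructor
  · rintro rfl
    have hv := R.q_s₂ (R.dC 2 (R.i₃ a))
    obtain ⟨y, z, hyz⟩ := R.exists_i₂ (R.dB 2 (R.s₂ (R.dC 2 (R.i₃ a)))) (by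
      have := R.dC_q 1 (R.s₂ (R.dC 2 (R.i₃ a)))
      rw [hv, R.dC_dC] at this
      exact neg_eq_zero.1 this.symm)
    refine ⟨_, z, hv, ?_⟩
    rw [key _ hv, hyz, map_add, R.j₂_p, R.j₂_i₂, add_zero]
  · rintro ⟨v, w, hv, hw⟩
    rw [key v hv, hw, map_add, R.j₂_p, R.j₂_i₂, add_zero]

theorem φ₄_eq_iff (h : C 4) (a : H₃) :
    R.φ₄ h = a ↔ ∃ y, R.dC 3 h = R.i₃ a + R.q 3 y := by
  constructor
  · rintro rfl
    obtain ⟨y, z, hyz⟩ := R.exists_i₃ (R.dC 3 h)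
    refine ⟨z, ?_⟩
    change R.dC 3 h = R.i₃ (R.j₃ (R.dC 3 h)) + R.q 3 z
    rw [hyz, map_add, R.j₃_q, R.j₃_i₃, add_zero]
  · rintro ⟨y, hy⟩
    change R.j₃ (R.dC 3 h) = a
    rw [hy, map_add, R.j₃_q, R.j₃_i₃, add_zero]

/-- A staircase through the exact rows: successive primitives `z0`, `z1`, `z2` are taken in `A`,
`B`, `C`, and then corrected backwards using surjectivity of `q` and the homology at `B 2`. -/
theorem exact_φ₂_φ₁ : Function.Exact R.φ₂ R.φ₁ := by
  intro c
  constructor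
  · intro hc
    obtain ⟨z0, hz0⟩ := R.exactA 0 (R.i₁ c) hc
    obtain ⟨z1, hz1⟩ := R.exactB 0 (R.p 1 z0) (by rw [R.dB_p, hz0, R.p_i₁, neg_zero])
    obtain ⟨z2, hz2⟩ := R.exactC 0 (R.q 1 z1) (by rw [R.dC_q, hz1, R.q_p, neg_zero])
    obtain ⟨w1, hw1⟩ := R.q_surjective z2
    obtain ⟨b, w, hbw⟩ := R.exists_i₂ (z1 + R.dB 2 w1) (by
      have := R.dC_q 1 w1
      rw [hw1, hz2] at this
      rw [map_add, this, neg_add_cancel])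
    refine ⟨b, (R.φ₂_eq_iff b c).2 ⟨z0 + R.dA 2 w, ?_, ?_⟩⟩
    · have h := congrArg (R.dB 1) hbw
      rw [map_add, R.dB_dB, add_zero, map_add, R.dB_p] at h
      rw [map_add, ← hz1, h]
      abel
    · rw [map_add, R.dA_dA, add_zero, hz0]
  · rintro ⟨b, rfl⟩
    obtain ⟨u, -, hu⟩ := (R.φ₂_eq_iff b _).1 rfl
    change R.dA 0 (R.i₁ _) = 0
    rw [← hu, R.dA_dA]

theorem exact_φ₃_φ₂ : Function.Exact R.φ₃ R.φ₂ := by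
  intro b
  constructor
  · intro hb
    obtain ⟨u, hu, hu'⟩ := (R.φ₂_eq_iff b 0).1 hb
    rw [map_zero] at hu'
    obtain ⟨w0, hw0⟩ := R.exactA 1 u hu'
    obtain ⟨w1, hw1⟩ := R.exactB 1 (R.i₂ b + R.p 2 w0) (by
      rw [map_add, R.dB_p, hw0, hu, add_neg_cancel])
    obtain ⟨w2, hw2⟩ := R.exactC 1 (R.q 2 w1) (by
      rw [R.dC_q, hw1, map_add, R.q_p, R.q_i₂, add_zero, neg_zero])
    obtain ⟨a, y, hay⟩ := R.exists_i₃ w2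
    refine ⟨a, (R.φ₃_eq_iff a b).2 ⟨w1 + R.dB 3 y, w0, ?_, ?_⟩⟩
    · rw [map_add, ← hw2, hay, map_add, R.dC_q]
      abel
    · rw [map_add, R.dB_dB, add_zero, hw1]
  · rintro ⟨a, rfl⟩
    obtain ⟨v, w, -, hw⟩ := (R.φ₃_eq_iff a _).1 rfl
    refine (R.φ₂_eq_iff _ 0).2 ⟨R.dA 2 w, ?_, ?_⟩
    · have h := congrArg (R.dB 1) hw
      rw [R.dB_dB, map_add, R.dB_p] at h
      exact (add_neg_eq_zero.1 h.symm).symm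
    · rw [R.dA_dA, map_zero]

theorem exact_φ₄_φ₃ : Function.Exact R.φ₄ R.φ₃ := by
  intro a
  constructor
  · intro ha
    obtain ⟨v, w, hv, hw⟩ := (R.φ₃_eq_iff a 0).1 ha
    rw [map_zero, zero_add] at hw
    obtain ⟨x0, hx0⟩ := R.exactA 2 w (R.p_injective 0 (by
      have := R.dB_p 1 w
      rw [← hw, R.dB_dB] at this
      rw [map_zero]
      exact neg_eq_zero.1 this.symm))
    obtain ⟨x1, hx1⟩ := R.exactB 2 (v + R.p 3 x0) (by
      rw [map_add, R.dB_p, hx0, hw, add_neg_cancel])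
    obtain ⟨h, hh⟩ := R.exactC 2 (R.i₃ a + R.q 3 x1) (by
      rw [map_add, R.dC_q, hx1, map_add, R.q_p, hv, add_zero, add_neg_cancel])
    exact ⟨h, (R.φ₄_eq_iff h a).2 ⟨x1, hh⟩⟩
  · rintro ⟨h, rfl⟩
    obtain ⟨y, hy⟩ := (R.φ₄_eq_iff h _).1 rfl
    refine (R.φ₃_eq_iff _ 0).2 ⟨R.dB 3 y, 0, ?_, ?_⟩
    · have h := congrArg (R.dC 2) hy
      rw [R.dC_dC, map_add, R.dC_q] at h
      exact (add_neg_eq_zero.1 h.symm).symm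
    · rw [R.dB_dB, map_zero, map_zero, add_zero]

/-- Forms of degree 5 vanish, so the leftmost map of each exact row is injective. These three
injectivities, together with exactness of the column at `B 3`, leave no room for a kernel. -/
theorem injective_φ₄ : Function.Injective R.φ₄ := by
  rw [injective_iff_map_eq_zero]
  intro h hh
  have hA : ∀ x, R.dA 3 x = 0 → x = 0 := fun x hx => by
    obtain ⟨y, rfl⟩ := R.exactA 3 x hx
    rw [R.subsingletonA.elim y 0, map_zero]
  have hB : ∀ x, R.dB 3 x = 0 → x = 0 := fun x hx => by
    obtain ⟨y, rfl⟩ := R.exactB 3 x hx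
    rw [R.subsingletonB.elim y 0, map_zero]
  have hC : ∀ x, R.dC 3 x = 0 → x = 0 := fun x hx => by
    obtain ⟨y, rfl⟩ := R.exactC 3 x hx
    rw [R.subsingletonC.elim y 0, map_zero]
  obtain ⟨y, hy⟩ := (R.φ₄_eq_iff h 0).1 hh
  rw [map_zero, zero_add] at hy
  obtain ⟨x0, hx0⟩ := R.exact_three (R.dB 3 y) (by
    have := R.dC_q 2 y
    rw [← hy, R.dC_dC] at this
    exact neg_eq_zero.1 this.symm)
  have hx : x0 = 0 := hA x0 (R.p_injective 1 (by
    have := R.dB_p 2 x0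
    rw [hx0, R.dB_dB] at this
    rw [map_zero]
    exact neg_eq_zero.1 this.symm))
  rw [hx, map_zero] at hx0
  rw [hB y hx0.symm, map_zero] at hy
  exact hC h hy

end ThreeRows

end DoubleComplex

/-! ### Homogeneous maps between free graded modules -/

section Homogeneous

open TensorProduct MvPolynomial

variable {K : Type*} [Field K] {n : ℕ} {U V W : Type*} [AddCommMonoid U] [Module K U]
  [AddCommMonoid V] [Module K V] [AddCommMonoid W] [Module K W]

/-- The value of a functional on the coefficients of an element of `K[χ] ⊗ V`. -/
def coordEval (φ : V →ₗ[K] K) : MvPolynomial (Fin n) K ⊗[K] V →ₗ[K] MvPolynomial (Fin n) K :=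
  (TensorProduct.rid K (MvPolynomial (Fin n) K)).toLinearMap ∘ₗ
    φ.lTensor (MvPolynomial (Fin n) K)

theorem coordEval_tmul (φ : V →ₗ[K] K) (f : MvPolynomial (Fin n) K) (v : V) :
    coordEval φ (f ⊗ₜ v) = φ v • f := by
  simp [coordEval]

/-- The elements of `K[χ] ⊗ V` of degree `d`. -/
def IsHomogeneousTensor (t : MvPolynomial (Fin n) K ⊗[K] V) (d : ℕ) : Prop :=
  ∀ φ : V →ₗ[K] K, (coordEval φ t).IsHomogeneous d

theorem isHomogeneousTensor_one_tmul (v : V) :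
    IsHomogeneousTensor ((1 : MvPolynomial (Fin n) K) ⊗ₜ[K] v) 0 := fun φ => by
  rw [coordEval_tmul, ← C_mul', mul_one]
  exact isHomogeneous_C _ _

theorem IsHomogeneousTensor.baseChange {t : MvPolynomial (Fin n) K ⊗[K] V} {d : ℕ}
    (h : IsHomogeneousTensor t d) (f : V →ₗ[K] W) :
    IsHomogeneousTensor (f.baseChange (MvPolynomial (Fin n) K) t) d := fun φ => by
  have e : coordEval φ (f.baseChange (MvPolynomial (Fin n) K) t) = coordEval (φ ∘ₗ f) t := by
    clear h
    induction t using TensorProduct.induction_on with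
    | zero => simp
    | tmul p v => simp [coordEval_tmul]
    | add a b ha hb => simp [ha, hb]
  rw [e]
  exact h _

theorem IsHomogeneousTensor.koszul {X : Type*} [AddCommGroup X] [Module K X] {k d : ℕ}
    {t : MvPolynomial (Fin n) K ⊗[K] extPow K n X (k + 1)} (h : IsHomogeneousTensor t d) :
    IsHomogeneousTensor (koszul k t) (d + 1) := fun φ => by
  have e : coordEval φ (FormalTheory.koszul k t)
      = ∑ i, MvPolynomial.X i * coordEval (φ ∘ₗ contrL k i) t := by
    clear h
    induction t using TensorProduct.induction_on with
    | zero => simp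
    | tmul p v => simp [coordEval_tmul, koszul_tmul]
    | add a b ha hb => simp [ha, hb, mul_add, Finset.sum_add_distrib]
  rw [e]
  refine IsHomogeneous.sum _ _ _ fun i _ => ?_
  rw [mul_comm]
  exact (h _).mul (isHomogeneous_X K i)

/-- The matrix (acting on rows from the right) of a map between free modules. -/
def rowMatrix {l m : ℕ} (bU : Module.Basis (Fin l) K U) (bV : Module.Basis (Fin m) K V)
    (f : MvPolynomial (Fin n) K ⊗[K] U →ₗ[MvPolynomial (Fin n) K] MvPolynomial (Fin n) K ⊗[K] V) :
    Matrix (Fin l) (Fin m) (MvPolynomial (Fin n) K) :=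
  Matrix.of fun a j => (bV.baseChange (MvPolynomial (Fin n) K)).repr (f (1 ⊗ₜ bU a)) j

theorem vecMul_rowMatrix {l m : ℕ} (bU : Module.Basis (Fin l) K U) (bV : Module.Basis (Fin m) K V)
    (f : MvPolynomial (Fin n) K ⊗[K] U →ₗ[MvPolynomial (Fin n) K] MvPolynomial (Fin n) K ⊗[K] V)
    (c : Fin l → MvPolynomial (Fin n) K) :
    c ᵥ* rowMatrix bU bV f = (bV.baseChange (MvPolynomial (Fin n) K)).equivFun
      (f ((bU.baseChange (MvPolynomial (Fin n) K)).equivFun.symm c)) := by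
  funext j
  simp only [Module.Basis.equivFun_symm_apply, map_sum, Finset.sum_apply, map_smul, Pi.smul_apply,
    smul_eq_mul, Module.Basis.baseChange_apply]
  rfl

theorem exact_rowMatrix {l m p : ℕ} (bU : Module.Basis (Fin l) K U)
    (bV : Module.Basis (Fin m) K V) (bW : Module.Basis (Fin p) K W)
    {f : MvPolynomial (Fin n) K ⊗[K] U →ₗ[MvPolynomial (Fin n) K] MvPolynomial (Fin n) K ⊗[K] V}
    {g : MvPolynomial (Fin n) K ⊗[K] V →ₗ[MvPolynomial (Fin n) K] MvPolynomial (Fin n) K ⊗[K] W}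
    (h : Function.Exact f g) (c : Fin m → MvPolynomial (Fin n) K) :
    c ᵥ* rowMatrix bV bW g = 0 ↔ ∃ b, b ᵥ* rowMatrix bU bV f = c := by
  rw [vecMul_rowMatrix, LinearEquiv.map_eq_zero_iff, h]
  constructor
  · rintro ⟨y, hy⟩
    refine ⟨(bU.baseChange (MvPolynomial (Fin n) K)).equivFun y, ?_⟩
    rw [vecMul_rowMatrix, LinearEquiv.symm_apply_apply, hy, LinearEquiv.apply_symm_apply]
  · rintro ⟨b, rfl⟩
    refine ⟨(bU.baseChange (MvPolynomial (Fin n) K)).equivFun.symm b, ?_⟩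
    rw [vecMul_rowMatrix, LinearEquiv.symm_apply_apply]

theorem injective_rowMatrix {l m : ℕ} (bU : Module.Basis (Fin l) K U)
    (bV : Module.Basis (Fin m) K V)
    {f : MvPolynomial (Fin n) K ⊗[K] U →ₗ[MvPolynomial (Fin n) K] MvPolynomial (Fin n) K ⊗[K] V}
    (h : Function.Injective f) {c : Fin l → MvPolynomial (Fin n) K}
    (hc : c ᵥ* rowMatrix bU bV f = 0) : c = 0 := by
  rw [vecMul_rowMatrix, LinearEquiv.map_eq_zero_iff, ← map_zero f] at hc
  exact (LinearEquiv.map_eq_zero_iff _).1 (h hc)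

theorem rowMatrix_isHomogeneous {l m : ℕ} (bU : Module.Basis (Fin l) K U)
    (bV : Module.Basis (Fin m) K V)
    {f : MvPolynomial (Fin n) K ⊗[K] U →ₗ[MvPolynomial (Fin n) K] MvPolynomial (Fin n) K ⊗[K] V}
    {d : ℕ} (h : ∀ u, IsHomogeneousTensor (f (1 ⊗ₜ u)) d) (a : Fin l) (j : Fin m) :
    (rowMatrix bU bV f a j).IsHomogeneous d := by
  have e (t : MvPolynomial (Fin n) K ⊗[K] V) :
      (bV.baseChange (MvPolynomial (Fin n) K)).repr t j = coordEval (bV.coord j) t := by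
    induction t using TensorProduct.induction_on with
    | zero => simp
    | tmul p v => simp [coordEval_tmul]
    | add a b ha hb => simp [ha, hb]
  have := h (bU a) (bV.coord j)
  rwa [← e] at this

end Homogeneous

/-! ### Representing homology by a complement -/

section Splitting

variable {K : Type*} [Field K] {V : Type*} [AddCommGroup V] [Module K V]

/-- The homology `Z / f(U)` is represented by a complement of `f(U)` in `Z`. -/
theorem exists_homology_splitting {U : Type*} [AddCommGroup U] [Module K U] [Module.Finite K V]
    {f : U →ₗ[K] V} {Z : Submodule K V} (h : ∀ u, f u ∈ Z) :
    ∃ (H : Submodule K V) (j : V →ₗ[K] H) (t : Z →ₗ[K] U), H ≤ Z ∧ (∀ x : H, j x = x) ∧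
      (∀ u, j (f u) = 0) ∧ (∀ x : Z, x.1 = j x + f (t x)) ∧
      (Function.Injective f → Module.finrank K H + Module.finrank K U = Module.finrank K Z) := by
  have h' : LinearMap.range f ≤ Z := by
    rintro _ ⟨u, rfl⟩
    exact h u
  -- The complement is taken in all of `V`, so that the projection to homology is defined on `V` and
  -- not only on the cycles; `Q ⊓ Z` is then a complement of the boundaries in `Z`.
  obtain ⟨Q, hQ⟩ := (LinearMap.range f).exists_isCompl
  obtain ⟨r, hr⟩ := (Submodule.inclusion (inf_le_left : Q ⊓ Z ≤ Q)).exists_leftInverse_of_injective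
    (Submodule.ker_inclusion _ _ _)
  have hr' (x : V) (hx : x ∈ Q ⊓ Z) : r ⟨x, hx.1⟩ = ⟨x, hx⟩ := LinearMap.congr_fun hr ⟨x, hx⟩
  have hdec (x : V) (hx : x ∈ Z) : ∃ y : (Q ⊓ Z : Submodule K V), ∃ u, x = y + f u := by
    obtain ⟨_, ⟨u, rfl⟩, y, hy, rfl⟩ :=
      Submodule.mem_sup.1 (hQ.sup_eq_top ▸ Submodule.mem_top (x := x))
    refine ⟨⟨y, hy, ?_⟩, u, add_comm _ _⟩
    have := Z.sub_mem hx (h u)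
    rwa [add_sub_cancel_left] at this
  let j : V →ₗ[K] (Q ⊓ Z : Submodule K V) :=
    r ∘ₗ Submodule.projectionOnto Q (LinearMap.range f) hQ.symm
  have hj1 (x : (Q ⊓ Z : Submodule K V)) : j x = x := by
    change r (Submodule.projectionOnto Q (LinearMap.range f) hQ.symm x.1) = x
    rw [Submodule.projectionOnto_apply_left hQ.symm ⟨x.1, x.2.1⟩]
    exact hr' x.1 x.2
  have hj2 (u) : j (f u) = 0 := by
    change r (Submodule.projectionOnto Q (LinearMap.range f) hQ.symm (f u)) = 0
    rw [Submodule.projectionOnto_apply_right hQ.symm ⟨f u, u, rfl⟩, map_zero]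
  have hmem (x : Z) : x.1 - j x ∈ LinearMap.range f := by
    obtain ⟨y, u, hx⟩ := hdec x.1 x.2
    refine ⟨u, ?_⟩
    rw [hx, map_add, hj1, hj2, add_zero, add_sub_cancel_left]
  obtain ⟨σ, hσ⟩ := f.rangeRestrict.exists_rightInverse_of_surjective f.range_rangeRestrict
  let t : Z →ₗ[K] U := σ ∘ₗ LinearMap.codRestrict (LinearMap.range f)
    (Z.subtype - (Q ⊓ Z).subtype ∘ₗ j ∘ₗ Z.subtype) hmem
  refine ⟨Q ⊓ Z, j, t, inf_le_right, hj1, hj2, fun x => ?_, fun hf => ?_⟩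
  · have : f (t x) = x.1 - j x :=
      congrArg Subtype.val (LinearMap.congr_fun hσ ⟨x.1 - j x, hmem x⟩)
    rw [this, add_sub_cancel]
  · have h1 : (Q ⊓ Z) ⊔ LinearMap.range f = Z := by
      refine le_antisymm (sup_le inf_le_right h') fun x hx => ?_
      obtain ⟨y, u, rfl⟩ := hdec x hx
      exact Submodule.add_mem_sup y.2 ⟨u, rfl⟩
    have h2 : (Q ⊓ Z) ⊓ LinearMap.range f = ⊥ :=
      le_bot_iff.1 (le_trans (inf_le_inf_right _ inf_le_left) hQ.symm.inf_eq_bot.le)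
    have := Submodule.finrank_sup_add_finrank_inf_eq (Q ⊓ Z) (LinearMap.range f)
    rw [h1, h2, finrank_bot, LinearMap.finrank_range_of_inj hf] at this
    omega

end Splitting

/-! ### The resolution of the symbol of the conformal Killing operator -/

section SymbolResolution

open TensorProduct MvPolynomial

variable {K : Type*} [Field K]

/-! ### Extension of scalars from the field to the polynomial ring -/

section FlatExtension

variable {n : ℕ} {U V W : Type*} [AddCommMonoid U] [Module K U] [AddCommMonoid V] [Module K V]
  [AddCommMonoid W] [Module K W]

theorem exact_baseChange {f : U →ₗ[K] V} {g : V →ₗ[K] W} (h : Function.Exact f g) :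
    Function.Exact (f.baseChange (MvPolynomial (Fin n) K)) (g.baseChange (MvPolynomial (Fin n) K)) :=
  let _ := Module.addCommMonoidToAddCommGroup K (M := U)
  let _ := Module.addCommMonoidToAddCommGroup K (M := V)
  let _ := Module.addCommMonoidToAddCommGroup K (M := W)
  Module.Flat.lTensor_exact (M := MvPolynomial (Fin n) K) h

theorem exists_of_baseChange_eq_zero {g : V →ₗ[K] W} {x : MvPolynomial (Fin n) K ⊗[K] V}
    (hx : g.baseChange (MvPolynomial (Fin n) K) x = 0) :
    ∃ y, (LinearMap.ker g).subtype.baseChange (MvPolynomial (Fin n) K) y = x := by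
  have h : Function.Exact (LinearMap.ker g).subtype g := fun v =>
    ⟨fun hv => ⟨⟨v, hv⟩, rfl⟩, by rintro ⟨v, rfl⟩; exact v.2⟩
  exact (exact_baseChange h x).1 hx

theorem injective_baseChange {f : U →ₗ[K] V} (h : Function.Injective f) :
    Function.Injective (f.baseChange (MvPolynomial (Fin n) K)) :=
  Module.Flat.lTensor_preserves_injective_linearMap f h

theorem surjective_baseChange {f : U →ₗ[K] V} (h : Function.Surjective f) :
    Function.Surjective (f.baseChange (MvPolynomial (Fin n) K)) :=
  LinearMap.lTensor_surjective _ h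

theorem baseChange_baseChange_eq {f : U →ₗ[K] V} {g : V →ₗ[K] W} {e : U →ₗ[K] W}
    (h : ∀ x, g (f x) = e x) (x : MvPolynomial (Fin n) K ⊗[K] U) :
    g.baseChange (MvPolynomial (Fin n) K) (f.baseChange (MvPolynomial (Fin n) K) x) = e.baseChange (MvPolynomial (Fin n) K) x := by
  have : e = g ∘ₗ f := LinearMap.ext fun x => (h x).symm
  rw [this, LinearMap.baseChange_comp]
  rfl

theorem baseChange_leftInverse {f : U →ₗ[K] V} {g : V →ₗ[K] U} (h : ∀ x, g (f x) = x)
    (x : MvPolynomial (Fin n) K ⊗[K] U) : g.baseChange (MvPolynomial (Fin n) K) (f.baseChange (MvPolynomial (Fin n) K) x) = x := by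
  rw [baseChange_baseChange_eq (e := LinearMap.id) h, LinearMap.baseChange_id]
  rfl

theorem baseChange_comp_zero {f : U →ₗ[K] V} {g : V →ₗ[K] W} (h : ∀ x, g (f x) = 0)
    (x : MvPolynomial (Fin n) K ⊗[K] U) : g.baseChange (MvPolynomial (Fin n) K) (f.baseChange (MvPolynomial (Fin n) K) x) = 0 := by
  rw [baseChange_baseChange_eq (e := 0) h, LinearMap.baseChange_zero]
  rfl

theorem baseChange_decomposition {H P : Type*} [AddCommMonoid H] [Module K H] [AddCommMonoid P]
    [Module K P] {e : P →ₗ[K] V} {i : H →ₗ[K] V} {j : V →ₗ[K] H} {f : U →ₗ[K] V} {t : P →ₗ[K] U}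
    (h : ∀ x, e x = i (j (e x)) + f (t x)) (x : MvPolynomial (Fin n) K ⊗[K] P) :
    e.baseChange (MvPolynomial (Fin n) K) x = i.baseChange (MvPolynomial (Fin n) K) (j.baseChange (MvPolynomial (Fin n) K) (e.baseChange (MvPolynomial (Fin n) K) x))
      + f.baseChange (MvPolynomial (Fin n) K) (t.baseChange (MvPolynomial (Fin n) K) x) := by
  induction x using TensorProduct.induction_on with
  | zero => simp
  | tmul p v =>
    simp only [LinearMap.baseChange_tmul]
    rw [← TensorProduct.tmul_add, ← h]
  | add a b ha hb =>
    simp only [map_add]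
    nth_rewrite 1 [ha, hb]
    abel

end FlatExtension

instance : Module.Finite K (Fin 4 → K) := inferInstance

theorem finrank_degree_one [CharZero K] : Module.finrank K (skewMatrices K 4 × K) = 7 := by
  rw [Module.finrank_prod, finrank_skewMatrices, Module.finrank_self]

theorem extPow_five_eq_zero {X : Type*} [AddCommGroup X] [Module K X]
    (t : MvPolynomial (Fin 4) K ⊗[K] extPow K 4 X 5) : t = 0 := by
  have : Subsingleton (extPow K 4 X 5) :=
    ⟨fun a b => Subtype.ext ((extPow_eq_zero (by norm_num) a.2).trans
      (extPow_eq_zero (by norm_num) b.2).symm)⟩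
  induction t using TensorProduct.induction_on with
  | zero => rfl
  | tmul p v => rw [Subsingleton.elim v 0, TensorProduct.tmul_zero]
  | add a b ha hb => rw [ha, hb, add_zero]

theorem exists_leftInverse_of_injective {n k l : ℕ} {X Y : Type*} [AddCommGroup X] [Module K X]
    [AddCommGroup Y] [Module K Y] {f : extPow K n X k →ₗ[K] extPow K n Y l}
    (hf : Function.Injective f) : ∃ s : extPow K n Y l →ₗ[K] extPow K n X k, ∀ x, s (f x) = x := by
  obtain ⟨s, hs⟩ := LinearMap.exists_leftInverse_of_injective (K := K) (V := extPow K n X k)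
    (V' := extPow K n Y l) f (LinearMap.ker_eq_bot.2 hf)
  exact ⟨s, LinearMap.congr_fun hs⟩

theorem exists_rightInverse_of_surjective {n k l : ℕ} {X Y : Type*} [AddCommGroup X] [Module K X]
    [AddCommGroup Y] [Module K Y] {f : extPow K n X k →ₗ[K] extPow K n Y l}
    (hf : Function.Surjective f) : ∃ s : extPow K n Y l →ₗ[K] extPow K n X k, ∀ x, f (s x) = x := by
  obtain ⟨s, hs⟩ := LinearMap.exists_rightInverse_of_surjective (R := K) (M := extPow K n X k)
    (P := extPow K n Y l) f (LinearMap.range_eq_top.2 hf)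
  exact ⟨s, LinearMap.congr_fun hs⟩

theorem exists_basis_of_finrank {V : Type*} [AddCommGroup V] [Module K V] [Module.Finite K V]
    (H : Submodule K V) {m : ℕ} (h : Module.finrank K H = m) :
    Nonempty (Module.Basis (Fin m) K H) :=
  ⟨Module.finBasisOfFinrankEq K H h⟩

theorem exists_retraction {V : Type*} [AddCommGroup V] [Module K V] (H : Submodule K V) :
    ∃ j : V →ₗ[K] H, ∀ x : H, j x = x := by
  obtain ⟨j, hj⟩ := H.subtype.exists_leftInverse_of_injective (Submodule.ker_subtype H)
  exact ⟨j, LinearMap.congr_fun hj⟩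

theorem finrank_ker_of_surjective {n k l : ℕ} {X Y : Type*} [AddCommGroup X] [Module K X]
    [AddCommGroup Y] [Module K Y] [Module.Finite K X]
    {f : extPow K n X k →ₗ[K] extPow K n Y l} (hf : Function.Surjective f) :
    Module.finrank K (extPow K n Y l) + Module.finrank K (LinearMap.ker f)
      = Module.finrank K (extPow K n X k) := by
  have h := LinearMap.finrank_range_add_finrank_ker (K := K) (V := extPow K n X k)
    (V₂ := extPow K n Y l) f
  rwa [LinearMap.range_eq_top.2 hf, finrank_top] at h

theorem extPow_exact_of_finrank {n k l m : ℕ} {X Y Z : Type*} [AddCommGroup X] [Module K X]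
    [AddCommGroup Y] [Module K Y] [AddCommGroup Z] [Module K Z] [Module.Finite K X]
    [Module.Finite K Y] [Module.Finite K Z] {f : extPow K n X k →ₗ[K] extPow K n Y l}
    {g : extPow K n Y l →ₗ[K] extPow K n Z m} (hf : Function.Injective f)
    (hg : Function.Surjective g) (hgf : ∀ u, g (f u) = 0)
    (hdim : Module.finrank K (extPow K n Y l)
      = Module.finrank K (extPow K n X k) + Module.finrank K (extPow K n Z m)) :
    Function.Exact f g :=
  exact_of_finrank (U := extPow K n X k) (V := extPow K n Y l) (W := extPow K n Z m) hf hg hgf hdim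

variable {ω : Matrix (Fin 4) (Fin 4) K}

variable (ω) in
/-- The first-order symbols that vanish on the conformal Killing symbol. -/
def killingSymbols : Submodule K (extPow K 4 (Fin 4 → K) 1) := LinearMap.ker (algDiff (mulZero ω) 0)

theorem finrank_killingSymbols [CharZero K] (hω : ω.IsSymm) (hdet : ω.det ≠ 0) :
    Module.finrank K (killingSymbols ω) = 9 := by
  have h := finrank_ker_of_surjective (algDiff_mulZero_surjective hω hdet (by norm_num))
  rw [finrank_extPow, finrank_extPow, finrank_degree_one, Module.finrank_fin_fun] at h
  have c1 : Nat.choose 4 1 = 4 := rfl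
  change _ + Module.finrank K (killingSymbols ω) = _ at h
  norm_num [c1] at h
  omega

variable (K) in
/-- The coordinates on the forms of degree zero. -/
def extPowZeroBasis : Module.Basis (Fin 4) K (extPow K 4 (Fin 4 → K) 0) :=
  Module.Basis.ofEquivFun
    { toFun := fun α => α.1 ∅
      map_add' := fun _ _ => rfl
      map_smul' := fun _ _ => rfl
      invFun := fun v => ⟨fun J => if J = ∅ then v else 0, fun J hJ =>
        if_neg fun h => hJ (by rw [h, Finset.card_empty])⟩
      left_inv := fun α => by
        apply Subtype.ext
        funext J
        by_cases h : J = ∅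
        · simp [h]
        · simp only [h, if_false]
          exact (α.2 J fun h' => h (Finset.card_eq_zero.1 h')).symm
      right_inv := fun v => by simp }

/-- The symbol of the conformal Killing operator. -/
def killingSymbolMatrix (b : Module.Basis (Fin 9) K (killingSymbols ω)) :
    Matrix (Fin 9) (Fin 4) (MvPolynomial (Fin 4) K) :=
  Matrix.of fun a r => ∑ i, C ((contrL 0 i (b a).1).1 ∅ r) * X i

variable (ω) in
/-- The map of free modules defined by the symbol of the conformal Killing operator. -/
def killingSymbolMap : MvPolynomial (Fin 4) K ⊗[K] killingSymbols ω →ₗ[MvPolynomial (Fin 4) K]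
    MvPolynomial (Fin 4) K ⊗[K] extPow K 4 (Fin 4 → K) 0 :=
  koszul 0 ∘ₗ (killingSymbols ω).subtype.baseChange (MvPolynomial (Fin 4) K)

theorem killingSymbolMatrix_eq (b : Module.Basis (Fin 9) K (killingSymbols ω)) :
    killingSymbolMatrix b = rowMatrix b (extPowZeroBasis K)
      (killingSymbolMap ω) := by
  ext1 a r
  change ∑ i, C ((contrL 0 i (b a).1).1 ∅ r) * X i = (Module.Basis.baseChange _ (extPowZeroBasis K)).repr (koszul 0
    ((killingSymbols ω).subtype.baseChange (MvPolynomial (Fin 4) K) (1 ⊗ₜ b a))) r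
  rw [LinearMap.baseChange_tmul, koszul_tmul, map_sum, Finsupp.finsetSum_apply]
  refine Finset.sum_congr rfl fun i _ => ?_
  rw [Module.Basis.baseChange_repr_tmul, mul_one, C_mul']
  rfl

set_option maxHeartbeats 2000000 in
theorem exists_symbol_resolution [CharZero K] (hω : ω.IsSymm) (hdet : ω.det ≠ 0)
    (b : Module.Basis (Fin 9) K (killingSymbols ω)) :
    ∃ (A₂ : Matrix (Fin 10) (Fin 9) (MvPolynomial (Fin 4) K))
      (A₃ : Matrix (Fin 9) (Fin 10) (MvPolynomial (Fin 4) K))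
      (A₄ : Matrix (Fin 4) (Fin 9) (MvPolynomial (Fin 4) K)),
      (∀ i j, (A₂ i j).IsHomogeneous 2) ∧ (∀ i j, (A₃ i j).IsHomogeneous 2) ∧
      (∀ i j, (A₄ i j).IsHomogeneous 1) ∧
      (∀ c, c ᵥ* killingSymbolMatrix b = 0 ↔ ∃ a, a ᵥ* A₂ = c) ∧
      (∀ c, c ᵥ* A₂ = 0 ↔ ∃ a, a ᵥ* A₃ = c) ∧
      (∀ c, c ᵥ* A₃ = 0 ↔ ∃ a, a ᵥ* A₄ = c) ∧
      ∀ c, c ᵥ* A₄ = 0 → c = 0 := by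
  have hmul := mulOne_mulZero hω
  have hp (k) : Function.Injective (algDiff (mulZero ω) (k + 1)) :=
    algDiff_mulZero_injective hdet k
  have hq0 : Function.Surjective (algDiff (mulOne ω) 0) := algDiff_mulOne_surjective (by norm_num)
  have hq1 : Function.Surjective (algDiff (mulOne ω) 1) := algDiff_mulOne_surjective (by norm_num)
  have hq2 : Function.Surjective (algDiff (mulOne ω) 2) := algDiff_mulOne_surjective (by norm_num)
  have hq3 : Function.Injective (algDiff (mulOne ω) 3) := algDiff_mulOne_injective hω hdet rfl
  have hqp (k) := algDiff_algDiff (K := K) hmul k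
  have d1 : Module.finrank K (skewMatrices K 4 × K) = 7 := finrank_degree_one
  -- The count is `28 = 24 + 4`; in `hd3` it is `28 = 4 + 24`. With injectivity on the left and
  -- surjectivity on the right it makes these two columns exact.
  have hd1 : Module.finrank K (extPow K 4 (skewMatrices K 4 × K) 1)
      = Module.finrank K (extPow K 4 (Fin 4 → K) 2) + Module.finrank K (extPow K 4 (Fin 4 → K) 0) := by
    rw [finrank_extPow, finrank_extPow, finrank_extPow, d1, Module.finrank_fin_fun]
    rfl
  have hd3 : Module.finrank K (extPow K 4 (skewMatrices K 4 × K) 3)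
      = Module.finrank K (extPow K 4 (Fin 4 → K) 4) + Module.finrank K (extPow K 4 (Fin 4 → K) 2) := by
    rw [finrank_extPow, finrank_extPow, finrank_extPow, d1, Module.finrank_fin_fun]
    rfl
  have hex1 : Function.Exact (algDiff (mulZero ω) 1) (algDiff (mulOne ω) 0) :=
    extPow_exact_of_finrank (hp 0) hq0 (hqp 0) hd1
  have hex3 : Function.Exact (algDiff (mulZero ω) 3) (algDiff (mulOne ω) 2) :=
    extPow_exact_of_finrank (hp 2) hq2 (hqp 2) hd3
  obtain ⟨j₁, hj₁⟩ := exists_retraction (killingSymbols ω)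
  obtain ⟨s₁, hs₁⟩ := exists_leftInverse_of_injective (hp 0)
  obtain ⟨s₂, hs₂⟩ := exists_rightInverse_of_surjective hq2
  obtain ⟨H₂, j₂, t₂, hH₂, hj₂, hj₂', ht₂, dH₂⟩ := exists_homology_splitting
    (V := extPow K 4 (skewMatrices K 4 × K) 2) (U := extPow K 4 (Fin 4 → K) 3)
    (f := algDiff (mulZero ω) 2) (Z := LinearMap.ker (algDiff (mulOne ω) 1)) (hqp 1)
  obtain ⟨H₃, j₃, t₃, -, hj₃, hj₃', ht₃, dH₃⟩ := exists_homology_splitting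
    (V := extPow K 4 (Fin 4 → K) 3) (U := extPow K 4 (skewMatrices K 4 × K) 4)
    (f := algDiff (mulOne ω) 3) (Z := ⊤) (fun _ => Submodule.mem_top)
  replace dH₂ := dH₂ (hp 1)
  replace dH₃ := dH₃ hq3
  rw [finrank_extPow, Module.finrank_fin_fun] at dH₂
  rw [finrank_extPow, d1, finrank_top, finrank_extPow, Module.finrank_fin_fun] at dH₃
  have dk := finrank_ker_of_surjective hq1
  rw [finrank_extPow, finrank_extPow, d1,
    Module.finrank_fin_fun] at dk
  have c1 : Nat.choose 4 1 = 4 := rfl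
  have c2 : Nat.choose 4 2 = 6 := rfl
  have c3 : Nat.choose 4 3 = 4 := rfl
  have c4 : Nat.choose 4 4 = 1 := rfl
  -- The ranks are `10 = (42 - 16) - 16` for `H₂` and `9 = 16 - 7` for `H₃`.
  norm_num [c1, c2, c3, c4] at dH₂ dH₃ dk
  have e₂ := dH₂.trans (Nat.eq_sub_of_add_eq' dk)
  have e₂' : Module.finrank K H₂ = 10 := by omega
  have e₃' : Module.finrank K H₃ = 9 := by omega
  obtain ⟨b₂⟩ := exists_basis_of_finrank (V := extPow K 4 (skewMatrices K 4 × K) 2) H₂ e₂'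
  obtain ⟨b₃⟩ := exists_basis_of_finrank (V := extPow K 4 (Fin 4 → K) 3) H₃ e₃'
  let R : ThreeRows (MvPolynomial (Fin 4) K)
      (fun k => MvPolynomial (Fin 4) K ⊗[K] extPow K 4 (Fin 4 → K) k)
      (fun k => MvPolynomial (Fin 4) K ⊗[K] extPow K 4 (skewMatrices K 4 × K) k)
      (fun k => MvPolynomial (Fin 4) K ⊗[K] extPow K 4 (Fin 4 → K) k)
      (MvPolynomial (Fin 4) K ⊗[K] killingSymbols ω) (MvPolynomial (Fin 4) K ⊗[K] H₂)
      (MvPolynomial (Fin 4) K ⊗[K] H₃) :=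
    { dA := koszul
      dB := koszul
      dC := koszul
      p := fun k => (algDiff (mulZero ω) k).baseChange _
      q := fun k => (algDiff (mulOne ω) k).baseChange _
      dA_dA := koszul_koszul
      dB_dB := koszul_koszul
      dC_dC := koszul_koszul
      exactA := fun k x => koszul_exact k
      exactB := fun k x => koszul_exact k
      exactC := fun k x => koszul_exact k
      subsingletonA := ⟨fun a b => (extPow_five_eq_zero a).trans (extPow_five_eq_zero b).symm⟩
      subsingletonB := ⟨fun a b => (extPow_five_eq_zero a).trans (extPow_five_eq_zero b).symm⟩
      subsingletonC := ⟨fun a b => (extPow_five_eq_zero a).trans (extPow_five_eq_zero b).symm⟩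
      dB_p := koszul_algDiff (mulZero ω)
      dC_q := koszul_algDiff (mulOne ω)
      q_p := fun k => baseChange_comp_zero (hqp k)
      p_injective := fun k => injective_baseChange (hp k)
      q_surjective := surjective_baseChange hq2
      exact_one := fun y => (exact_baseChange hex1 y).1
      exact_three := fun y => (exact_baseChange hex3 y).1
      i₁ := (killingSymbols ω).subtype.baseChange _
      i₂ := H₂.subtype.baseChange _
      i₃ := H₃.subtype.baseChange _
      j₁ := j₁.baseChange _
      j₂ := j₂.baseChange _
      j₃ := j₃.baseChange _
      j₁_i₁ := baseChange_leftInverse hj₁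
      p_i₁ := baseChange_comp_zero fun x => x.2
      exists_i₁ := fun x hx => exists_of_baseChange_eq_zero hx
      j₂_i₂ := baseChange_leftInverse hj₂
      j₂_p := baseChange_comp_zero fun x => hj₂' x
      q_i₂ := baseChange_comp_zero fun x => hH₂ x.2
      exists_i₂ := fun x hx => by
        obtain ⟨x', rfl⟩ := exists_of_baseChange_eq_zero hx
        exact ⟨_, _, baseChange_decomposition (i := H₂.subtype) ht₂ x'⟩
      j₃_i₃ := baseChange_leftInverse hj₃
      j₃_q := baseChange_comp_zero fun x => hj₃' x
      exists_i₃ := fun x => by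
        have h := baseChange_decomposition (n := 4) (e := LinearMap.id)
          (i := H₃.subtype) (t := t₃ ∘ₗ Submodule.topEquiv.symm.toLinearMap)
          (fun x => ht₃ ⟨x, trivial⟩) x
        rw [LinearMap.baseChange_id, LinearMap.id_apply] at h
        exact ⟨_, _, h⟩
      s₁ := s₁.baseChange _
      s₁_p := baseChange_leftInverse hs₁
      s₂ := s₂.baseChange _
      q_s₂ := baseChange_leftInverse hs₂ }
  have h21 : Function.Exact R.φ₂ (killingSymbolMap ω) := R.exact_φ₂_φ₁
  let b₄ : Module.Basis (Fin 4) K (extPow K 4 (Fin 4 → K) 4) :=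
    Module.finBasisOfFinrankEq K _ (by
      rw [finrank_extPow, Module.finrank_fin_fun]; rfl)
  refine ⟨rowMatrix b₂ b R.φ₂, rowMatrix b₃ b₂ R.φ₃, rowMatrix b₄ b₃ R.φ₄,
    rowMatrix_isHomogeneous _ _ fun u => ?_, rowMatrix_isHomogeneous _ _ fun u => ?_,
    rowMatrix_isHomogeneous _ _ fun u => ?_, fun c => ?_, exact_rowMatrix _ _ _ R.exact_φ₃_φ₂,
    exact_rowMatrix _ _ _ R.exact_φ₄_φ₃, fun c => injective_rowMatrix _ _ R.injective_φ₄⟩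
  -- Only the Koszul maps raise the polynomial degree; the lifts and projections have coefficients
  -- in `K`. The zigzags contain two Koszul maps, the last map only one.
  · change IsHomogeneousTensor (j₁.baseChange _ (koszul 1 (s₁.baseChange _ (koszul 1
      (H₂.subtype.baseChange _ (1 ⊗ₜ u)))))) 2
    exact ((((isHomogeneousTensor_one_tmul u).baseChange _).koszul.baseChange _).koszul).baseChange _
  · change IsHomogeneousTensor (j₂.baseChange _ (koszul 2 (s₂.baseChange _ (koszul 2
      (H₃.subtype.baseChange _ (1 ⊗ₜ u)))))) 2
    exact ((((isHomogeneousTensor_one_tmul u).baseChange _).koszul.baseChange _).koszul).baseChange _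
  · change IsHomogeneousTensor (j₃.baseChange _ (koszul 3 (1 ⊗ₜ u))) 1
    exact (isHomogeneousTensor_one_tmul u).koszul.baseChange _
  · rw [killingSymbolMatrix_eq]
    exact exact_rowMatrix b₂ b (extPowZeroBasis K) (f := R.φ₂) (g := killingSymbolMap ω) h21 c

end SymbolResolution

/-! ### Filtration of polynomials by degree -/

section DegreeFiltration

open MvPolynomial

variable {K : Type*} [Field K] {n : ℕ}

variable (K n) in
/-- Polynomials of degree less than `k`. -/
def degLT (k : ℕ) : Submodule K (MvPolynomial (Fin n) K) where
  carrier := {f | ∀ μ : Fin n →₀ ℕ, k ≤ μ.degree → coeff μ f = 0}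
  add_mem' := by
    intro f g hf hg μ hμ
    rw [coeff_add, hf μ hμ, hg μ hμ, add_zero]
  zero_mem' := fun μ _ => coeff_zero μ
  smul_mem' := by
    intro c f hf μ hμ
    rw [coeff_smul, hf μ hμ, smul_zero]

theorem degLT_mono {k l : ℕ} (h : k ≤ l) {f : MvPolynomial (Fin n) K} (hf : f ∈ degLT K n k) :
    f ∈ degLT K n l := fun μ hμ => hf μ (h.trans hμ)

theorem eq_zero_of_degLT_zero {f : MvPolynomial (Fin n) K} (hf : f ∈ degLT K n 0) : f = 0 := by
  ext μ
  rw [hf μ (Nat.zero_le _), coeff_zero]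

/-- The bounds are strict, so the product of degrees at most `a - 1` and `b - 1` has degree at most
`a + b - 2`; hence `k + 1` and not `k` on the right. -/
theorem mul_mem_degLT {a b k : ℕ} {f g : MvPolynomial (Fin n) K} (hf : f ∈ degLT K n a)
    (hg : g ∈ degLT K n b) (h : a + b ≤ k + 1) : f * g ∈ degLT K n k := by
  intro μ hμ
  rw [coeff_mul]
  refine Finset.sum_eq_zero fun x hx => ?_
  have hx' : x.1.degree + x.2.degree = μ.degree := by
    rw [← Finset.HasAntidiagonal.mem_antidiagonal.1 hx, map_add]
  by_cases h1 : a ≤ x.1.degree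
  · rw [hf _ h1, zero_mul]
  · rw [hg x.2 (by omega), mul_zero]

theorem isHomogeneous_mem_degLT {d : ℕ} {f : MvPolynomial (Fin n) K} (hf : f.IsHomogeneous d) :
    f ∈ degLT K n (d + 1) := fun μ hμ => hf.coeff_eq_zero (by omega)

theorem eq_zero_of_isHomogeneous_of_mem_degLT {d : ℕ} {f : MvPolynomial (Fin n) K}
    (hf : f.IsHomogeneous d) (h : f ∈ degLT K n d) : f = 0 := by
  ext μ
  rw [coeff_zero]
  by_cases hμ : μ.degree = d
  · exact h μ hμ.ge
  · exact hf.coeff_eq_zero hμ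

theorem sub_homogeneousComponent_mem_degLT {k : ℕ} {f : MvPolynomial (Fin n) K}
    (hf : f ∈ degLT K n (k + 1)) : f - homogeneousComponent k f ∈ degLT K n k := by
  intro μ hμ
  rw [coeff_sub, coeff_homogeneousComponent]
  split_ifs with h
  · rw [sub_self]
  · rw [hf μ (by omega), sub_zero]

theorem mem_degLT_totalDegree (f : MvPolynomial (Fin n) K) : f ∈ degLT K n (f.totalDegree + 1) :=
  fun μ hμ => coeff_eq_zero_of_totalDegree_lt (by
    have : μ.degree = ∑ i ∈ μ.support, μ i := rfl
    omega)

theorem totalDegree_le_iff_mem_degLT {k : ℕ} {f : MvPolynomial (Fin n) K} :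
    f.totalDegree ≤ k ↔ f ∈ degLT K n (k + 1) := by
  constructor
  · exact fun h => degLT_mono (by omega) (mem_degLT_totalDegree f)
  · intro h
    refine Finset.sup_le fun μ hμ => ?_
    by_contra hlt
    have : (μ.sum fun _ e => e) = μ.degree := rfl
    exact mem_support_iff.1 hμ (h μ (by omega))

theorem homogeneousComponent_mul {d k : ℕ} {g : MvPolynomial (Fin n) K} (hg : g.IsHomogeneous d)
    (f : MvPolynomial (Fin n) K) :
    homogeneousComponent k (f * g)
      = if d ≤ k then homogeneousComponent (k - d) f * g else 0 := by
  conv_lhs => rw [← sum_homogeneousComponent f, Finset.sum_mul, map_sum]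
  have h (i : ℕ) : homogeneousComponent k (homogeneousComponent i f * g)
      = if i + d = k then homogeneousComponent i f * g else 0 := by
    rw [homogeneousComponent_of_mem ((homogeneousComponent_isHomogeneous i f).mul hg)]
    simp [eq_comm]
  rw [Finset.sum_congr rfl fun i _ => h i]
  split_ifs with hd
  · by_cases hk : k - d ∈ Finset.range (f.totalDegree + 1)
    · rw [Finset.sum_eq_single_of_mem _ hk fun i _ hi => if_neg (by omega), if_pos (by omega)]
    · rw [Finset.sum_eq_zero fun i hi => if_neg fun h' => hk ?_, homogeneousComponent_eq_zero,
        zero_mul]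
      · rw [Finset.mem_range] at hk
        omega
      · have : k - d = i := by omega
        rwa [this]
  · exact Finset.sum_eq_zero fun i _ => if_neg (by omega)

/-- Homogeneous solutions of linear equations with homogeneous coefficients. -/
theorem exists_homogeneous_solution {l m d k : ℕ}
    {B : Matrix (Fin l) (Fin m) (MvPolynomial (Fin n) K)} (hB : ∀ i j, (B i j).IsHomogeneous d)
    {x : Fin m → MvPolynomial (Fin n) K} (hx : ∀ j, (x j).IsHomogeneous k)
    {y : Fin l → MvPolynomial (Fin n) K} (h : y ᵥ* B = x) :
    ∃ z : Fin l → MvPolynomial (Fin n) K, z ᵥ* B = x ∧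
      (∀ i, (z i).IsHomogeneous (k - d)) ∧ (k < d → z = 0) := by
  -- The component of degree `k - d` of any solution solves the equation. The case distinction
  -- guards against the truncated difference: for `k < d` the solution has to be zero.
  refine ⟨fun i => if d ≤ k then homogeneousComponent (k - d) (y i) else 0, ?_, fun i => ?_,
    fun hk => ?_⟩
  · funext j
    have hj := congrFun h j
    have : homogeneousComponent k (x j) = x j := homogeneousComponent_eq_self (hx j)
    rw [← this, ← hj]
    simp only [Matrix.vecMul, dotProduct, map_sum]
    refine Finset.sum_congr rfl fun i _ => ?_
    rw [homogeneousComponent_mul (hB i j)]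
    split_ifs <;> simp
  · dsimp only
    split_ifs
    · exact homogeneousComponent_isHomogeneous _ _
    · exact isHomogeneous_zero _ _ _
  · funext i
    exact if_neg (by omega)

end DegreeFiltration

/-! ### Monomials in commuting elements -/

section Monomials

theorem multiIndex_induction {n : ℕ} {P : (Fin n →₀ ℕ) → Prop} (h0 : P 0)
    (h1 : ∀ i μ, P μ → P (Finsupp.single i 1 + μ)) (μ : Fin n →₀ ℕ) : P μ := by
  induction hd : μ.degree generalizing μ with
  | zero =>
    rw [(Finsupp.degree_eq_zero_iff μ).1 hd]
    exact h0
  | succ d ih =>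
    have hμ : μ ≠ 0 := by
      rintro rfl
      simp at hd
    obtain ⟨i, hi⟩ := Finsupp.ne_iff.1 hμ
    have hle : Finsupp.single i 1 ≤ μ := by
      rw [Finsupp.single_le_iff]
      exact Nat.one_le_iff_ne_zero.2 hi
    have e : Finsupp.single i 1 + (μ - Finsupp.single i 1) = μ := add_tsub_cancel_of_le hle
    rw [← e]
    refine h1 i _ (ih _ ?_)
    have := congrArg Finsupp.degree e
    rw [map_add, Finsupp.degree_single] at this
    omega

open scoped IsMulCommutative in
/-- Monomials in pairwise commuting elements of a ring. -/
theorem exists_monomials {R : Type*} [Ring R] {n : ℕ} (x : Fin n → R)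
    (hx : ∀ i j, x i * x j = x j * x i) :
    ∃ m : (Fin n →₀ ℕ) → R, m 0 = 1 ∧ ∀ i μ, m (Finsupp.single i 1 + μ) = x i * m μ := by
  -- Products over a finite index set need a commutative ring; the subring generated by the
  -- commuting elements is one.
  have _ : IsMulCommutative (Subring.closure (Set.range x)) :=
    Subring.isMulCommutative_closure (by
      rintro _ ⟨i, rfl⟩ _ ⟨j, rfl⟩
      exact hx i j)
  let y (i : Fin n) : Subring.closure (Set.range x) :=
    ⟨x i, Subring.subset_closure (Set.mem_range_self i)⟩
  refine ⟨fun μ => ((∏ i, y i ^ μ i : Subring.closure (Set.range x)) : R), ?_, fun i μ => ?_⟩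
  · simp
  · have e : ∏ j, y j ^ (Finsupp.single i 1 + μ : Fin n →₀ ℕ) j = y i * ∏ j, y j ^ μ j := by
      simp only [Finsupp.add_apply, pow_add, Finset.prod_mul_distrib]
      congr 1
      rw [Finset.prod_eq_single i]
      · simp
      · intro j _ hj
        rw [Finsupp.single_eq_of_ne hj, pow_zero]
      · simp
    change ((∏ j, y j ^ (Finsupp.single i 1 + μ : Fin n →₀ ℕ) j : Subring.closure (Set.range x)) : R) = _
    rw [e]
    rfl

end Monomials

/-! ### Normal forms and symbols of differential operators -/

section DiffOpSymbols

open MvPolynomial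

variable {K : Type*} [Field K] {n : ℕ} {pd : Fin n → Derivation ℤ K K}

theorem diffOp_induction {P : DiffOp pd → Prop} (hK : ∀ a, P (ofK pd a)) (hd : ∀ i, P (dOp pd i))
    (h0 : P 0) (h1 : P 1) (hadd : ∀ A B, P A → P B → P (A + B)) (hneg : ∀ A, P A → P (-A))
    (hmul : ∀ A B, P A → P B → P (A * B)) (A : DiffOp pd) : P A := by
  obtain ⟨A, hA⟩ := A
  induction hA using Subring.closure_induction with
  | mem x hx =>
    rcases hx with ⟨a, rfl⟩ | ⟨i, rfl⟩
    · exact hK a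
    · exact hd i
  | zero => exact h0
  | one => exact h1
  | add x y hx hy ihx ihy => exact hadd _ _ ihx ihy
  | neg x hx ih => exact hneg _ ih
  | mul x y hx hy ihx ihy => exact hmul _ _ ihx ihy

theorem normalForm_one : normalForm (1 : DiffOp pd) = 1 := rfl

theorem normalForm_ofK (a : K) : normalForm (ofK pd a) = C a := by
  have := normalForm_ofK_mul (pd := pd) a 1
  rwa [mul_one, normalForm_one, mul_one] at this

theorem coeff_map_derivation (D : Derivation ℤ K K) (f : MvPolynomial (Fin n) K)
    (μ : Fin n →₀ ℕ) : coeff μ (AddMonoidAlgebra.map (D : K →+ K) f) = D (coeff μ f) := rfl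

theorem map_derivation_mem_degLT (D : Derivation ℤ K K) {k : ℕ} {f : MvPolynomial (Fin n) K}
    (hf : f ∈ degLT K n k) :
    (AddMonoidAlgebra.map (D : K →+ K) f : MvPolynomial (Fin n) K) ∈ degLT K n k := by
  intro μ hμ
  rw [coeff_map_derivation, hf μ hμ, map_zero]

theorem X_mem_degLT (i : Fin n) : (X i : MvPolynomial (Fin n) K) ∈ degLT K n 2 :=
  isHomogeneous_mem_degLT (isHomogeneous_X K i)

theorem C_mem_degLT (a : K) : (C a : MvPolynomial (Fin n) K) ∈ degLT K n 1 :=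
  isHomogeneous_mem_degLT (isHomogeneous_C _ a)

/-- Makes the normal form faithful: each operator is recovered from its coefficients. This is not
automatic, because `D` is defined by its generators inside the additive endomorphisms. -/
theorem exists_monomial_operators (hcomm : ∀ i j a, pd i (pd j a) = pd j (pd i a)) :
    ∃ m : (Fin n →₀ ℕ) → DiffOp pd, m 0 = 1 ∧
      (∀ i μ, m (Finsupp.single i 1 + μ) = dOp pd i * m μ) ∧
      (∀ μ, normalForm (m μ) = monomial μ 1) ∧
      (∀ P : DiffOp pd,
        P = ∑ μ ∈ (normalForm P).support, ofK pd (coeff μ (normalForm P)) * m μ) := by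
  obtain ⟨m, hm0, hm⟩ := exists_monomials (dOp pd) (dOp_mul_comm hcomm)
  have hnf (μ) : normalForm (m μ) = monomial μ 1 := by
    induction μ using multiIndex_induction with
    | h0 =>
      rw [hm0]
      rfl
    | h1 i μ ih =>
      rw [hm, normalForm_dOp_mul, ih]
      have : AddMonoidAlgebra.map (pd i : K →+ K) (monomial μ (1 : K))
          = (0 : MvPolynomial (Fin n) K) := by
        ext ν
        rw [coeff_map_derivation, coeff_monomial, coeff_zero]
        split_ifs <;> simp
      rw [this, add_zero, X, monomial_mul, one_mul]
  refine ⟨m, hm0, hm, hnf, fun P => ?_⟩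
  -- The sums of terms `a d^μ` are stable under left multiplication by the generators of `D`, by the
  -- commutation rule, and they contain 1. Hence they are all of `D`.
  let N : AddSubgroup (DiffOp pd) :=
    AddSubgroup.closure {Q | ∃ a μ, Q = ofK pd a * m μ}
  have hN1 (a : K) (μ) : ofK pd a * m μ ∈ N := AddSubgroup.subset_closure ⟨a, μ, rfl⟩
  have hN (A : DiffOp pd) : ∀ Q ∈ N, A * Q ∈ N := by
    induction A using diffOp_induction with
    | hK a =>
      intro Q hQ
      induction hQ using AddSubgroup.closure_induction with
      | mem x hx =>
        obtain ⟨b, μ, rfl⟩ := hx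
        rw [← mul_assoc, ← map_mul]
        exact hN1 _ _
      | zero => simp
      | add x y _ _ hx hy => rw [mul_add]; exact N.add_mem hx hy
      | neg x _ hx => rw [mul_neg]; exact N.neg_mem hx
    | hd i =>
      intro Q hQ
      induction hQ using AddSubgroup.closure_induction with
      | mem x hx =>
        obtain ⟨b, μ, rfl⟩ := hx
        rw [← mul_assoc, dOp_mul_ofK, add_mul, mul_assoc, ← hm]
        exact N.add_mem (hN1 _ _) (hN1 _ _)
      | zero => simp
      | add x y _ _ hx hy => rw [mul_add]; exact N.add_mem hx hy
      | neg x _ hx => rw [mul_neg]; exact N.neg_mem hx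
    | h0 => intro Q _; rw [zero_mul]; exact N.zero_mem
    | h1 => intro Q hQ; rwa [one_mul]
    | hadd A B hA hB => intro Q hQ; rw [add_mul]; exact N.add_mem (hA Q hQ) (hB Q hQ)
    | hneg A hA => intro Q hQ; rw [neg_mul]; exact N.neg_mem (hA Q hQ)
    | hmul A B hA hB => intro Q hQ; rw [mul_assoc]; exact hA _ (hB Q hQ)
  have hP : P ∈ N := by
    have h1 : (1 : DiffOp pd) ∈ N := by
      have := hN1 1 0
      rwa [map_one, hm0, mul_one] at this
    have := hN P 1 h1
    rwa [mul_one] at this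
  -- All sufficiently large index sets are allowed, since the support of a sum can be smaller than
  -- the union of the supports.
  have key : ∃ s : Finset (Fin n →₀ ℕ), ∀ t, s ⊆ t →
      P = ∑ μ ∈ t, ofK pd (coeff μ (normalForm P)) * m μ := by
    clear hN
    induction hP using AddSubgroup.closure_induction with
    | mem x hx =>
      obtain ⟨a, ν, rfl⟩ := hx
      refine ⟨{ν}, fun t ht => ?_⟩
      have e : normalForm (ofK pd a * m ν) = monomial ν a := by
        rw [normalForm_ofK_mul, hnf, C_mul_monomial, mul_one]
      rw [e, Finset.sum_eq_single_of_mem ν (ht (Finset.mem_singleton_self ν))]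
      · rw [coeff_monomial, if_pos rfl]
      · intro μ _ hμ
        rw [coeff_monomial, if_neg hμ.symm, map_zero, zero_mul]
    | zero => exact ⟨∅, fun t _ => by simp⟩
    | add x y _ _ hx hy =>
      obtain ⟨s, hs⟩ := hx
      obtain ⟨s', hs'⟩ := hy
      refine ⟨s ∪ s', fun t ht => ?_⟩
      conv_lhs => rw [hs t (Finset.union_subset_left ht), hs' t (Finset.union_subset_right ht)]
      rw [← Finset.sum_add_distrib]
      refine Finset.sum_congr rfl fun μ _ => ?_
      rw [map_add, coeff_add, map_add, add_mul]
    | neg x _ hx =>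
      obtain ⟨s, hs⟩ := hx
      refine ⟨s, fun t ht => ?_⟩
      conv_lhs => rw [hs t ht]
      rw [← Finset.sum_neg_distrib]
      refine Finset.sum_congr rfl fun μ _ => ?_
      rw [map_neg, coeff_neg, map_neg, neg_mul]
  obtain ⟨s, hs⟩ := key
  rw [Finset.sum_subset (Finset.subset_union_right (s₁ := s)) fun μ _ hμ => by
    rw [notMem_support_iff.1 hμ, map_zero, zero_mul]]
  exact hs _ Finset.subset_union_left

theorem normalForm_injective (hcomm : ∀ i j a, pd i (pd j a) = pd j (pd i a)) {P : DiffOp pd}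
    (h : normalForm P = 0) : P = 0 := by
  obtain ⟨m, -, -, -, hP⟩ := exists_monomial_operators hcomm
  rw [hP P, h]
  simp

theorem normalForm_surjective (hcomm : ∀ i j a, pd i (pd j a) = pd j (pd i a))
    (f : MvPolynomial (Fin n) K) : ∃ P : DiffOp pd, normalForm P = f := by
  obtain ⟨m, -, -, hm, -⟩ := exists_monomial_operators hcomm
  refine ⟨∑ μ ∈ f.support, ofK pd (coeff μ f) * m μ, ?_⟩
  rw [map_sum]
  conv_rhs => rw [f.as_sum]
  refine Finset.sum_congr rfl fun μ _ => ?_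
  rw [normalForm_ofK_mul, hm, C_mul_monomial, mul_one]

/-- Moving a derivation past a coefficient costs one order, so the leading part of a product is the
product of the leading parts. With orders below `a` and `b`, the leading order is `a + b - 2` and
the difference lies strictly below it. -/
theorem normalForm_mul_sub (hcomm : ∀ i j a, pd i (pd j a) = pd j (pd i a)) {a b k : ℕ}
    {P Q : DiffOp pd} (hP : normalForm P ∈ degLT K n a) (hQ : normalForm Q ∈ degLT K n b)
    (hk : a + b ≤ k + 2) : normalForm (P * Q) - normalForm P * normalForm Q ∈ degLT K n k := by
  obtain ⟨m, hm0, hm, hnf, hsum⟩ := exists_monomial_operators hcomm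
  -- If the truncated difference degenerates, that is `μ.degree + b = 0`, then `Q` has normal form
  -- zero and the claim still holds.
  have h1 (μ) : normalForm (m μ * Q) - monomial μ 1 * normalForm Q
      ∈ degLT K n (μ.degree + b - 1) := by
    induction μ using multiIndex_induction with
    | h0 =>
      rw [hm0, one_mul]
      have : (monomial (0 : Fin n →₀ ℕ) (1 : K)) = 1 := rfl
      rw [this, one_mul, sub_self]
      exact Submodule.zero_mem _
    | h1 i μ ih =>
      have e : (Finsupp.single i 1 + μ).degree + b - 1 = μ.degree + b := by
        rw [map_add, Finsupp.degree_single]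
        omega
      rw [hm, mul_assoc, normalForm_dOp_mul, e]
      have h2 : (monomial (Finsupp.single i 1 + μ) (1 : K)) = X i * monomial μ 1 := by
        rw [X, monomial_mul, one_mul]
      have h3 : normalForm (m μ * Q) ∈ degLT K n (μ.degree + b) := by
        have h4 : monomial μ (1 : K) * normalForm Q ∈ degLT K n (μ.degree + b) :=
          mul_mem_degLT (isHomogeneous_mem_degLT (isHomogeneous_monomial 1 rfl)) hQ (by omega)
        have := Submodule.add_mem _ (degLT_mono (Nat.sub_le _ 1) ih) h4
        rwa [sub_add_cancel] at this
      have h5 : X i * (normalForm (m μ * Q) - monomial μ 1 * normalForm Q)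
          ∈ degLT K n (μ.degree + b) := by
        rcases Nat.eq_zero_or_pos (μ.degree + b) with h0 | h0
        · rw [h0] at ih
          rw [eq_zero_of_degLT_zero ih, mul_zero]
          exact Submodule.zero_mem _
        · exact mul_mem_degLT (X_mem_degLT i) ih (by omega)
      have := Submodule.add_mem _ h5 (map_derivation_mem_degLT (pd i) h3)
      convert this using 1
      rw [h2]
      ring
  have h2 : normalForm P = ∑ μ ∈ (normalForm P).support,
      C (coeff μ (normalForm P)) * monomial μ 1 := by
    conv_lhs => rw [(normalForm P).as_sum]
    exact Finset.sum_congr rfl fun μ _ => by rw [C_mul_monomial, mul_one]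
  have h3 : normalForm (P * Q) - normalForm P * normalForm Q = ∑ μ ∈ (normalForm P).support,
      C (coeff μ (normalForm P)) * (normalForm (m μ * Q) - monomial μ 1 * normalForm Q) := by
    conv_lhs =>
      rw [show P * Q = (∑ μ ∈ (normalForm P).support, ofK pd (coeff μ (normalForm P)) * m μ) * Q
        by rw [← hsum P]]
      rw [show normalForm P * normalForm Q = (∑ μ ∈ (normalForm P).support,
        C (coeff μ (normalForm P)) * monomial μ 1) * normalForm Q by rw [← h2]]
    rw [Finset.sum_mul, Finset.sum_mul, map_sum, ← Finset.sum_sub_distrib]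
    refine Finset.sum_congr rfl fun μ _ => ?_
    rw [mul_assoc, normalForm_ofK_mul]
    ring
  rw [h3]
  refine Submodule.sum_mem _ fun μ hμ => mul_mem_degLT (C_mem_degLT _) (h1 μ) ?_
  have : μ.degree < a := by
    by_contra hlt
    exact mem_support_iff.1 hμ (hP μ (by omega))
  omega

/-- `P` has order at most `k`, and its part of order `k` is `A`. -/
def HasSymbol (P : DiffOp pd) (k : ℕ) (A : MvPolynomial (Fin n) K) : Prop :=
  A.IsHomogeneous k ∧ normalForm P - A ∈ degLT K n k

theorem HasSymbol.mem {P : DiffOp pd} {k : ℕ} {A : MvPolynomial (Fin n) K}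
    (h : HasSymbol P k A) : normalForm P ∈ degLT K n (k + 1) := by
  have := Submodule.add_mem _ (degLT_mono (Nat.le_succ k) h.2) (isHomogeneous_mem_degLT h.1)
  rwa [sub_add_cancel] at this

theorem HasSymbol.add {P Q : DiffOp pd} {k : ℕ} {A B : MvPolynomial (Fin n) K}
    (hP : HasSymbol P k A) (hQ : HasSymbol Q k B) : HasSymbol (P + Q) k (A + B) := by
  refine ⟨hP.1.add hQ.1, ?_⟩
  rw [map_add, add_sub_add_comm]
  exact Submodule.add_mem _ hP.2 hQ.2

theorem HasSymbol.neg {P : DiffOp pd} {k : ℕ} {A : MvPolynomial (Fin n) K}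
    (hP : HasSymbol P k A) : HasSymbol (-P) k (-A) := by
  refine ⟨hP.1.neg, ?_⟩
  rw [map_neg, neg_sub_neg, ← neg_sub]
  exact Submodule.neg_mem _ hP.2

theorem hasSymbol_zero (k : ℕ) : HasSymbol (0 : DiffOp pd) k 0 :=
  ⟨isHomogeneous_zero _ _ _, by simp⟩

theorem HasSymbol.sum {ι : Type*} {s : Finset ι} {P : ι → DiffOp pd} {k : ℕ}
    {A : ι → MvPolynomial (Fin n) K} (h : ∀ i ∈ s, HasSymbol (P i) k (A i)) :
    HasSymbol (∑ i ∈ s, P i) k (∑ i ∈ s, A i) := by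
  classical
  induction s using Finset.induction_on with
  | empty => exact hasSymbol_zero k
  | insert a s ha ih =>
    rw [Finset.sum_insert ha, Finset.sum_insert ha]
    exact (h a (Finset.mem_insert_self a s)).add (ih fun i hi => h i (Finset.mem_insert_of_mem hi))

theorem HasSymbol.mul (hcomm : ∀ i j a, pd i (pd j a) = pd j (pd i a)) {P Q : DiffOp pd}
    {a b : ℕ} {A B : MvPolynomial (Fin n) K} (hP : HasSymbol P a A) (hQ : HasSymbol Q b B) :
    HasSymbol (P * Q) (a + b) (A * B) := by
  refine ⟨hP.1.mul hQ.1, ?_⟩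
  have h1 := normalForm_mul_sub hcomm hP.mem hQ.mem (k := a + b) (by omega)
  have h2 := mul_mem_degLT (k := a + b) hP.2 hQ.mem (by omega)
  have h3 := mul_mem_degLT (k := a + b) (isHomogeneous_mem_degLT hP.1) hQ.2 (by omega)
  have := Submodule.add_mem _ (Submodule.add_mem _ h1 h2) h3
  convert this using 1
  ring

theorem hasSymbol_of_mem {P : DiffOp pd} {k : ℕ} (h : normalForm P ∈ degLT K n (k + 1)) :
    HasSymbol P k (homogeneousComponent k (normalForm P)) :=
  ⟨homogeneousComponent_isHomogeneous k _, sub_homogeneousComponent_mem_degLT h⟩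

theorem HasSymbol.eq_zero {P : DiffOp pd} {k : ℕ} {A : MvPolynomial (Fin n) K}
    (h : HasSymbol P k A) (hP : normalForm P ∈ degLT K n k) : A = 0 := by
  refine eq_zero_of_isHomogeneous_of_mem_degLT h.1 ?_
  have := Submodule.sub_mem _ hP h.2
  rwa [sub_sub_cancel] at this

theorem HasSymbol.mem_of_zero {P : DiffOp pd} {k : ℕ} (h : HasSymbol P k 0) :
    normalForm P ∈ degLT K n k := by
  have := h.2
  rwa [sub_zero] at this

theorem exists_hasSymbol (hcomm : ∀ i j a, pd i (pd j a) = pd j (pd i a)) {k : ℕ}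
    {A : MvPolynomial (Fin n) K} (hA : A.IsHomogeneous k) : ∃ P : DiffOp pd, HasSymbol P k A := by
  obtain ⟨P, hP⟩ := normalForm_surjective hcomm A
  refine ⟨P, hA, ?_⟩
  rw [hP, sub_self]
  exact Submodule.zero_mem _

theorem HasSymbol.vecMul (hcomm : ∀ i j a, pd i (pd j a) = pd j (pd i a)) {p m a b : ℕ}
    {c : Fin p → DiffOp pd} {x : Fin p → MvPolynomial (Fin n) K}
    {P : Matrix (Fin p) (Fin m) (DiffOp pd)} {A : Matrix (Fin p) (Fin m) (MvPolynomial (Fin n) K)}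
    (hc : ∀ i, HasSymbol (c i) a (x i)) (hP : ∀ i j, HasSymbol (P i j) b (A i j)) (j : Fin m) :
    HasSymbol ((c ᵥ* P) j) (a + b) ((x ᵥ* A) j) :=
  HasSymbol.sum fun i _ => (hc i).mul hcomm (hP i j)

/-- The rows whose entries have order less than `k`. -/
def RowLT {p : ℕ} (k : ℕ) (c : Fin p → DiffOp pd) : Prop := ∀ i, normalForm (c i) ∈ degLT K n k

theorem RowLT.mono {p k l : ℕ} (h : k ≤ l) {c : Fin p → DiffOp pd} (hc : RowLT k c) : RowLT l c :=
  fun i => degLT_mono h (hc i)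

theorem RowLT.add {p k : ℕ} {c c' : Fin p → DiffOp pd} (hc : RowLT k c) (hc' : RowLT k c') :
    RowLT k (c + c') := fun i => by
  rw [Pi.add_apply, map_add]
  exact Submodule.add_mem _ (hc i) (hc' i)

theorem RowLT.eq_zero (hcomm : ∀ i j a, pd i (pd j a) = pd j (pd i a)) {p : ℕ}
    {c : Fin p → DiffOp pd} (hc : RowLT 0 c) : c = 0 :=
  funext fun i => normalForm_injective hcomm (eq_zero_of_degLT_zero (hc i))

theorem exists_rowLT {p : ℕ} (c : Fin p → DiffOp pd) : ∃ k, RowLT k c :=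
  ⟨Finset.univ.sup fun i => (normalForm (c i)).totalDegree + 1, fun i =>
    degLT_mono (Finset.le_sup (f := fun i => (normalForm (c i)).totalDegree + 1)
      (Finset.mem_univ i)) (mem_degLT_totalDegree _)⟩

/-- Every CC of `P` of order less than `k` is a combination of the rows of `Q` with coefficients
of order less than `k - d`. -/
def StrictlyGenerates {l p m : ℕ} (P : Matrix (Fin p) (Fin m) (DiffOp pd))
    (Q : Matrix (Fin l) (Fin p) (DiffOp pd)) (d : ℕ) : Prop :=
  ∀ k c, RowLT k c → c ᵥ* P = 0 → ∃ b, RowLT (k - d) b ∧ b ᵥ* Q = c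

/-- Induction on the order: the leading part of a CC is a CC of the symbol, hence `y ᵥ* B` with
homogeneous `y`. Subtracting an operator with symbol `y` composed with `Q` lowers the order. If the
order is below `d₂`, then `y` can be taken zero and the leading part already vanishes. -/
theorem strictlyGenerates_of_symbol (hcomm : ∀ i j a, pd i (pd j a) = pd j (pd i a))
    {l p m d₁ d₂ : ℕ} {P : Matrix (Fin p) (Fin m) (DiffOp pd)}
    {Q : Matrix (Fin l) (Fin p) (DiffOp pd)}
    {A : Matrix (Fin p) (Fin m) (MvPolynomial (Fin n) K)}
    {B : Matrix (Fin l) (Fin p) (MvPolynomial (Fin n) K)}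
    (hP : ∀ i j, HasSymbol (P i j) d₁ (A i j)) (hQ : ∀ i j, HasSymbol (Q i j) d₂ (B i j))
    (hQP : ∀ b, b ᵥ* Q ᵥ* P = 0) (hAB : ∀ x, x ᵥ* A = 0 → ∃ y, y ᵥ* B = x) :
    StrictlyGenerates P Q d₂ := by
  intro k
  induction k with
  | zero =>
    intro c hc _
    refine ⟨0, fun i => by simp, ?_⟩
    rw [hc.eq_zero hcomm, Matrix.zero_vecMul]
  | succ k ih =>
    intro c hc hcP
    have hsym (i) := hasSymbol_of_mem (hc i)
    obtain ⟨y, hy⟩ := hAB (fun i => homogeneousComponent k (normalForm (c i))) (by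
      funext j
      refine (HasSymbol.vecMul hcomm hsym hP j).eq_zero ?_
      rw [hcP]
      simp)
    obtain ⟨z, hz, hzhom, hz0⟩ := exists_homogeneous_solution (fun i j => (hQ i j).1)
      (fun i => homogeneousComponent_isHomogeneous k _) hy
    by_cases hk : k < d₂
    · have hx : ∀ i, homogeneousComponent k (normalForm (c i)) = 0 := fun i => by
        rw [← congrFun hz i, hz0 hk, Matrix.zero_vecMul]
        rfl
      obtain ⟨b, hb, hbc⟩ := ih c (fun i => by
        have := hsym i
        rw [hx i] at this
        exact this.mem_of_zero) hcP
      exact ⟨b, hb.mono (by omega), hbc⟩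
    · choose b₀ hb₀ using fun i => exists_hasSymbol (pd := pd) hcomm (hzhom i)
      have hsub : RowLT k (c - b₀ ᵥ* Q) := fun i => by
        have h1 := HasSymbol.vecMul hcomm hb₀ hQ i
        rw [hz, Nat.sub_add_cancel (by omega)] at h1
        have h2 := (hsym i).add h1.neg
        rw [add_neg_cancel, ← sub_eq_add_neg] at h2
        exact h2.mem_of_zero
      obtain ⟨b, hb, hbc⟩ := ih (c - b₀ ᵥ* Q) hsub (by
        rw [Matrix.sub_vecMul, hcP, hQP, sub_zero])
      refine ⟨b + b₀, (hb.mono (by omega)).add fun i => ?_, ?_⟩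
      · have := (hb₀ i).mem
        rwa [← Nat.sub_add_comm (by omega)] at this
      · rw [Matrix.add_vecMul, hbc, sub_add_cancel]

/-- Any operator with the prescribed symbol composes with `P` to something of too low an order;
`hred` absorbs it by a correction of lower order, which leaves the symbol unchanged. The hypothesis
`hred` is formal integrability of `P` at the relevant order. -/
theorem exists_lift_of_symbol (hcomm : ∀ i j a, pd i (pd j a) = pd j (pd i a))
    {l p m d₁ d₂ : ℕ} {P : Matrix (Fin p) (Fin m) (DiffOp pd)}
    {A : Matrix (Fin p) (Fin m) (MvPolynomial (Fin n) K)}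
    {B : Matrix (Fin l) (Fin p) (MvPolynomial (Fin n) K)}
    (hP : ∀ i j, HasSymbol (P i j) d₁ (A i j)) (hB : ∀ i j, (B i j).IsHomogeneous d₂)
    (hBA : ∀ y, y ᵥ* B ᵥ* A = 0)
    (hred : ∀ c : Fin p → DiffOp pd, RowLT (d₁ + d₂) (c ᵥ* P) →
      ∃ b : Fin p → DiffOp pd, RowLT d₂ b ∧ b ᵥ* P = c ᵥ* P) :
    ∃ Q : Matrix (Fin l) (Fin p) (DiffOp pd), (∀ i j, HasSymbol (Q i j) d₂ (B i j)) ∧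
      ∀ b, b ᵥ* Q ᵥ* P = 0 := by
  have hrow (i : Fin l) : ∃ q : Fin p → DiffOp pd, (∀ j, HasSymbol (q j) d₂ (B i j)) ∧
      q ᵥ* P = 0 := by
    choose q₀ hq₀ using fun j => exists_hasSymbol (pd := pd) hcomm (hB i j)
    obtain ⟨b, hb, hbP⟩ := hred q₀ fun j => by
      have h1 := HasSymbol.vecMul hcomm hq₀ hP j
      have h2 := hBA (Pi.single i 1)
      rw [Matrix.single_one_vecMul] at h2
      have h3 : ((fun j => B i j) ᵥ* A) j = 0 := congrFun h2 j
      rw [h3] at h1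
      rw [add_comm]
      exact h1.mem_of_zero
    refine ⟨q₀ - b, fun j => ⟨hB i j, ?_⟩, ?_⟩
    · rw [Pi.sub_apply, map_sub, sub_right_comm]
      exact Submodule.sub_mem _ (hq₀ j).2 (hb j)
    · rw [Matrix.sub_vecMul, hbP, sub_self]
  choose q hq hqP using hrow
  refine ⟨Matrix.of q, hq, fun b => ?_⟩
  have : Matrix.of q * P = 0 := by
    ext1 i j
    exact congrFun (hqP i) j
  rw [Matrix.vecMul_vecMul, this, Matrix.vecMul_zero]

theorem mem_compat_iff {p m k : ℕ} {P : Matrix (Fin p) (Fin m) (DiffOp pd)}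
    {c : Fin p → DiffOp pd} : c ∈ compat P k ↔ RowLT (k + 1) c ∧ c ᵥ* P = 0 :=
  and_congr_left fun _ => forall_congr' fun _ => totalDegree_le_iff_mem_degLT

/-- Order at most `k` means less than `k + 1 ≤ d`, so the coefficients have order less than 0. -/
theorem StrictlyGenerates.compat_eq_bot (hcomm : ∀ i j a, pd i (pd j a) = pd j (pd i a))
    {l p m d k : ℕ} {P : Matrix (Fin p) (Fin m) (DiffOp pd)}
    {Q : Matrix (Fin l) (Fin p) (DiffOp pd)} (h : StrictlyGenerates P Q d) (hk : k < d) :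
    compat P k = ⊥ := by
  rw [eq_bot_iff]
  intro c hc
  obtain ⟨h1, h2⟩ := mem_compat_iff.1 hc
  obtain ⟨b, hb, rfl⟩ := h _ c h1 h2
  rw [Nat.sub_eq_zero_of_le (by omega)] at hb
  rw [hb.eq_zero hcomm, Matrix.zero_vecMul]
  exact Submodule.zero_mem _

theorem sum_smul_row {l p : ℕ} (Q : Matrix (Fin l) (Fin p) (DiffOp pd)) (a : Fin l → K) :
    ∑ i, a i • Q.row i = (fun i => ofK pd (a i)) ᵥ* Q := by
  funext j
  rw [Finset.sum_apply]
  rfl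

theorem rowLT_one_ofK {l : ℕ} (a : Fin l → K) : RowLT 1 fun i => ofK pd (a i) := fun i => by
  rw [normalForm_ofK]
  exact C_mem_degLT _

theorem exists_ofK_of_rowLT_one (hcomm : ∀ i j a, pd i (pd j a) = pd j (pd i a)) {l : ℕ}
    {b : Fin l → DiffOp pd} (hb : RowLT 1 b) : ∃ a : Fin l → K, b = fun i => ofK pd (a i) := by
  refine ⟨fun i => coeff 0 (normalForm (b i)), funext fun i => ?_⟩
  rw [← sub_eq_zero]
  refine normalForm_injective hcomm ?_
  rw [map_sub, normalForm_ofK]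
  ext μ
  rw [coeff_sub, coeff_C, coeff_zero]
  split_ifs with h
  · rw [h, sub_self]
  · rw [hb i μ (Nat.one_le_iff_ne_zero.2 fun h' => h ((Finsupp.degree_eq_zero_iff μ).1 h').symm),
      sub_zero]

/-- A CC of order at most `d` has coefficients of order less than `d + 1 - d = 1`, that is, in `K`.
So strictness gives the basis property and generation at once. -/
theorem StrictlyGenerates.isGeneratingCC (hcomm : ∀ i j a, pd i (pd j a) = pd j (pd i a))
    {l p m d : ℕ} {P : Matrix (Fin (p + 1)) (Fin m) (DiffOp pd)}
    {Q : Matrix (Fin (l + 1)) (Fin (p + 1)) (DiffOp pd)} (h : StrictlyGenerates P Q d)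
    (hQ : ∀ i, RowLT (d + 1) (Q i)) (hQP : ∀ b, b ᵥ* Q ᵥ* P = 0)
    (hind : ∀ b, RowLT 1 b → b ᵥ* Q = 0 → b = 0) : IsGeneratingCC P Q d := by
  have hli : LinearIndependent K Q.row := by
    rw [Fintype.linearIndependent_iff]
    intro a ha i
    rw [sum_smul_row] at ha
    have := congrArg normalForm (congrFun (hind _ (rowLT_one_ofK a) ha) i)
    rw [normalForm_ofK, Pi.zero_apply, map_zero] at this
    exact C_injective _ _ (by rw [this, C_0])
  have hrow (i) : Q.row i ∈ compat P d := by
    refine mem_compat_iff.2 ⟨hQ i, ?_⟩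
    have := hQP (Pi.single i 1)
    rwa [Matrix.single_one_vecMul] at this
  refine ⟨⟨hli, le_antisymm ?_ fun c hc => ?_⟩, fun c hc => ?_, fun j hj hall => ?_⟩
  · rw [Submodule.span_le]
    rintro _ ⟨i, rfl⟩
    exact hrow i
  · obtain ⟨h1, h2⟩ := mem_compat_iff.1 hc
    obtain ⟨b, hb, rfl⟩ := h _ c h1 h2
    rw [Nat.add_sub_cancel_left] at hb
    obtain ⟨a, rfl⟩ := exists_ofK_of_rowLT_one hcomm hb
    rw [← sum_smul_row]
    exact Submodule.sum_mem _ fun i _ =>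
      Submodule.smul_mem _ _ (Submodule.subset_span ⟨i, rfl⟩)
  · obtain ⟨k, hk⟩ := exists_rowLT c
    obtain ⟨b, -, hb⟩ := h k c hk hc
    exact ⟨b, hb.symm⟩
  -- There are no CC of order below `d`, while `Q` has at least one row and its rows are nonzero.
  · refine hli.ne_zero 0 ?_
    have := hall _ (mem_compat_iff.1 (hrow 0)).2
    rwa [h.compat_eq_bot hcomm hj, Submodule.bot_coe, Submodule.span_zero_singleton,
      Submodule.mem_bot] at this

end DiffOpSymbols

/-! ### The tractor connection of a conformally flat metric -/

section Curvature

variable {K : Type*} [Field K]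

/-- The second Bianchi identity of a connection `∂_i + Ω_i`. -/
theorem connection_bianchi {R : Type*} [Ring R] {n : ℕ} (δ : Fin n → R →+ R)
    (hδ : ∀ i a b, δ i (a * b) = δ i a * b + a * δ i b) (hcomm : ∀ i j a, δ i (δ j a) = δ j (δ i a))
    (Ω : Fin n → R) (F : Fin n → Fin n → R)
    (hF : ∀ i j, F i j = δ i (Ω j) - δ j (Ω i) + Ω i * Ω j - Ω j * Ω i) (i j k : Fin n) :
    (δ k (F i j) + Ω k * F i j - F i j * Ω k) + (δ i (F j k) + Ω i * F j k - F j k * Ω i)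
      + (δ j (F k i) + Ω j * F k i - F k i * Ω j) = 0 := by
  simp only [hF, map_add, map_sub, hδ, hcomm k i, hcomm k j, hcomm i j]
  noncomm_ring

/-- The indices of the frame `X, Y, Z_1, …, Z_n` of the tractor bundle. -/
abbrev TractorIndex (n : ℕ) : Type := Option (Option (Fin n))

variable {n : ℕ}

/-- The matrices of the tractor connection: `X ↦ Z_i`, `Z_k ↦ -P_{ik} X + Γ^m_{ik} Z_m - ω_{ik} Y`,
`Y ↦ S^m_i Z_m`. -/
def tractorMatrix (Γ : Fin n → Fin n → Fin n → K) (ω P S : Matrix (Fin n) (Fin n) K) (i : Fin n) :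
    Matrix (TractorIndex n) (TractorIndex n) K := fun a b =>
  match a, b with
  | none, some (some k) => -P i k
  | some none, some (some k) => -ω i k
  | some (some m), none => if m = i then 1 else 0
  | some (some m), some none => S m i
  | some (some m), some (some k) => Γ m i k
  | _, _ => 0

theorem christoffel_comm {pd : Fin n → Derivation ℤ K K} {ω : Matrix (Fin n) (Fin n) K}
    (hω : ω.IsSymm) (k i j : Fin n) : christoffel pd ω k i j = christoffel pd ω k j i := by
  unfold christoffel
  congr 1
  refine Finset.sum_congr rfl fun r _ => ?_
  rw [← hω.apply i j]
  ring

theorem sum_mul_inv {ω : Matrix (Fin n) (Fin n) K} (hdet : ω.det ≠ 0) (i j : Fin n) :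
    ∑ r, ω i r * ω⁻¹ r j = if i = j then 1 else 0 := by
  rw [← Matrix.mul_apply, Matrix.mul_nonsing_inv _ (isUnit_iff_ne_zero.2 hdet), Matrix.one_apply]

theorem sum_inv_mul {ω : Matrix (Fin n) (Fin n) K} (hdet : ω.det ≠ 0) (i j : Fin n) :
    ∑ r, ω⁻¹ i r * ω r j = if i = j then 1 else 0 := by
  rw [← Matrix.mul_apply, Matrix.nonsing_inv_mul _ (isUnit_iff_ne_zero.2 hdet), Matrix.one_apply]

theorem inv_symm {ω : Matrix (Fin n) (Fin n) K} (hω : ω.IsSymm) (i j : Fin n) :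
    ω⁻¹ i j = ω⁻¹ j i := by
  have h : (ω⁻¹)ᵀ = ω⁻¹ := by rw [Matrix.transpose_nonsing_inv, hω.eq]
  exact congrFun (congrFun h j) i

theorem sum_mul_sum_inv {ω : Matrix (Fin n) (Fin n) K} (hdet : ω.det ≠ 0) (t : Fin n → K)
    (k : Fin n) : ∑ r, ω k r * ∑ s, ω⁻¹ r s * t s = t k := by
  have : ω *ᵥ (ω⁻¹ *ᵥ t) = t := by
    rw [Matrix.mulVec_mulVec, Matrix.mul_nonsing_inv _ (isUnit_iff_ne_zero.2 hdet),
      Matrix.one_mulVec]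
  exact congrFun this k

theorem sum_inv_mul_sum {ω : Matrix (Fin n) (Fin n) K} (hdet : ω.det ≠ 0) (t : Fin n → K)
    (k : Fin n) : ∑ r, ω⁻¹ k r * ∑ s, ω r s * t s = t k := by
  have : ω⁻¹ *ᵥ (ω *ᵥ t) = t := by
    rw [Matrix.mulVec_mulVec, Matrix.nonsing_inv_mul _ (isUnit_iff_ne_zero.2 hdet),
      Matrix.one_mulVec]
  exact congrFun this k

theorem sum_mul_christoffel {pd : Fin n → Derivation ℤ K K} {ω : Matrix (Fin n) (Fin n) K}
    (hdet : ω.det ≠ 0) (k i j : Fin n) : ∑ r, ω k r * christoffel pd ω r i j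
      = 1 / 2 * (pd i (ω k j) + pd j (ω k i) - pd k (ω i j)) := by
  unfold christoffel
  simp only [mul_left_comm _ (1 / 2 : K), ← Finset.mul_sum]
  rw [sum_mul_sum_inv hdet (fun r => pd i (ω r j) + pd j (ω r i) - pd r (ω i j))]

theorem metric_compat [CharZero K] {pd : Fin n → Derivation ℤ K K} {ω : Matrix (Fin n) (Fin n) K}
    (hω : ω.IsSymm) (hdet : ω.det ≠ 0) (i j k : Fin n) : pd i (ω j k)
      = ∑ r, ω k r * christoffel pd ω r i j + ∑ r, ω j r * christoffel pd ω r i k := by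
  rw [sum_mul_christoffel hdet, sum_mul_christoffel hdet, hω.apply j k, hω.apply i k,
    hω.apply i j]
  ring

theorem riemann_cyclic {pd : Fin n → Derivation ℤ K K} {ω : Matrix (Fin n) (Fin n) K}
    (hω : ω.IsSymm) (k l i j : Fin n) :
    riemann pd ω k l i j + riemann pd ω k i j l + riemann pd ω k j l i = 0 := by
  have hs : (∑ r, (christoffel pd ω r l j * christoffel pd ω k r i
        - christoffel pd ω r l i * christoffel pd ω k r j))
      + (∑ r, (christoffel pd ω r i l * christoffel pd ω k r j
        - christoffel pd ω r i j * christoffel pd ω k r l))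
      + ∑ r, (christoffel pd ω r j i * christoffel pd ω k r l
        - christoffel pd ω r j l * christoffel pd ω k r i) = 0 := by
    rw [← Finset.sum_add_distrib, ← Finset.sum_add_distrib]
    refine Finset.sum_eq_zero fun r _ => ?_
    rw [christoffel_comm hω r l j, christoffel_comm hω r l i, christoffel_comm hω r i j]
    ring
  unfold riemann
  rw [christoffel_comm hω k l j, christoffel_comm hω k l i, christoffel_comm hω k i j]
  linear_combination hs

/-- The Schouten tensor of a metric in dimension four. -/
def schouten (pd : Fin 4 → Derivation ℤ K K) (ω : Matrix (Fin 4) (Fin 4) K) :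
    Matrix (Fin 4) (Fin 4) K :=
  fun i j => 1 / 2 * (ricci pd ω i j - scalarCurvature pd ω / 6 * ω i j)

/-! ### Schouten tensor, Cotton tensor and tractor curvature in dimension four -/

section FourDimensions

variable {pd : Fin 4 → Derivation ℤ K K} {ω : Matrix (Fin 4) (Fin 4) K}

/-- The constants are `1/(n-2) = 1/2` and `1/((n-1)(n-2)) = 1/6`; each of the two Schouten terms
carries half of the latter, which is the `1/12`. -/
theorem riemann_eq_schouten [CharZero K] (hdet : ω.det ≠ 0)
    (hW : ∀ k l i j, weylTensor pd ω k l i j = 0) (k l i j : Fin 4) :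
    riemann pd ω k l i j = (if k = i then 1 else 0) * schouten pd ω l j
      - (if k = j then 1 else 0) * schouten pd ω l i
      + ω l j * (ω⁻¹ * schouten pd ω) k i - ω l i * (ω⁻¹ * schouten pd ω) k j := by
  have hS (k i : Fin 4) : (ω⁻¹ * schouten pd ω) k i
      = 1 / 2 * (∑ s, ω⁻¹ k s * ricci pd ω s i)
        - 1 / 12 * scalarCurvature pd ω * (if k = i then 1 else 0) := by
    rw [← sum_inv_mul hdet, Matrix.mul_apply, Finset.mul_sum, Finset.mul_sum,
      ← Finset.sum_sub_distrib]
    refine Finset.sum_congr rfl fun s _ => ?_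
    rw [schouten]
    ring
  have h := hW k l i j
  simp only [weylTensor] at h
  rw [hS, hS, schouten, schouten]
  push_cast at h
  linear_combination h

/-- The cyclic identity with one index `k` repeated, and different from both `l` and `j`, leaves
only `P_{lj} - P_{jl}` once the Riemann tensor is expressed by the Schouten tensor. -/
theorem schouten_symm [CharZero K] (hω : ω.IsSymm) (hdet : ω.det ≠ 0)
    (hW : ∀ k l i j, weylTensor pd ω k l i j = 0) (l j : Fin 4) :
    schouten pd ω l j = schouten pd ω j l := by
  obtain ⟨k, hl, hj⟩ : ∃ k : Fin 4, k ≠ l ∧ k ≠ j := by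
    revert l j
    decide
  have h := riemann_cyclic (pd := pd) hω k l k j
  simp only [riemann_eq_schouten hdet hW, if_neg hl, if_neg hj, if_true, hω.apply l k,
    hω.apply j k, hω.apply j l] at h
  linear_combination h

/-- The Cotton tensor. -/
def cotton (pd : Fin 4 → Derivation ℤ K K) (ω : Matrix (Fin 4) (Fin 4) K) (i j k : Fin 4) : K :=
  pd i (schouten pd ω j k) - pd j (schouten pd ω i k)
    + ∑ m, (christoffel pd ω m j k * schouten pd ω i m - christoffel pd ω m i k * schouten pd ω j m)

/-- The matrices of the tractor connection of a metric. -/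
def tractorConn (pd : Fin 4 → Derivation ℤ K K) (ω : Matrix (Fin 4) (Fin 4) K) (i : Fin 4) :
    Matrix (TractorIndex 4) (TractorIndex 4) K :=
  tractorMatrix (christoffel pd ω) ω (schouten pd ω) (ω⁻¹ * schouten pd ω) i

/-- Entrywise derivative of a matrix. -/
def mapDeriv {ι : Type*} (D : Derivation ℤ K K) : Matrix ι ι K →+ Matrix ι ι K where
  toFun A := A.map D
  map_zero' := by ext; simp
  map_add' A B := by ext; simp

theorem mapDeriv_apply {ι : Type*} (D : Derivation ℤ K K) (A : Matrix ι ι K) (a b : ι) :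
    mapDeriv D A a b = D (A a b) := rfl

theorem mapDeriv_mul {ι : Type*} [Fintype ι] (D : Derivation ℤ K K) (A B : Matrix ι ι K) :
    mapDeriv D (A * B) = mapDeriv D A * B + A * mapDeriv D B := by
  ext a b
  simp only [mapDeriv_apply, Matrix.mul_apply, Matrix.add_apply, map_sum, Derivation.leibniz,
    smul_eq_mul, ← Finset.sum_add_distrib]
  exact Finset.sum_congr rfl fun _ _ => by ring

/-- The curvature of the tractor connection. -/
def tractorCurv (pd : Fin 4 → Derivation ℤ K K) (ω : Matrix (Fin 4) (Fin 4) K) (i j : Fin 4) :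
    Matrix (TractorIndex 4) (TractorIndex 4) K :=
  mapDeriv (pd i) (tractorConn pd ω j) - mapDeriv (pd j) (tractorConn pd ω i)
    + tractorConn pd ω i * tractorConn pd ω j - tractorConn pd ω j * tractorConn pd ω i

theorem sum_mul_raised (hdet : ω.det ≠ 0) (k i : Fin 4) :
    ∑ m, ω k m * (ω⁻¹ * schouten pd ω) m i = schouten pd ω k i :=
  sum_mul_sum_inv hdet (fun s => schouten pd ω s i) k

/-- Lowering an index commutes with covariant differentiation, by metric compatibility. -/
theorem sum_mul_deriv_raised [CharZero K] (hω : ω.IsSymm) (hdet : ω.det ≠ 0) (i j k : Fin 4) :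
    ∑ m, ω k m * (pd i ((ω⁻¹ * schouten pd ω) m j)
        + ∑ l, christoffel pd ω m i l * (ω⁻¹ * schouten pd ω) l j)
      = pd i (schouten pd ω k j) - ∑ m, christoffel pd ω m i k * schouten pd ω m j := by
  have h1 : pd i (schouten pd ω k j) = ∑ m, (ω k m * pd i ((ω⁻¹ * schouten pd ω) m j)
      + (ω⁻¹ * schouten pd ω) m j * pd i (ω k m)) := by
    rw [← sum_mul_raised hdet, map_sum]
    exact Finset.sum_congr rfl fun m _ => Derivation.leibniz _ _ _
  have h2 : ∑ m, christoffel pd ω m i k * schouten pd ω m j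
      = ∑ m, (ω⁻¹ * schouten pd ω) m j * ∑ r, ω m r * christoffel pd ω r i k := by
    simp only [← sum_mul_raised (pd := pd) hdet, Finset.mul_sum]
    rw [Finset.sum_comm]
    refine Finset.sum_congr rfl fun m _ => Finset.sum_congr rfl fun r _ => ?_
    rw [hω.apply r m]
    ring
  have h3 : ∑ m, ω k m * ∑ l, christoffel pd ω m i l * (ω⁻¹ * schouten pd ω) l j
      = ∑ m, (ω⁻¹ * schouten pd ω) m j * ∑ r, ω k r * christoffel pd ω r i m := by
    simp only [Finset.mul_sum]
    rw [Finset.sum_comm]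
    refine Finset.sum_congr rfl fun m _ => Finset.sum_congr rfl fun r _ => ?_
    ring
  simp only [mul_add, Finset.sum_add_distrib, h3]
  rw [h1, h2, Finset.sum_add_distrib, add_sub_assoc, ← Finset.sum_sub_distrib]
  congr 1
  refine Finset.sum_congr rfl fun m _ => ?_
  rw [metric_compat hω hdet i k m]
  ring

theorem sum_mul_tractorCurv [CharZero K] (hω : ω.IsSymm) (hdet : ω.det ≠ 0)
    (hW : ∀ k l i j, weylTensor pd ω k l i j = 0) (i j k : Fin 4) :
    ∑ m, ω k m * tractorCurv pd ω i j (some (some m)) (some none) = cotton pd ω i j k := by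
  have h (m) : tractorCurv pd ω i j (some (some m)) (some none)
      = (pd i ((ω⁻¹ * schouten pd ω) m j)
        + ∑ l, christoffel pd ω m i l * (ω⁻¹ * schouten pd ω) l j)
      - (pd j ((ω⁻¹ * schouten pd ω) m i)
        + ∑ l, christoffel pd ω m j l * (ω⁻¹ * schouten pd ω) l i) := by
    simp only [tractorCurv, tractorConn, tractorMatrix, Matrix.sub_apply, Matrix.add_apply,
      Matrix.mul_apply, Fintype.sum_option, mapDeriv_apply, mul_zero, zero_add]
    ring
  simp only [h, mul_sub, Finset.sum_sub_distrib, sum_mul_deriv_raised hω hdet, cotton]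
  rw [schouten_symm hω hdet hW k j, schouten_symm hω hdet hW k i]
  simp only [schouten_symm hω hdet hW i, schouten_symm hω hdet hW j]
  ring

theorem tractorCurv_apply (i j : Fin 4) (a b : TractorIndex 4) : tractorCurv pd ω i j a b
    = pd i (tractorConn pd ω j a b) - pd j (tractorConn pd ω i a b)
      + ∑ c, tractorConn pd ω i a c * tractorConn pd ω j c b
      - ∑ c, tractorConn pd ω j a c * tractorConn pd ω i c b := rfl

theorem tractorCurv_X [CharZero K] (hω : ω.IsSymm) (hdet : ω.det ≠ 0)
    (hW : ∀ k l i j, weylTensor pd ω k l i j = 0) (i j : Fin 4) (a : TractorIndex 4) :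
    tractorCurv pd ω i j a none = 0 := by
  rw [tractorCurv_apply]
  rcases a with - | - | m
  · simp [tractorConn, tractorMatrix, Fintype.sum_option, schouten_symm hω hdet hW i j]
  · simp [tractorConn, tractorMatrix, Fintype.sum_option, hω.apply i j]
  · simp [tractorConn, tractorMatrix, Fintype.sum_option, christoffel_comm hω m i j, apply_ite]

theorem tractorCurv_ZZ [CharZero K] (hdet : ω.det ≠ 0)
    (hW : ∀ k l i j, weylTensor pd ω k l i j = 0) (hω : ω.IsSymm) (i j m k : Fin 4) :
    tractorCurv pd ω i j (some (some m)) (some (some k)) = 0 := by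
  have h := riemann_eq_schouten hdet hW m k i j
  rw [schouten_symm hω hdet hW k j, schouten_symm hω hdet hW k i, ← hω.apply k j,
    ← hω.apply k i] at h
  unfold riemann at h
  rw [christoffel_comm hω m k i, christoffel_comm hω m k j, Finset.sum_sub_distrib,
    Finset.sum_congr rfl fun r _ => show christoffel pd ω r k j * christoffel pd ω m r i
      = christoffel pd ω m i r * christoffel pd ω r j k by
        rw [christoffel_comm hω m r, christoffel_comm hω r k, mul_comm],
    Finset.sum_congr rfl fun r _ => show christoffel pd ω r k i * christoffel pd ω m r j
      = christoffel pd ω m j r * christoffel pd ω r i k by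
        rw [christoffel_comm hω m r, christoffel_comm hω r k, mul_comm]] at h
  rw [tractorCurv_apply]
  simp only [tractorConn, tractorMatrix, Fintype.sum_option]
  linear_combination h

theorem tractorCurv_YZ [CharZero K] (hω : ω.IsSymm) (hdet : ω.det ≠ 0) (i j k : Fin 4) :
    tractorCurv pd ω i j (some none) (some (some k)) = 0 := by
  have h1 := metric_compat (pd := pd) hω hdet i j k
  have h2 := metric_compat (pd := pd) hω hdet j i k
  simp only [christoffel_comm hω _ j i] at h2
  rw [tractorCurv_apply]
  simp only [tractorConn, tractorMatrix, Fintype.sum_option, map_neg, neg_mul,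
    Finset.sum_neg_distrib]
  linear_combination h2 - h1

theorem tractorCurv_YY [CharZero K] (hω : ω.IsSymm) (hdet : ω.det ≠ 0)
    (hW : ∀ k l i j, weylTensor pd ω k l i j = 0) (i j : Fin 4) :
    tractorCurv pd ω i j (some none) (some none) = 0 := by
  rw [tractorCurv_apply]
  simp only [tractorConn, tractorMatrix, Fintype.sum_option, neg_mul, Finset.sum_neg_distrib,
    sum_mul_raised hdet, schouten_symm hω hdet hW i j, map_zero]
  ring

theorem tractorCurv_XY [CharZero K] (hω : ω.IsSymm) (hdet : ω.det ≠ 0)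
    (hW : ∀ k l i j, weylTensor pd ω k l i j = 0) (i j : Fin 4) :
    tractorCurv pd ω i j none (some none) = 0 := by
  have h : ∑ m, schouten pd ω i m * (ω⁻¹ * schouten pd ω) m j
      = ∑ m, schouten pd ω j m * (ω⁻¹ * schouten pd ω) m i := by
    simp only [Matrix.mul_apply, Finset.mul_sum]
    rw [Finset.sum_comm]
    refine Finset.sum_congr rfl fun m _ => Finset.sum_congr rfl fun r _ => ?_
    rw [inv_symm hω r m, schouten_symm hω hdet hW i r, schouten_symm hω hdet hW m j]
    ring
  rw [tractorCurv_apply]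
  simp only [tractorConn, tractorMatrix, Fintype.sum_option, neg_mul, Finset.sum_neg_distrib, h,
    map_zero]
  ring

theorem tractorCurv_XZ [CharZero K] (i j k : Fin 4) :
    tractorCurv pd ω i j none (some (some k)) = -cotton pd ω i j k := by
  rw [tractorCurv_apply, cotton, Finset.sum_sub_distrib]
  simp only [tractorConn, tractorMatrix, Fintype.sum_option, neg_mul, Finset.sum_neg_distrib,
    mul_comm (christoffel pd ω _ _ _), map_neg]
  ring

/-- In dimension four the Cotton tensor is controlled by the divergence of the Weyl tensor. Here
this is read off the `Z, Z` entries of the Bianchi identity of the tractor curvature, in which only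
Cotton terms are left. -/
theorem cotton_eq_zero [CharZero K] (hcomm : ∀ i j a, pd i (pd j a) = pd j (pd i a))
    (hω : ω.IsSymm) (hdet : ω.det ≠ 0)
    (hW : ∀ k l i j, weylTensor pd ω k l i j = 0) (i j l : Fin 4) : cotton pd ω i j l = 0 := by
  have hB := connection_bianchi (fun i => mapDeriv (ι := TractorIndex 4) (pd i))
    (fun i => mapDeriv_mul (pd i)) (fun i j A => by ext a b; exact hcomm i j _)
    (tractorConn pd ω) (tractorCurv pd ω) (fun _ _ => rfl)
  set D : Fin 4 → Fin 4 → Fin 4 → K := fun i j m =>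
    tractorCurv pd ω i j (some (some m)) (some none) with hD
  have hCD (i j k) : ∑ m, ω k m * D i j m = cotton pd ω i j k :=
    sum_mul_tractorCurv hω hdet hW i j k
  have hDanti (i j m) : D i j m = -D j i m := by
    simp only [hD, tractorCurv, Matrix.sub_apply, Matrix.add_apply]
    ring
  have hCanti (i j k) : cotton pd ω i j k = -cotton pd ω j i k := by
    rw [← hCD, ← hCD, ← Finset.sum_neg_distrib]
    refine Finset.sum_congr rfl fun m _ => ?_
    rw [hDanti]
    ring
  have hterm (k i j m l) : (mapDeriv (pd k) (tractorCurv pd ω i j)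
      + tractorConn pd ω k * tractorCurv pd ω i j - tractorCurv pd ω i j * tractorConn pd ω k)
        (some (some m)) (some (some l))
      = -(if m = k then 1 else 0) * cotton pd ω i j l + ω k l * D i j m := by
    rw [Matrix.sub_apply, Matrix.add_apply, mapDeriv_apply, Matrix.mul_apply, Matrix.mul_apply,
      tractorCurv_ZZ hdet hW hω, map_zero, Fintype.sum_option, Fintype.sum_option,
      Fintype.sum_option, Fintype.sum_option, tractorCurv_XZ, tractorCurv_YZ hω hdet,
      tractorCurv_X hω hdet hW]
    simp only [tractorCurv_ZZ hdet hW hω, tractorConn, tractorMatrix, mul_zero, zero_mul,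
      Finset.sum_const_zero]
    ring
  have key (i j l m k) : -(if m = k then 1 else 0) * cotton pd ω i j l + ω k l * D i j m
      + (-(if m = i then 1 else 0) * cotton pd ω j k l + ω i l * D j k m)
      + (-(if m = j then 1 else 0) * cotton pd ω k i l + ω j l * D k i m) = 0 := by
    rw [← hterm, ← hterm, ← hterm]
    exact congrFun (congrFun (hB i j k) (some (some m))) (some (some l))
  -- Tracing `key` over `m = k` gives the coefficient `-4 + 3 = -1` in front of the Cotton tensor,
  -- so it is determined by the traces of `D`.
  have hc (i j l) : cotton pd ω i j l
      = ω i l * (∑ k, D j k k) - ω j l * ∑ k, D i k k := by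
    have h := Finset.sum_eq_zero fun k (_ : k ∈ Finset.univ) => key i j l k k
    simp only [Finset.sum_add_distrib, if_true, ← Finset.mul_sum, neg_mul, ite_mul, one_mul,
      zero_mul, Finset.sum_neg_distrib, Finset.sum_ite_eq', Finset.mem_univ, Finset.sum_const,
      Finset.card_univ, Fintype.card_fin, nsmul_eq_mul] at h
    have h1 : ∑ k, ω k l * D i j k = cotton pd ω i j l := by
      rw [← hCD]
      exact Finset.sum_congr rfl fun k _ => by rw [hω.apply]
    have h2 : ∑ k, D k i k = -∑ k, D i k k := by
      rw [← Finset.sum_neg_distrib]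
      exact Finset.sum_congr rfl fun k _ => hDanti k i k
    rw [h1, h2, hCanti j i l] at h
    push_cast at h
    linear_combination -h
  have hD' (i j m) : D i j m
      = (if m = i then 1 else 0) * (∑ k, D j k k) - (if m = j then 1 else 0) * ∑ k, D i k k := by
    rw [← sum_inv_mul_sum hdet (D i j) m]
    simp only [hCD, hc, mul_sub, Finset.sum_sub_distrib, ← mul_assoc, ← Finset.sum_mul]
    simp only [hω.apply _ i, hω.apply _ j, sum_inv_mul hdet]
  -- Tracing `hD'` over `m = j` gives `c = c - 4 c` for each trace `c`.
  have hc0 (i) : ∑ k, D i k k = 0 := by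
    have h : ∑ j, D i j j = ∑ j, ((if j = i then 1 else 0) * (∑ k, D j k k) - ∑ k, D i k k) :=
      Finset.sum_congr rfl fun j _ => by rw [hD' i j j, if_pos rfl, one_mul]
    simp only [Finset.sum_sub_distrib, ite_mul, one_mul, zero_mul, Finset.sum_ite_eq',
      Finset.mem_univ, if_true, Finset.sum_const, Finset.card_univ, Fintype.card_fin,
      nsmul_eq_mul] at h
    push_cast at h
    have : (4 : K) * ∑ k, D i k k = 0 := by linear_combination h
    exact (mul_eq_zero.1 this).resolve_left (by norm_num)
  rw [hc, hc0, hc0, mul_zero, mul_zero, sub_zero]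

theorem tractorCurv_eq_zero [CharZero K] (hcomm : ∀ i j a, pd i (pd j a) = pd j (pd i a))
    (hω : ω.IsSymm) (hdet : ω.det ≠ 0)
    (hW : ∀ k l i j, weylTensor pd ω k l i j = 0) (i j : Fin 4) : tractorCurv pd ω i j = 0 := by
  ext a b
  rw [Matrix.zero_apply]
  rcases b with - | - | k
  · exact tractorCurv_X hω hdet hW i j a
  · rcases a with - | - | m
    · exact tractorCurv_XY hω hdet hW i j
    · exact tractorCurv_YY hω hdet hW i j
    · rw [← sum_inv_mul_sum hdet (fun m => tractorCurv pd ω i j (some (some m)) (some none)) m]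
      refine Finset.sum_eq_zero fun r _ => ?_
      rw [sum_mul_tractorCurv hω hdet hW, cotton_eq_zero hcomm hω hdet hW, mul_zero]
  · rcases a with - | - | m
    · rw [tractorCurv_XZ, cotton_eq_zero hcomm hω hdet hW, neg_zero]
    · exact tractorCurv_YZ hω hdet i j k
    · exact tractorCurv_ZZ hdet hW hω i j m k

/-- The covariant derivative of tractors with two indices. -/
def tractorNabla (pd : Fin 4 → Derivation ℤ K K) (ω : Matrix (Fin 4) (Fin 4) K) (i : Fin 4) :
    AddMonoid.End (Matrix (TractorIndex 4) (TractorIndex 4) K) where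
  toFun B := mapDeriv (pd i) B + tractorConn pd ω i * B + B * (tractorConn pd ω i)ᵀ
  map_zero' := by simp
  map_add' A B := by
    simp only [map_add, mul_add, add_mul]
    abel

theorem tractorNabla_smul (i : Fin 4) (a : K) (B : Matrix (TractorIndex 4) (TractorIndex 4) K) :
    tractorNabla pd ω i (a • B) = pd i a • B + a • tractorNabla pd ω i B := by
  have h : mapDeriv (pd i) (a • B) = pd i a • B + a • mapDeriv (pd i) B := by
    ext x y
    simp only [mapDeriv_apply, Matrix.smul_apply, Matrix.add_apply, Derivation.leibniz, smul_eq_mul]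
    ring
  change mapDeriv (pd i) (a • B) + tractorConn pd ω i * (a • B)
    + (a • B) * (tractorConn pd ω i)ᵀ = _ + a • (mapDeriv (pd i) B + tractorConn pd ω i * B
      + B * (tractorConn pd ω i)ᵀ)
  rw [h, Matrix.mul_smul, Matrix.smul_mul, smul_add, smul_add]
  abel

/-- The commutator acts by `B ↦ F B + B Fᵀ` with the tractor curvature `F`, which is zero. -/
theorem tractorNabla_comm [CharZero K] (hcomm : ∀ i j a, pd i (pd j a) = pd j (pd i a))
    (hω : ω.IsSymm) (hdet : ω.det ≠ 0)
    (hW : ∀ k l i j, weylTensor pd ω k l i j = 0) (i j : Fin 4) :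
    tractorNabla pd ω i * tractorNabla pd ω j = tractorNabla pd ω j * tractorNabla pd ω i := by
  refine AddMonoidHom.ext fun B => ?_
  have hF : mapDeriv (pd i) (tractorConn pd ω j) - mapDeriv (pd j) (tractorConn pd ω i)
      + tractorConn pd ω i * tractorConn pd ω j - tractorConn pd ω j * tractorConn pd ω i = 0 :=
    tractorCurv_eq_zero hcomm hω hdet hW i j
  have hFT := congrArg Matrix.transpose hF
  have hT (k) (A : Matrix (TractorIndex 4) (TractorIndex 4) K) :
      mapDeriv (pd k) Aᵀ = (mapDeriv (pd k) A)ᵀ := rfl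
  have hBB : mapDeriv (pd i) (mapDeriv (pd j) B) = mapDeriv (pd j) (mapDeriv (pd i) B) := by
    ext a b
    exact hcomm i j _
  simp only [Matrix.transpose_add, Matrix.transpose_sub, Matrix.transpose_mul,
    Matrix.transpose_zero, ← hT] at hFT
  change mapDeriv (pd i) (mapDeriv (pd j) B + tractorConn pd ω j * B + B * (tractorConn pd ω j)ᵀ)
      + tractorConn pd ω i * (mapDeriv (pd j) B + tractorConn pd ω j * B
        + B * (tractorConn pd ω j)ᵀ)
      + (mapDeriv (pd j) B + tractorConn pd ω j * B + B * (tractorConn pd ω j)ᵀ)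
        * (tractorConn pd ω i)ᵀ
    = mapDeriv (pd j) (mapDeriv (pd i) B + tractorConn pd ω i * B + B * (tractorConn pd ω i)ᵀ)
      + tractorConn pd ω j * (mapDeriv (pd i) B + tractorConn pd ω i * B
        + B * (tractorConn pd ω i)ᵀ)
      + (mapDeriv (pd i) B + tractorConn pd ω i * B + B * (tractorConn pd ω i)ᵀ)
        * (tractorConn pd ω j)ᵀ
  rw [← sub_eq_zero]
  simp only [map_add, mapDeriv_mul, hBB]
  have e := congrArg₂ (· + ·) (congrArg (· * B) hF) (congrArg (B * ·) hFT)
  simp only [zero_mul, mul_zero, add_zero] at e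
  rw [← e]
  noncomm_ring

end FourDimensions

end Curvature

/-! ### Conformal Killing vectors as parallel sections -/

section Evaluation

open MvPolynomial

variable {K : Type*} [Field K]

/-- Modules over the ring of differential operators from commuting derivatives. -/
theorem exists_action {n : ℕ} {pd : Fin n → Derivation ℤ K K} {N : Type*} [AddCommGroup N]
    [Module K N] (D : Fin n → AddMonoid.End N)
    (hD : ∀ i j, D i * D j = D j * D i) (hDs : ∀ i (a : K) B, D i (a • B) = pd i a • B + a • D i B) :
    ∃ act : DiffOp pd →+ N →+ N, (∀ B, act 1 B = B) ∧
      (∀ a Q B, act (ofK pd a * Q) B = a • act Q B) ∧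
      ∀ i Q B, act (dOp pd i * Q) B = D i (act Q B) := by
  obtain ⟨m, hm0, hm⟩ := exists_monomials D hD
  -- An operator acts through its normal form, with the monomials replaced by products of the
  -- commuting `D i`.
  let f (B : N) : MvPolynomial (Fin n) K →ₗ[K] N :=
    (basisMonomials (Fin n) K).constr K fun μ => m μ B
  have hf (B : N) (μ) (a : K) : f B (monomial μ a) = a • m μ B := by
    have h1 : monomial μ a = a • basisMonomials (Fin n) K μ := by
      rw [coe_basisMonomials, smul_monomial, smul_eq_mul, mul_one]
    rw [h1, map_smul]
    simp only [f, Module.Basis.constr_basis]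
  refine ⟨⟨⟨fun P => ⟨⟨fun B => f B (normalForm P), ?_⟩, fun B C => ?_⟩, ?_⟩, fun P Q => ?_⟩,
    fun B => ?_, fun a Q B => ?_, fun i Q B => ?_⟩
  · have : f 0 = 0 := (basisMonomials (Fin n) K).ext fun μ => by
      simp only [f, Module.Basis.constr_basis, map_zero, LinearMap.zero_apply]
    rw [this, LinearMap.zero_apply]
  · have : f (B + C) = f B + f C := (basisMonomials (Fin n) K).ext fun μ => by
      simp only [f, LinearMap.add_apply, Module.Basis.constr_basis, map_add]
    change f (B + C) _ = _
    rw [this, LinearMap.add_apply]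
  · ext B
    exact map_zero (f B)
  · ext B
    exact (congrArg (f B) (map_add normalForm P Q)).trans (map_add (f B) _ _)
  · change f B (normalForm 1) = B
    have : normalForm (1 : DiffOp pd) = monomial 0 1 := rfl
    rw [this, hf, hm0, one_smul]
    rfl
  · change f B (normalForm (ofK pd a * Q)) = a • f B (normalForm Q)
    rw [normalForm_ofK_mul, ← smul_eq_C_mul, map_smul]
  · change f B (normalForm (dOp pd i * Q)) = D i (f B (normalForm Q))
    rw [normalForm_dOp_mul]
    generalize normalForm Q = p
    induction p using MvPolynomial.induction_on' with
    | monomial μ a =>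
      have h1 : (AddMonoidAlgebra.map (pd i : K →+ K) (monomial μ a) : MvPolynomial (Fin n) K)
          = monomial μ (pd i a) := by
        ext ν
        rw [coeff_map_derivation, coeff_monomial, coeff_monomial]
        split_ifs <;> simp
      rw [h1, X, monomial_mul, one_mul, map_add, hf, hf, hf, hDs, hm]
      exact add_comm _ _
    | add p q hp hq =>
      rw [AddMonoidAlgebra.map_add, mul_add, add_add_add_comm, map_add (f B) (X i * p + _), hp, hq,
        map_add, map_add]

/-- The coefficients stay on the left and one derivation is split off on the right, so that the
second-order part of a row can be evaluated step by step on a section. -/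
theorem exists_order_decomposition {n : ℕ} {pd : Fin n → Derivation ℤ K K}
    (hcomm : ∀ i j a, pd i (pd j a) = pd j (pd i a)) {k : ℕ} {P : DiffOp pd}
    (hP : normalForm P ∈ degLT K n (k + 1)) :
    ∃ (Q : Fin n → DiffOp pd) (a : K), (∀ i, normalForm (Q i) ∈ degLT K n k) ∧
      P = ∑ i, Q i * dOp pd i + ofK pd a := by
  obtain ⟨m, hm0, hm, hnf, hsum⟩ := exists_monomial_operators hcomm
  have hmd (μ) : ∀ i, m μ * dOp pd i = dOp pd i * m μ := by
    induction μ using multiIndex_induction with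
    | h0 => intro i; rw [hm0, one_mul, mul_one]
    | h1 j μ ih =>
      intro i
      rw [hm, mul_assoc, ih, ← mul_assoc, ← mul_assoc, dOp_mul_comm hcomm]
  have h1 (μ : Fin n →₀ ℕ) (a : K) (hμ : μ.degree < k + 1) :
      ∃ (Q : Fin n → DiffOp pd) (b : K), (∀ i, normalForm (Q i) ∈ degLT K n k) ∧
        ofK pd a * m μ = ∑ i, Q i * dOp pd i + ofK pd b := by
    by_cases h0 : μ = 0
    · refine ⟨0, a, fun i => by simp, ?_⟩
      rw [h0, hm0, mul_one]
      simp
    · obtain ⟨i, hi⟩ := Finsupp.ne_iff.1 h0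
      have e : Finsupp.single i 1 + (μ - Finsupp.single i 1) = μ := add_tsub_cancel_of_le (by
        rw [Finsupp.single_le_iff]
        exact Nat.one_le_iff_ne_zero.2 hi)
      have hdeg := congrArg Finsupp.degree e
      rw [map_add, Finsupp.degree_single] at hdeg
      refine ⟨Pi.single i (ofK pd a * m (μ - Finsupp.single i 1)), 0, fun j => ?_, ?_⟩
      · by_cases hj : j = i
        · subst hj
          rw [Pi.single_eq_same, normalForm_ofK_mul, hnf, C_mul_monomial]
          exact degLT_mono (by omega) (isHomogeneous_mem_degLT (isHomogeneous_monomial _ rfl))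
        · rw [Pi.single_eq_of_ne hj, map_zero]
          exact Submodule.zero_mem _
      · rw [Finset.sum_eq_single_of_mem i (Finset.mem_univ i) fun j _ hj => by
          rw [Pi.single_eq_of_ne hj, zero_mul], Pi.single_eq_same, map_zero, add_zero, mul_assoc,
          hmd, ← hm, e]
  have h2 (μ) : ∃ (Q : Fin n → DiffOp pd) (b : K), (∀ i, normalForm (Q i) ∈ degLT K n k) ∧
      ofK pd (coeff μ (normalForm P)) * m μ = ∑ i, Q i * dOp pd i + ofK pd b := by
    by_cases hμ : μ.degree < k + 1
    · exact h1 μ _ hμ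
    · exact ⟨0, 0, fun i => by simp, by rw [hP μ (by omega)]; simp⟩
  choose Q b hQ hb using h2
  refine ⟨fun i => ∑ μ ∈ (normalForm P).support, Q μ i, ∑ μ ∈ (normalForm P).support, b μ,
    fun i => ?_, ?_⟩
  · rw [map_sum]
    exact Submodule.sum_mem _ fun μ _ => hQ μ i
  · conv_lhs => rw [hsum P, Finset.sum_congr rfl fun μ _ => hb μ, Finset.sum_add_distrib,
      Finset.sum_comm]
    simp only [Finset.sum_mul, map_sum]

variable {pd : Fin 4 → Derivation ℤ K K} {ω : Matrix (Fin 4) (Fin 4) K}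

/-- The entries of the bivector `X ∧ v^b Z_b`. -/
def wedgeXEntry (v : Fin 4 → K) (a b : TractorIndex 4) : K :=
  match a, b with
  | none, some (some b) => v b
  | some (some a), none => -v a
  | _, _ => 0

/-- The bivector `X ∧ v^b Z_b`. -/
def wedgeX : (Fin 4 → K) →ₗ[K] Matrix (TractorIndex 4) (TractorIndex 4) K where
  toFun v := Matrix.of (wedgeXEntry v)
  map_add' v w := by
    ext a b
    change wedgeXEntry (v + w) a b = wedgeXEntry v a b + wedgeXEntry w a b
    rcases a with - | - | a <;> rcases b with - | - | b <;>
      simp [wedgeXEntry, add_comm]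
  map_smul' c v := by
    ext a b
    change wedgeXEntry (c • v) a b = c * wedgeXEntry v a b
    rcases a with - | - | a <;> rcases b with - | - | b <;>
      simp [wedgeXEntry]

theorem wedgeX_apply (v : Fin 4 → K) (a b : TractorIndex 4) : wedgeX v a b = wedgeXEntry v a b :=
  rfl

variable (K) in
/-- The bivector `X ∧ Y`. -/
def wedgeXY : Matrix (TractorIndex 4) (TractorIndex 4) K := fun a b =>
  match a, b with
  | none, some none => 1
  | some none, none => -1
  | _, _ => 0

theorem tractorNabla_apply (i : Fin 4) (B : Matrix (TractorIndex 4) (TractorIndex 4) K)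
    (a b : TractorIndex 4) : tractorNabla pd ω i B a b
      = pd i (B a b) + ∑ c, tractorConn pd ω i a c * B c b + ∑ c, B a c * tractorConn pd ω i b c :=
  rfl

theorem tractorNabla_wedgeX (i : Fin 4) (v : Fin 4 → K) (a b : TractorIndex 4) :
    tractorNabla pd ω i (wedgeX v) a b = match a, b with
      | none, some none => -∑ c, v c * ω i c
      | some none, none => ∑ c, v c * ω i c
      | none, some (some b) => pd i (v b) + ∑ c, christoffel pd ω b i c * v c
      | some (some a), none => -(pd i (v a) + ∑ c, christoffel pd ω a i c * v c)
      | some (some a), some (some b) => (if a = i then v b else 0) - (if b = i then v a else 0)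
      | _, _ => 0 := by
  have hv (f : Fin 4 → K) : ∑ c, v c * f c = ∑ c, f c * v c :=
    Finset.sum_congr rfl fun c _ => mul_comm _ _
  rw [tractorNabla_apply]
  rcases a with - | - | a <;> rcases b with - | - | b <;>
    simp [wedgeX_apply, wedgeXEntry, tractorConn, tractorMatrix, Fintype.sum_option, hv]
  · ring
  · split_ifs <;> ring

/-- This entry sees only second-order coefficients: the corresponding entries of the first
derivative and of the section itself vanish. It is the pairing of second-order symbols with `ĝ_2`.
-/
theorem tractorNabla_tractorNabla_ZY (hω : ω.IsSymm) (hdet : ω.det ≠ 0) (i j r a : Fin 4) :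
    tractorNabla pd ω j (tractorNabla pd ω i (wedgeX (ω⁻¹ r))) (some (some a)) (some none)
      = ω⁻¹ r a * ω i j - (if a = j then 1 else 0) * (if r = i then 1 else 0)
        - (if a = i then 1 else 0) * (if r = j then 1 else 0) := by
  have h (i) : ∑ c, ω⁻¹ r c * ω i c = if r = i then 1 else 0 := by
    rw [← sum_inv_mul hdet]
    exact Finset.sum_congr rfl fun c _ => by rw [hω.apply]
  rw [tractorNabla_apply]
  simp only [tractorNabla_wedgeX, Fintype.sum_option, h, tractorConn, tractorMatrix, sub_mul,
    Finset.sum_sub_distrib, ite_mul, zero_mul, mul_neg, Finset.sum_neg_distrib, map_zero,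
    mul_zero, Finset.sum_const_zero, Finset.sum_ite_eq', Finset.mem_univ, if_true]
  rw [hω.apply i j]
  by_cases ha : a = i
  · simp only [ha, if_true, h]
    ring
  · simp only [ha, if_false, Finset.sum_const_zero]
    ring

/-- The evaluation of rows of differential operators on the sections `ω^{rs} X ∧ Z_s`. -/
structure IsEvaluation (pd : Fin 4 → Derivation ℤ K K) (ω : Matrix (Fin 4) (Fin 4) K)
    (ev : (Fin 4 → DiffOp pd) →+ Matrix (TractorIndex 4) (TractorIndex 4) K) : Prop where
  ofK_mul : ∀ a p, ev (fun r => ofK pd a * p r) = a • ev p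
  dOp_mul : ∀ i p, ev (fun r => dOp pd i * p r) = tractorNabla pd ω i (ev p)
  order_two : ∀ (q : Fin 4 → Fin 4 → Fin 4 → K) (c : Fin 4 → Fin 4 → K) (a : Fin 4 → K),
    ev (fun r => ∑ i, (∑ j, ofK pd (q r i j) * dOp pd j + ofK pd (c r i)) * dOp pd i
        + ofK pd (a r))
      = ∑ r, (∑ i, (∑ j, q r i j • tractorNabla pd ω j (tractorNabla pd ω i (wedgeX (ω⁻¹ r)))
          + c r i • tractorNabla pd ω i (wedgeX (ω⁻¹ r))) + a r • wedgeX (ω⁻¹ r))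

theorem exists_evaluation [CharZero K] (hcomm : ∀ i j a, pd i (pd j a) = pd j (pd i a))
    (hω : ω.IsSymm) (hdet : ω.det ≠ 0) (hW : ∀ k l i j, weylTensor pd ω k l i j = 0) :
    ∃ ev, IsEvaluation pd ω ev := by
  obtain ⟨act, h1, hK, hd⟩ := exists_action (pd := pd) (tractorNabla pd ω)
    (tractorNabla_comm hcomm hω hdet hW) tractorNabla_smul
  refine ⟨∑ r, ((AddMonoidHom.eval (wedgeX (ω⁻¹ r))).comp act).comp (Pi.evalAddMonoidHom _ r),
    fun a p => ?_, fun i p => ?_, fun q c a => ?_⟩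
  · simp only [AddMonoidHom.finsetSum_apply, Finset.smul_sum]
    exact Finset.sum_congr rfl fun r _ => hK _ _ _
  · simp only [AddMonoidHom.finsetSum_apply, map_sum]
    exact Finset.sum_congr rfl fun r _ => hd _ _ _
  · simp only [AddMonoidHom.finsetSum_apply]
    refine Finset.sum_congr rfl fun r _ => ?_
    have hK1 (a : K) (B) : act (ofK pd a) B = a • B := by
      rw [← mul_one (ofK pd a), hK, h1]
    have hd1 (i) (B) : act (dOp pd i) B = tractorNabla pd ω i B := by
      rw [← mul_one (dOp pd i), hd, h1]
    change act (∑ i, (∑ j, ofK pd (q r i j) * dOp pd j + ofK pd (c r i)) * dOp pd i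
            + ofK pd (a r)) (wedgeX (ω⁻¹ r)) = _
    simp only [map_add, map_sum, add_mul, Finset.sum_mul, mul_assoc, AddMonoidHom.add_apply,
      AddMonoidHom.finsetSum_apply, hK, hd, hK1, hd1]

section Reduction

variable {ev : (Fin 4 → DiffOp pd) →+ Matrix (TractorIndex 4) (TractorIndex 4) K}

/-- The kernel of the evaluation is a left `D`-submodule; only closure under generators, sums and
products has to be seen. -/
theorem IsEvaluation.mul_eq_zero (hev : IsEvaluation pd ω ev) (A : DiffOp pd)
    {p : Fin 4 → DiffOp pd} (hp : ev p = 0) : ev (fun r => A * p r) = 0 := by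
  induction A using diffOp_induction generalizing p with
  | hK a => rw [hev.ofK_mul, hp, smul_zero]
  | hd i => rw [hev.dOp_mul, hp, map_zero]
  | h0 => simp only [zero_mul]; exact map_zero ev
  | h1 => simpa only [one_mul] using hp
  | hadd A B hA hB =>
    simp only [add_mul]
    exact (map_add ev _ _).trans (by rw [hA hp, hB hp, add_zero])
  | hneg A hA =>
    simp only [neg_mul]
    exact (map_neg ev _).trans (by rw [hA hp, neg_zero])
  | hmul A B hA hB => simpa only [mul_assoc] using hA (hB hp)

theorem IsEvaluation.vecMul_eq_zero (hev : IsEvaluation pd ω ev) {l : ℕ}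
    {P : Matrix (Fin l) (Fin 4) (DiffOp pd)} (hP : ∀ i, ev (P i) = 0) (c : Fin l → DiffOp pd) :
    ev (c ᵥ* P) = 0 := by
  have : c ᵥ* P = ∑ i, fun r => c i * P i r := by
    funext r
    rw [Finset.sum_apply]
    rfl
  rw [this, map_sum]
  exact Finset.sum_eq_zero fun i _ => hev.mul_eq_zero (c i) (hP i)

end Reduction

theorem sum_smul_tractorNabla_wedgeX (hdet : ω.det ≠ 0) (i j : Fin 4) :
    ∑ r, ω j r • tractorNabla pd ω i (wedgeX (ω⁻¹ r))
      = tractorNabla pd ω i (wedgeX (Pi.single j 1))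
        - wedgeX (∑ r, pd i (ω j r) • ω⁻¹ r) := by
  have h1 : (Pi.single j 1 : Fin 4 → K) = ∑ r, ω j r • ω⁻¹ r := by
    funext b
    rw [Finset.sum_apply]
    refine Eq.trans ?_ (sum_mul_inv hdet j b).symm
    rw [Pi.single_apply]
    simp only [eq_comm]
  rw [h1, map_sum, map_sum, map_sum, ← Finset.sum_sub_distrib]
  refine Finset.sum_congr rfl fun r _ => ?_
  rw [map_smul wedgeX, tractorNabla_smul, map_smul wedgeX, add_sub_cancel_left]

/-- In the symmetrised derivative the bivectors `Z_i ∧ Z_j` cancel and the Christoffel symbols are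
compensated by the zero-order part of the Lie derivative. Only `X ∧ Y` survives, proportional to
`ω_ij`, which is why precisely the trace-free combinations are killed. -/
theorem tractorNabla_single_add [CharZero K] (hω : ω.IsSymm) (i j : Fin 4) :
    tractorNabla pd ω i (wedgeX (Pi.single j 1)) + tractorNabla pd ω j (wedgeX (Pi.single i 1))
      + wedgeX (∑ r, (pd r (ω i j) - pd i (ω j r) - pd j (ω i r)) • ω⁻¹ r)
      = (-2 * ω i j) • wedgeXY K := by
  have h (b) : (∑ r, (pd r (ω i j) - pd i (ω j r) - pd j (ω i r)) • ω⁻¹ r) b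
      = -(2 * christoffel pd ω b i j) := by
    rw [Finset.sum_apply, christoffel, Finset.mul_sum, Finset.mul_sum, ← Finset.sum_neg_distrib]
    refine Finset.sum_congr rfl fun r _ => ?_
    rw [Pi.smul_apply, smul_eq_mul, inv_symm hω r b, hω.apply r j, hω.apply r i]
    ring
  have hp (D : Derivation ℤ K K) (p : Prop) [Decidable p] : D (if p then 1 else 0) = 0 := by
    split_ifs <;> simp
  ext a b
  rw [Matrix.add_apply, Matrix.add_apply, tractorNabla_wedgeX, tractorNabla_wedgeX, wedgeX_apply,
    Matrix.smul_apply]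
  rcases a with - | - | a <;> rcases b with - | - | b <;>
    simp only [wedgeXEntry, wedgeXY, h, hp, Pi.single_apply, mul_ite, ite_mul, one_mul, mul_one,
      zero_mul, mul_zero, Finset.sum_ite_eq', Finset.mem_univ, if_true, smul_eq_mul, hω.apply i j,
      christoffel_comm hω _ j i] <;> try ring1
  split_ifs <;> ring

theorem IsEvaluation.lieRow [CharZero K] (hω : ω.IsSymm) (hdet : ω.det ≠ 0)
    {ev : (Fin 4 → DiffOp pd) →+ Matrix (TractorIndex 4) (TractorIndex 4) K}
    (hev : IsEvaluation pd ω ev)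
    (i j : Fin 4) : ev (FormalTheory.lieRow pd ω i j) = (-2 * ω i j) • wedgeXY K := by
  have h := hev.order_two 0 (fun r k => (if k = i then ω j r else 0) + if k = j then ω i r else 0)
    (fun r => pd r (ω i j))
  have e : FormalTheory.lieRow pd ω i j = fun r => ∑ k, (∑ l, ofK pd ((0 : Fin 4 → Fin 4 → Fin 4 → K) r k l)
      * dOp pd l + ofK pd ((if k = i then ω j r else 0) + if k = j then ω i r else 0)) * dOp pd k
      + ofK pd (pd r (ω i j)) := by
    funext r
    simp only [FormalTheory.lieRow, hω.apply j r, Pi.zero_apply, map_zero, zero_mul, Finset.sum_const_zero,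
      zero_add, map_add, add_mul, Finset.sum_add_distrib, apply_ite (ofK pd), ite_mul,
      Finset.sum_ite_eq', Finset.mem_univ, if_true]
  rw [e, h, ← tractorNabla_single_add hω]
  simp only [Pi.zero_apply, zero_smul, Finset.sum_const_zero, zero_add, add_smul,
    Finset.sum_add_distrib, ite_smul, Finset.sum_ite_eq', Finset.mem_univ, if_true,
    sum_smul_tractorNabla_wedgeX hdet, sub_smul, Finset.sum_sub_distrib, map_sub, map_sum,
    map_smul]
  abel

variable (pd ω) in
/-- The combination of the equations `L(ξ)ω` with the coefficients `T/2`. -/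
def killingRow : Matrix (Fin 4) (Fin 4) K →ₗ[K] (Fin 4 → DiffOp pd) where
  toFun T := ∑ i, ∑ j, (1 / 2 * T i j) • lieRow pd ω i j
  map_add' T U := by
    simp only [Matrix.add_apply, mul_add, add_smul, Finset.sum_add_distrib]
  map_smul' c T := by
    simp only [Matrix.smul_apply, smul_eq_mul, Finset.smul_sum, smul_smul, RingHom.id_apply,
      mul_left_comm]

variable (ω) in
/-- The symmetric bivectors without trace. -/
def symTraceless : Submodule K (Matrix (Fin 4) (Fin 4) K) where
  carrier := {T | T.IsSymm ∧ (T * ω).trace = 0}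
  add_mem' := fun ⟨h1, h2⟩ ⟨h3, h4⟩ =>
    ⟨h1.add h3, by rw [add_mul, Matrix.trace_add, h2, h4, add_zero]⟩
  zero_mem' := ⟨Matrix.isSymm_zero, by rw [zero_mul, Matrix.trace_zero]⟩
  smul_mem' := fun c _ ⟨h1, h2⟩ =>
    ⟨h1.smul c, by rw [Matrix.smul_mul, Matrix.trace_smul, h2, smul_zero]⟩

theorem HasSymbol.smul {n : ℕ} {pd : Fin n → Derivation ℤ K K} {P : DiffOp pd} {k : ℕ}
    {A : MvPolynomial (Fin n) K} (hP : HasSymbol P k A) (a : K) :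
    HasSymbol (a • P) k (C a * A) := by
  refine ⟨by simpa using (isHomogeneous_C _ a).mul hP.1, ?_⟩
  rw [smul_def, normalForm_ofK_mul, ← mul_sub, C_mul']
  exact Submodule.smul_mem _ _ hP.2

theorem hasSymbol_dOp {n : ℕ} {pd : Fin n → Derivation ℤ K K} (i : Fin n) :
    HasSymbol (dOp pd i) 1 (X i) := by
  refine ⟨isHomogeneous_X K i, ?_⟩
  have h := normalForm_dOp_mul (pd := pd) i 1
  have h1 : (AddMonoidAlgebra.map (pd i : K →+ K) (1 : MvPolynomial (Fin n) K)
      : MvPolynomial (Fin n) K) = 0 := by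
    ext μ
    rw [coeff_map_derivation, coeff_one, coeff_zero]
    split_ifs <;> simp
  rw [mul_one, normalForm_one, mul_one, h1, add_zero] at h
  rw [h, sub_self]
  exact Submodule.zero_mem _

theorem hasSymbol_ofK {n : ℕ} {pd : Fin n → Derivation ℤ K K} (a : K) :
    HasSymbol (ofK pd a) 0 (C a) := by
  refine ⟨isHomogeneous_C _ a, ?_⟩
  rw [normalForm_ofK, sub_self]
  exact Submodule.zero_mem _

theorem hasSymbol_of_mem_degLT {n : ℕ} {pd : Fin n → Derivation ℤ K K} {P : DiffOp pd} {k : ℕ}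
    (h : normalForm P ∈ degLT K n k) : HasSymbol P k 0 :=
  ⟨isHomogeneous_zero _ _ _, by rwa [sub_zero]⟩

theorem hasSymbol_lieRow (i j r : Fin 4) :
    HasSymbol (lieRow pd ω i j r) 1 (C (ω r j) * X i + C (ω i r) * X j) := by
  have h := (((hasSymbol_dOp (pd := pd) i).smul (ω r j)).add
    ((hasSymbol_dOp (pd := pd) j).smul (ω i r))).add
    (hasSymbol_of_mem_degLT (hasSymbol_ofK (pd := pd) (pd r (ω i j))).mem)
  rwa [add_zero] at h

theorem lieRow_symm (hω : ω.IsSymm) (i j : Fin 4) : lieRow pd ω i j = lieRow pd ω j i := by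
  funext r
  simp only [lieRow, hω.apply i j, hω.apply r j, hω.apply r i]
  rw [add_comm (ofK pd (ω r j) * dOp pd i)]

theorem hasSymbol_killingRow [CharZero K] (hω : ω.IsSymm) {T : Matrix (Fin 4) (Fin 4) K}
    (hT : T.IsSymm) (r : Fin 4) :
    HasSymbol (killingRow pd ω T r) 1 (∑ i, C ((T * ω) i r) * X i) := by
  have h : HasSymbol (∑ i, ∑ j, (1 / 2 * T i j) • lieRow pd ω i j r) 1
      (∑ i, ∑ j, C (1 / 2 * T i j) * (C (ω r j) * X i + C (ω i r) * X j)) :=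
    HasSymbol.sum fun i _ => HasSymbol.sum fun j _ => (hasSymbol_lieRow i j r).smul _
  have e1 : killingRow pd ω T r = ∑ i, ∑ j, (1 / 2 * T i j) • lieRow pd ω i j r := by
    change (∑ i, ∑ j, (1 / 2 * T i j) • lieRow pd ω i j) r = _
    simp only [Finset.sum_apply, Pi.smul_apply]
  have e2 : ∑ i, C ((T * ω) i r) * X i
      = ∑ i, ∑ j, C (1 / 2 * T i j) * (C (ω r j) * X i + C (ω i r) * X j) := by
    simp only [mul_add, Finset.sum_add_distrib]
    rw [Finset.sum_comm (f := fun i j => C (1 / 2 * T i j) * (C (ω i r) * X j)),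
      ← Finset.sum_add_distrib]
    refine Finset.sum_congr rfl fun i _ => ?_
    rw [Matrix.mul_apply, map_sum, Finset.sum_mul, ← Finset.sum_add_distrib]
    refine Finset.sum_congr rfl fun j _ => ?_
    rw [hT.apply i j, hω.apply j r, ← mul_assoc, ← C_mul, ← add_mul, ← C_add]
    congr 2
    ring
  rw [e1, e2]
  exact h

theorem confKillingRow_eq (i j : Fin 4) : confKillingRow pd ω i j
    = lieRow pd ω i j - ω i j • ∑ k, ∑ l, (1 / 4 * ω⁻¹ k l) • lieRow pd ω k l := by
  have h (k l : Fin 4) : (1 / ((4 : ℕ) : K) * ω i j * ω⁻¹ k l) • lieRow pd ω k l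
      = ω i j • (1 / 4 * ω⁻¹ k l) • lieRow pd ω k l := by
    rw [smul_smul, Nat.cast_ofNat]
    exact congrArg (· • lieRow pd ω k l) (by ring)
  rw [confKillingRow, Finset.sum_congr rfl fun k _ => Finset.sum_congr rfl fun l _ => h k l]
  simp only [← Finset.smul_sum]

theorem killingRow_mem (hω : ω.IsSymm) {T : Matrix (Fin 4) (Fin 4) K} (hT : T ∈ symTraceless ω) :
    killingRow pd ω T ∈ confKillingEqs pd ω := by
  have h : killingRow pd ω T = ∑ i, ∑ j, (1 / 2 * T i j) • confKillingRow pd ω i j := by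
    have h0 : ∑ i, ∑ j, 1 / 2 * T i j * ω i j = 0 := by
      have h : ∑ i, ∑ j, T i j * ω j i = 0 := hT.2
      simp only [mul_assoc, ← Finset.mul_sum]
      rw [Finset.sum_congr rfl fun i _ => Finset.sum_congr rfl fun j _ => by rw [hω.apply j i],
        h, mul_zero]
    simp only [confKillingRow_eq, smul_sub, Finset.sum_sub_distrib, smul_smul, ← Finset.sum_smul,
      h0, zero_smul, sub_zero]
    rfl
  rw [h]
  exact Submodule.sum_mem _ fun i _ => Submodule.sum_mem _ fun j _ =>
    Submodule.smul_mem _ _ (Submodule.subset_span ⟨(i, j), rfl⟩)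

theorem killingRow_single (i j : Fin 4) :
    killingRow pd ω (Matrix.single i j 1) = (1 / 2 : K) • lieRow pd ω i j := by
  change ∑ k, ∑ l, (1 / 2 * Matrix.single i j (1 : K) k l) • lieRow pd ω k l = _
  rw [Finset.sum_eq_single_of_mem i (Finset.mem_univ i), Finset.sum_eq_single_of_mem j
    (Finset.mem_univ j), Matrix.single_apply_same, mul_one]
  · intro l _ hl
    rw [Matrix.single_apply_of_ne _ _ _ _ _ (by simp [hl.symm]), mul_zero, zero_smul]
  · intro k _ hk
    refine Finset.sum_eq_zero fun l _ => ?_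
    rw [Matrix.single_apply_of_ne _ _ _ _ _ (by simp [hk.symm]), mul_zero, zero_smul]

theorem exists_killingRow [CharZero K] (hω : ω.IsSymm) (hdet : ω.det ≠ 0) (i j : Fin 4) :
    ∃ T ∈ symTraceless ω, killingRow pd ω T = confKillingRow pd ω i j := by
  -- The trace-free part of the symmetrised elementary matrix: its trace with `ω` is `2 ω_ij`, and
  -- that of `ω⁻¹` is 4.
  refine ⟨Matrix.single i j 1 + Matrix.single j i 1 - (1 / 2 * ω i j) • ω⁻¹, ⟨?_, ?_⟩, ?_⟩
  · rw [Matrix.IsSymm, Matrix.transpose_sub, Matrix.transpose_add, Matrix.transpose_single,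
      Matrix.transpose_single, Matrix.transpose_smul, Matrix.transpose_nonsing_inv, hω.eq, add_comm]
  · rw [sub_mul, add_mul, Matrix.smul_mul, Matrix.nonsing_inv_mul _ (isUnit_iff_ne_zero.2 hdet),
      Matrix.trace_sub, Matrix.trace_add, Matrix.trace_smul, Matrix.trace_one,
      Matrix.trace_single_mul, Matrix.trace_single_mul, hω.apply i j]
    simp
    ring
  · have h : killingRow pd ω ω⁻¹ = (2 : K) • ∑ k, ∑ l, (1 / 4 * ω⁻¹ k l) • lieRow pd ω k l := by
      change ∑ k, ∑ l, (1 / 2 * ω⁻¹ k l) • lieRow pd ω k l = _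
      simp only [Finset.smul_sum, smul_smul]
      refine Finset.sum_congr rfl fun k _ => Finset.sum_congr rfl fun l _ =>
        congrArg (· • lieRow pd ω k l) ?_
      ring
    rw [map_sub, map_add, map_smul, killingRow_single, killingRow_single, lieRow_symm hω j i,
      ← add_smul, confKillingRow_eq, h, smul_smul (1 / 2 * ω i j) 2,
      show (1 / 2 + 1 / 2 : K) = 1 by norm_num, one_smul,
      show 1 / 2 * ω i j * 2 = ω i j by ring]

theorem sum_inv_mul_symm (hω : ω.IsSymm) (hdet : ω.det ≠ 0) (r i : Fin 4) :
    ∑ c, ω⁻¹ r c * ω i c = if r = i then 1 else 0 := by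
  rw [← sum_inv_mul hdet]
  exact Finset.sum_congr rfl fun c _ => by rw [hω.apply]

/-! ### Rows of order at most two in the kernel of the evaluation -/

section Reduction

variable {ev : (Fin 4 → DiffOp pd) →+ Matrix (TractorIndex 4) (TractorIndex 4) K}

/-- In order zero the evaluation sends the coefficients to the `X ∧ Z` entries through the
invertible matrix `ω⁻¹`. -/
theorem IsEvaluation.eq_zero (hev : IsEvaluation pd ω ev) (hdet : ω.det ≠ 0)
    (hcomm : ∀ i j a, pd i (pd j a) = pd j (pd i a)) {p : Fin 4 → DiffOp pd}
    (hp : RowLT 1 p) (h : ev p = 0) : p = 0 := by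
  obtain ⟨a, rfl⟩ := exists_ofK_of_rowLT_one hcomm hp
  have h1 := hev.order_two 0 0 a
  simp only [Pi.zero_apply, map_zero, zero_mul, Finset.sum_const_zero, zero_add, zero_smul, h] at h1
  have h2 (b : Fin 4) : ∑ r, a r * ω⁻¹ r b = 0 := by
    have := congrFun (congrFun h1 none) (some (some b))
    rw [Matrix.sum_apply] at this
    exact this.symm
  have h3 : a = 0 := by
    have e : a ᵥ* ω⁻¹ = 0 := funext h2
    have := congrArg (· ᵥ* ω) e
    rwa [Matrix.vecMul_vecMul, Matrix.nonsing_inv_mul _ (isUnit_iff_ne_zero.2 hdet),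
      Matrix.vecMul_one, Matrix.zero_vecMul] at this
  funext r
  rw [h3, Pi.zero_apply, map_zero]
  rfl

/-- For the leading coefficients with one index raised, the `Z, Z` entries of the evaluation say
that they are symmetric and the `X, Y` entry that they are trace-free. So the leading part is that
of a conformal Killing equation. -/
theorem IsEvaluation.exists_sub_rowLT_one [CharZero K] (hev : IsEvaluation pd ω ev) (hω : ω.IsSymm) (hdet : ω.det ≠ 0)
    (hcomm : ∀ i j a, pd i (pd j a) = pd j (pd i a)) {p : Fin 4 → DiffOp pd}
    (hp : RowLT 2 p) (h : ev p = 0) : ∃ T ∈ symTraceless ω, RowLT 1 (p - killingRow pd ω T) := by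
  choose Q a hQ hQa using fun r => exists_order_decomposition hcomm (hp r)
  choose c hc using fun r => exists_ofK_of_rowLT_one hcomm (hQ r)
  have hpr : p = fun r => ∑ i, ofK pd (c r i) * dOp pd i + ofK pd (a r) := by
    funext r
    rw [hQa r, hc r]
  have h1 := hev.order_two 0 c a
  simp only [Pi.zero_apply, map_zero, zero_mul, Finset.sum_const_zero, zero_add, zero_smul,
    ← hpr, h] at h1
  have hentry (x y) : ∑ r, (∑ i, c r i * tractorNabla pd ω i (wedgeX (ω⁻¹ r)) x y
      + a r * wedgeX (ω⁻¹ r) x y) = 0 := by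
    have := congrFun (congrFun h1 x) y
    simp only [Matrix.sum_apply, Matrix.add_apply, Matrix.smul_apply, smul_eq_mul] at this
    exact this.symm
  let T : Matrix (Fin 4) (Fin 4) K := Matrix.of fun i k => ∑ r, c r i * ω⁻¹ r k
  have hTω (i r) : (T * ω) i r = c r i := by
    have : ∑ k, (∑ s, c s i * ω⁻¹ s k) * ω k r = c r i := by
      simp only [Finset.sum_mul, mul_assoc]
      rw [Finset.sum_comm]
      simp only [← Finset.mul_sum, sum_inv_mul hdet, mul_ite, mul_one, mul_zero,
        Finset.sum_ite_eq', Finset.mem_univ, if_true]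
    exact this
  have hT : T ∈ symTraceless ω := by
    refine ⟨Matrix.IsSymm.ext fun x y => ?_, ?_⟩
    · have := hentry (some (some x)) (some (some y))
      simp only [tractorNabla_wedgeX, wedgeX_apply, wedgeXEntry, mul_zero, add_zero, mul_sub,
        Finset.sum_sub_distrib, mul_ite, Finset.sum_ite_eq, Finset.mem_univ, if_true] at this
      exact (sub_eq_zero.1 this).symm
    · have := hentry none (some none)
      simp only [tractorNabla_wedgeX, wedgeX_apply, wedgeXEntry, mul_zero, add_zero,
        sum_inv_mul_symm hω hdet, mul_neg, mul_ite, mul_one, Finset.sum_neg_distrib,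
        Finset.sum_ite_eq, Finset.mem_univ, if_true, neg_eq_zero] at this
      change ∑ r, (T * ω) r r = 0
      simpa only [hTω] using this
  refine ⟨T, hT, fun r => ?_⟩
  have h2 : HasSymbol (p r) 1 (∑ i, C ((T * ω) i r) * X i) := by
    rw [hpr]
    have h3 : HasSymbol (∑ i, ofK pd (c r i) * dOp pd i) 1 (∑ i, C ((T * ω) i r) * X i) :=
      HasSymbol.sum fun i _ => by
        rw [hTω]
        exact (hasSymbol_dOp i).smul (c r i)
    have := h3.add (hasSymbol_of_mem_degLT (hasSymbol_ofK (pd := pd) (a r)).mem)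
    rwa [add_zero] at this
  have h4 := h2.add (hasSymbol_killingRow hω hT.1 r).neg
  rw [add_neg_cancel, ← sub_eq_add_neg] at h4
  exact h4.mem_of_zero

/-- In order two only the `Z, Y` entries are used: they give exactly the condition under which the
leading part is a combination of first derivatives of the equations. -/
theorem IsEvaluation.exists_sub_rowLT_two [CharZero K] (hev : IsEvaluation pd ω ev)
    (hω : ω.IsSymm) (hdet : ω.det ≠ 0) (hcomm : ∀ i j a, pd i (pd j a) = pd j (pd i a))
    {p : Fin 4 → DiffOp pd} (hp : RowLT 3 p) (h : ev p = 0) :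
    ∃ T : Fin 4 → Matrix (Fin 4) (Fin 4) K, (∀ j, T j ∈ symTraceless ω) ∧
      RowLT 2 (p - ∑ j, fun r => dOp pd j * killingRow pd ω (T j) r) := by
  choose Q a hQ hQa using fun r => exists_order_decomposition hcomm (hp r)
  choose Q' c hQ' hQc using fun r i => exists_order_decomposition hcomm (hQ r i)
  choose q hq using fun r i => exists_ofK_of_rowLT_one hcomm (hQ' r i)
  have hpr : p = fun r => ∑ i, (∑ j, ofK pd (q r i j) * dOp pd j + ofK pd (c r i)) * dOp pd i
      + ofK pd (a r) := by
    funext r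
    rw [hQa r]
    congr 1
    refine Finset.sum_congr rfl fun i _ => ?_
    rw [hQc r i, hq r i]
  have h1 := hev.order_two q c a
  rw [← hpr, h] at h1
  have hentry (x) : ∑ r, ∑ i, ∑ j, q r i j * (ω⁻¹ r x * ω i j
      - (if x = j then 1 else 0) * (if r = i then 1 else 0)
      - (if x = i then 1 else 0) * (if r = j then 1 else 0)) = 0 := by
    have := congrFun (congrFun h1 (some (some x))) (some none)
    simp only [Matrix.sum_apply, Matrix.add_apply, Matrix.smul_apply, smul_eq_mul,
      tractorNabla_tractorNabla_ZY hω hdet] at this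
    simp only [tractorNabla_wedgeX, wedgeX_apply, wedgeXEntry, mul_zero, add_zero] at this
    exact this.symm
  let Qt (i j k : Fin 4) : K := ∑ r, (q r i j + q r j i) * ω⁻¹ r k
  have hQt (i j k) : Qt i j k = Qt j i k :=
    Finset.sum_congr rfl fun r _ => by rw [add_comm (q r i j)]
  have hQtω (i j r) : ∑ k, Qt i j k * ω k r = q r i j + q r j i := by
    simp only [Qt, Finset.sum_mul, mul_assoc]
    rw [Finset.sum_comm]
    simp only [← Finset.mul_sum, sum_inv_mul hdet, mul_ite, mul_one, mul_zero,
      Finset.sum_ite_eq', Finset.mem_univ, if_true]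
  let A (j i r : Fin 4) : K := ∑ k, Qt j k i * ω k r
  -- The Christoffel trick: `Qt` is symmetric in its first two indices, and this is the tensor
  -- symmetric in `i, k` whose symmetrisation over `i, j` returns `Qt i j k`. The entry condition
  -- makes it trace-free.
  let T (j : Fin 4) : Matrix (Fin 4) (Fin 4) K :=
    Matrix.of fun i k => 1 / 2 * (Qt i j k + Qt j k i - Qt i k j)
  have hTω (j i r) : (T j * ω) i r = 1 / 2 * (q r i j + q r j i + A j i r - A i j r) := by
    have : ∑ k, 1 / 2 * (Qt i j k + Qt j k i - Qt i k j) * ω k r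
        = 1 / 2 * (q r i j + q r j i + A j i r - A i j r) := by
      rw [← hQtω, ← Finset.sum_add_distrib, ← Finset.sum_sub_distrib, Finset.mul_sum]
      exact Finset.sum_congr rfl fun k _ => by ring
    exact this
  have hT (j) : T j ∈ symTraceless ω := by
    refine ⟨Matrix.IsSymm.ext fun x y => ?_, ?_⟩
    · change 1 / 2 * (Qt y j x + Qt j x y - Qt y x j) = 1 / 2 * (Qt x j y + Qt j y x - Qt x y j)
      rw [hQt y j x, hQt j x y, hQt y x j]
      ring
    · have h2 := hentry j
      change ∑ r, (T j * ω) r r = 0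
      have e1 : ∑ r, A j r r = ∑ r, (q r r j + q r j r) := by
        simp only [A]
        rw [Finset.sum_comm]
        refine Finset.sum_congr rfl fun k _ => ?_
        rw [add_comm, ← hQtω]
        exact Finset.sum_congr rfl fun r _ => by rw [hω.apply]
      have e2 : ∑ r, A r j r = 2 * ∑ r, ∑ i, ∑ k, q r i k * (ω⁻¹ r j * ω i k) := by
        have e3 : ∑ r, A r j r = ∑ s, ∑ i, ∑ k, q s i k * (ω⁻¹ s j * ω i k)
            + ∑ s, ∑ i, ∑ k, q s k i * (ω⁻¹ s j * ω i k) := by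
          simp only [A, Qt, Finset.sum_mul, ← Finset.sum_add_distrib]
          rw [Finset.sum_congr rfl fun i _ => Finset.sum_comm, Finset.sum_comm]
          refine Finset.sum_congr rfl fun s _ => Finset.sum_congr rfl fun i _ =>
            Finset.sum_congr rfl fun k _ => ?_
          rw [hω.apply i k]
          ring
        rw [e3, two_mul]
        congr 1
        refine Finset.sum_congr rfl fun s _ => ?_
        rw [Finset.sum_comm]
        refine Finset.sum_congr rfl fun i _ => Finset.sum_congr rfl fun k _ => ?_
        rw [hω.apply i k]
      have e4 : ∑ r, ∑ i, ∑ k, q r i k * (ω⁻¹ r j * ω i k) = ∑ r, (q r r j + q r j r) := by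
        simp only [mul_sub, Finset.sum_sub_distrib, mul_ite, mul_one, mul_zero, Finset.sum_ite_eq,
          Finset.sum_ite_irrel, Finset.mem_univ, if_true, Finset.sum_const_zero] at h2
        rw [Finset.sum_add_distrib]
        linear_combination h2
      simp only [hTω]
      rw [← Finset.mul_sum, Finset.sum_sub_distrib, Finset.sum_add_distrib, e1, e2, e4]
      ring
  refine ⟨T, hT, fun r => ?_⟩
  have h2 : HasSymbol (p r) 2 (∑ i, (∑ j, C (q r i j) * X j) * X i) := by
    have h3 : HasSymbol (∑ i, (∑ j, ofK pd (q r i j) * dOp pd j + ofK pd (c r i)) * dOp pd i) 2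
        (∑ i, (∑ j, C (q r i j) * X j) * X i) := HasSymbol.sum fun i _ => by
      have h4 : HasSymbol (∑ j, ofK pd (q r i j) * dOp pd j) 1 (∑ j, C (q r i j) * X j) :=
        HasSymbol.sum fun j _ => (hasSymbol_dOp j).smul (q r i j)
      have := h4.add (hasSymbol_of_mem_degLT (hasSymbol_ofK (pd := pd) (c r i)).mem)
      rw [add_zero] at this
      exact this.mul hcomm (hasSymbol_dOp i)
    have h4 := h3.add (hasSymbol_of_mem_degLT (degLT_mono (Nat.le_succ 1)
      (hasSymbol_ofK (pd := pd) (a r)).mem))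
    rw [add_zero] at h4
    rwa [hpr]
  have h3 : HasSymbol ((∑ j, fun r => dOp pd j * killingRow pd ω (T j) r) r) 2
      (∑ j, X j * ∑ i, C ((T j * ω) i r) * X i) := by
    rw [Finset.sum_apply]
    exact HasSymbol.sum fun j _ =>
      (hasSymbol_dOp (pd := pd) j).mul hcomm (hasSymbol_killingRow hω (hT j).1 r)
  have e : ∑ j, X j * ∑ i, C ((T j * ω) i r) * X i
      = ∑ i, (∑ j, C (q r i j) * X j) * X i := by
    have hswap (g : Fin 4 → Fin 4 → K) : ∑ i, ∑ j, C (g j i) * (X j * X i)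
        = (∑ i, ∑ j, C (g i j) * (X j * X i) : MvPolynomial (Fin 4) K) := by
      rw [Finset.sum_comm]
      simp only [mul_comm (X _) (X _)]
    have hq2 := hswap (fun i j => q r i j)
    have hA2 := hswap (fun i j => A i j r)
    have h2 : C (1 / 2) * (2 : MvPolynomial (Fin 4) K) = 1 := by
      rw [show (2 : MvPolynomial (Fin 4) K) = C 2 from (map_ofNat C 2).symm, ← C_mul]
      norm_num
    have e1 : ∑ j, X j * ∑ i, C ((T j * ω) i r) * X i
        = C (1 / 2) * (∑ i, ∑ j, C (q r i j) * (X j * X i) + ∑ i, ∑ j, C (q r j i) * (X j * X i)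
          + ∑ i, ∑ j, C (A j i r) * (X j * X i) - ∑ i, ∑ j, C (A i j r) * (X j * X i)) := by
      simp only [hTω, C_mul, C_add, C_sub, Finset.mul_sum, ← Finset.sum_add_distrib,
        ← Finset.sum_sub_distrib]
      rw [Finset.sum_comm]
      refine Finset.sum_congr rfl fun i _ => Finset.sum_congr rfl fun j _ => ?_
      ring
    rw [e1, hq2, hA2]
    simp only [Finset.sum_mul, mul_assoc]
    linear_combination (∑ i, ∑ j, C (q r i j) * (X j * X i)) * h2
  rw [e] at h3
  have h4 := h2.add h3.neg
  rw [add_neg_cancel, ← sub_eq_add_neg] at h4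
  exact h4.mem_of_zero

end Reduction

end Evaluation

/-! ### The conformal Killing operator and its symbol -/

section KillingOperator

open MvPolynomial

variable {K : Type*} [Field K] {pd : Fin 4 → Derivation ℤ K K} {ω : Matrix (Fin 4) (Fin 4) K}

/-- The coefficients of a one-form. -/
def oneFormCoeff : extPow K 4 (Fin 4 → K) 1 →ₗ[K] Matrix (Fin 4) (Fin 4) K where
  toFun u := Matrix.of fun i r => (contrL 0 i u).1 ∅ r
  map_add' u v := by
    ext i r
    simp
  map_smul' c u := by
    ext i r
    simp

theorem oneFormCoeff_apply (u : extPow K 4 (Fin 4 → K) 1) (i r : Fin 4) :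
    oneFormCoeff u i r = (contrL 0 i u).1 ∅ r := rfl

theorem zeroForm_ext {u v : extPow K 4 (Fin 4 → K) 0} (h : u.1 ∅ = v.1 ∅) : u = v := by
  apply Subtype.ext
  funext J
  by_cases hJ : J = ∅
  · rw [hJ, h]
  · have : J.card ≠ 0 := fun h' => hJ (Finset.card_eq_zero.1 h')
    rw [u.2 J this, v.2 J this]

theorem oneFormCoeff_injective [CharZero K] {u : extPow K 4 (Fin 4 → K) 1}
    (h : oneFormCoeff u = 0) : u = 0 := by
  refine eq_zero_of_contrL fun i => zeroForm_ext (funext fun r => ?_)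
  exact congrFun (congrFun h i) r

theorem oneFormCoeff_surjective (G : Matrix (Fin 4) (Fin 4) K) : ∃ u, oneFormCoeff u = G := by
  let v (j : Fin 4) : extPow K 4 (Fin 4 → K) 0 :=
    ⟨fun J => if J = ∅ then G j else 0, fun J hJ => if_neg fun h => hJ (by simp [h])⟩
  refine ⟨∑ j, wedgeL 0 j (v j), ?_⟩
  ext i r
  rw [oneFormCoeff_apply, map_sum]
  simp only [contrL_wedgeL_zero, Finset.sum_ite_eq, Finset.mem_univ, if_true]
  rfl

theorem mem_killingSymbols_iff {u : extPow K 4 (Fin 4 → K) 1} : u ∈ killingSymbols ω ↔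
    (∀ s r, ∑ i, ω i s * oneFormCoeff u i r = ∑ i, ω i r * oneFormCoeff u i s) ∧
      (oneFormCoeff u).trace = 0 := by
  have h : (algDiff (mulZero ω) 0 u).1 ∅ = ∑ i, mulZero ω i ((contrL 0 i u).1 ∅) := by
    rw [algDiff_apply, AddSubmonoidClass.coe_finsetSum, Finset.sum_apply]
    rfl
  have h1 : u ∈ killingSymbols ω ↔ (algDiff (mulZero ω) 0 u).1 ∅ = 0 := by
    refine ⟨fun hu => ?_, fun hu => ?_⟩
    · have : algDiff (mulZero ω) 0 u = 0 := hu
      rw [this]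
      rfl
    · change algDiff (mulZero ω) 0 u = 0
      apply Subtype.ext
      funext J
      by_cases hJ : J = ∅
      · rw [hJ, hu]
        rfl
      · exact (algDiff (mulZero ω) 0 u).2 J fun h' => hJ (Finset.card_eq_zero.1 h')
  rw [h1, h, Prod.ext_iff, Prod.fst_sum, Prod.snd_sum]
  refine and_congr ?_ Iff.rfl
  rw [Subtype.ext_iff, AddSubmonoidClass.coe_finsetSum]
  constructor
  · intro h s r
    have := congrFun (congrFun h s) r
    rw [Finset.sum_apply, Finset.sum_apply] at this
    rw [← sub_eq_zero, ← Finset.sum_sub_distrib]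
    exact this
  · intro h
    funext s r
    rw [Finset.sum_apply, Finset.sum_apply]
    have := sub_eq_zero.2 (h s r)
    rw [← Finset.sum_sub_distrib] at this
    exact this

variable (ω) in
/-- The bivector `T^{ij} = c^i_r ω^{rj}` of an element of the symbol. -/
def killingBivector : killingSymbols ω →ₗ[K] Matrix (Fin 4) (Fin 4) K where
  toFun u := oneFormCoeff u.1 * ω⁻¹
  map_add' u v := by
    rw [Submodule.coe_add, map_add, add_mul]
  map_smul' c u := by
    rw [Submodule.coe_smul, map_smul, Matrix.smul_mul]
    rfl

theorem killingBivector_mul (hdet : ω.det ≠ 0) (u : killingSymbols ω) :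
    killingBivector ω u * ω = oneFormCoeff u.1 := by
  change oneFormCoeff u.1 * ω⁻¹ * ω = _
  rw [mul_assoc, Matrix.nonsing_inv_mul _ (isUnit_iff_ne_zero.2 hdet), mul_one]

theorem killingBivector_injective [CharZero K] (hdet : ω.det ≠ 0) :
    Function.Injective (killingBivector ω) := by
  rw [injective_iff_map_eq_zero]
  intro u hu
  have h := killingBivector_mul hdet u
  rw [hu, zero_mul] at h
  exact Subtype.ext (oneFormCoeff_injective h.symm)

theorem killingBivector_mem (hω : ω.IsSymm) (hdet : ω.det ≠ 0) (u : killingSymbols ω) :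
    killingBivector ω u ∈ symTraceless ω := by
  obtain ⟨h1, h2⟩ := mem_killingSymbols_iff.1 u.2
  refine ⟨?_, by rw [killingBivector_mul hdet, h2]⟩
  have h3 : (ωᵀ * oneFormCoeff u.1)ᵀ = ωᵀ * oneFormCoeff u.1 := by
    ext s r
    exact h1 r s
  rw [hω.eq, ← killingBivector_mul hdet, Matrix.transpose_mul, Matrix.transpose_mul, hω.eq,
    mul_assoc] at h3
  have h4 := congrArg (fun A => ω⁻¹ * A * ω⁻¹) h3
  simp only [mul_assoc, Matrix.mul_nonsing_inv _ (isUnit_iff_ne_zero.2 hdet), mul_one] at h4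
  change (killingBivector ω u)ᵀ = killingBivector ω u
  simpa only [← mul_assoc, Matrix.nonsing_inv_mul _ (isUnit_iff_ne_zero.2 hdet), one_mul] using h4

theorem exists_killingBivector (hω : ω.IsSymm) (hdet : ω.det ≠ 0) {T : Matrix (Fin 4) (Fin 4) K}
    (hT : T ∈ symTraceless ω) : ∃ u, killingBivector ω u = T := by
  obtain ⟨u, hu⟩ := oneFormCoeff_surjective (T * ω)
  refine ⟨⟨u, mem_killingSymbols_iff.2 ⟨?_, ?_⟩⟩, ?_⟩
  · have h : (ω * (T * ω))ᵀ = ω * (T * ω) := by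
      rw [Matrix.transpose_mul, Matrix.transpose_mul, hω.eq, hT.1.eq, mul_assoc]
    intro s r
    have h1 := congrFun (congrFun h r) s
    rw [Matrix.transpose_apply, Matrix.mul_apply, Matrix.mul_apply] at h1
    rw [hu]
    simpa only [hω.apply _ r, hω.apply _ s] using h1
  · rw [hu]
    exact hT.2
  · change oneFormCoeff u * ω⁻¹ = T
    rw [hu, mul_assoc, Matrix.mul_nonsing_inv _ (isUnit_iff_ne_zero.2 hdet), mul_one]

variable (pd) in
/-- The conformal Killing operator in a basis of its symbol. -/
def killingOperator (b : Module.Basis (Fin 9) K (killingSymbols ω)) :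
    Matrix (Fin 9) (Fin 4) (DiffOp pd) :=
  Matrix.of fun a => killingRow pd ω (killingBivector ω (b a))

theorem hasSymbol_killingOperator [CharZero K] (hω : ω.IsSymm) (hdet : ω.det ≠ 0)
    (b : Module.Basis (Fin 9) K (killingSymbols ω)) (a : Fin 9) (r : Fin 4) :
    HasSymbol (killingOperator pd b a r) 1 (killingSymbolMatrix b a r) := by
  have h := hasSymbol_killingRow (pd := pd) hω (killingBivector_mem hω hdet (b a)).1 r
  rw [killingBivector_mul hdet] at h
  exact h

/-- The coefficients of the symbol are the entries of `T * ω`, and `ω` is invertible. -/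
theorem killingRow_injective [CharZero K] (hω : ω.IsSymm) (hdet : ω.det ≠ 0)
    {T : Matrix (Fin 4) (Fin 4) K} (hT : T.IsSymm) (h : killingRow pd ω T = 0) : T = 0 := by
  have h1 : T * ω = 0 := by
    ext i r
    have h2 := (hasSymbol_killingRow (pd := pd) hω hT r).eq_zero (by
      rw [h]
      simp)
    have h3 := congrArg (coeff (Finsupp.single i 1)) h2
    simpa [coeff_sum, coeff_C_mul, coeff_X, Finsupp.single_left_inj] using h3
  have h2 := congrArg (· * ω⁻¹) h1
  simpa only [mul_assoc, Matrix.mul_nonsing_inv _ (isUnit_iff_ne_zero.2 hdet), mul_one,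
    zero_mul] using h2

theorem sum_smul_killingOperator (b : Module.Basis (Fin 9) K (killingSymbols ω)) (a : Fin 9 → K) :
    ∑ i, a i • (killingOperator pd b).row i
      = killingRow pd ω (killingBivector ω (∑ i, a i • b i)) := by
  rw [map_sum, map_sum]
  refine Finset.sum_congr rfl fun i _ => ?_
  rw [map_smul (killingBivector ω), map_smul (killingRow pd ω)]
  rfl

theorem exists_sum_smul_killingOperator (hω : ω.IsSymm) (hdet : ω.det ≠ 0)
    (b : Module.Basis (Fin 9) K (killingSymbols ω)) {T : Matrix (Fin 4) (Fin 4) K}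
    (hT : T ∈ symTraceless ω) :
    ∃ a : Fin 9 → K, ∑ i, a i • (killingOperator pd b).row i = killingRow pd ω T := by
  obtain ⟨u, rfl⟩ := exists_killingBivector hω hdet hT
  exact ⟨fun i => b.repr u i, by rw [sum_smul_killingOperator, b.sum_repr]⟩

theorem isRowBasis_killingOperator [CharZero K] (hω : ω.IsSymm) (hdet : ω.det ≠ 0)
    (b : Module.Basis (Fin 9) K (killingSymbols ω)) :
    IsRowBasis (killingOperator pd b) (confKillingEqs pd ω) := by
  refine ⟨Fintype.linearIndependent_iff.2 fun a ha => ?_, le_antisymm ?_ ?_⟩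
  · rw [sum_smul_killingOperator] at ha
    have h0 : ∑ i, a i • b i = 0 :=
      (injective_iff_map_eq_zero _).1 (killingBivector_injective hdet) _
        (killingRow_injective hω hdet (killingBivector_mem hω hdet _).1 ha)
    have h1 := b.repr_sum_self a
    rw [h0, map_zero] at h1
    exact fun i => (congrFun h1 i).symm
  · rw [Submodule.span_le]
    rintro _ ⟨i, rfl⟩
    exact killingRow_mem hω (killingBivector_mem hω hdet (b i))
  · refine Submodule.span_le.2 ?_
    rintro _ ⟨⟨i, j⟩, rfl⟩
    obtain ⟨T, hT, hTr⟩ := exists_killingRow (pd := pd) hω hdet i j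
    obtain ⟨a, ha⟩ := exists_sum_smul_killingOperator (pd := pd) hω hdet b hT
    change confKillingRow pd ω i j ∈ _
    rw [← hTr, ← ha]
    exact Submodule.sum_mem _ fun k _ =>
      Submodule.smul_mem _ _ (Submodule.subset_span ⟨k, rfl⟩)

theorem exists_vecMul_killingOperator (hω : ω.IsSymm) (hdet : ω.det ≠ 0)
    (b : Module.Basis (Fin 9) K (killingSymbols ω)) {T : Matrix (Fin 4) (Fin 4) K}
    (hT : T ∈ symTraceless ω) :
    ∃ c, RowLT 1 c ∧ c ᵥ* killingOperator pd b = killingRow pd ω T := by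
  obtain ⟨a, ha⟩ := exists_sum_smul_killingOperator (pd := pd) hω hdet b hT
  exact ⟨fun i => ofK pd (a i), rowLT_one_ofK _, by rw [← sum_smul_row, ha]⟩

theorem IsEvaluation.killingRow [CharZero K] (hω : ω.IsSymm) (hdet : ω.det ≠ 0)
    {ev : (Fin 4 → DiffOp pd) →+ Matrix (TractorIndex 4) (TractorIndex 4) K}
    (hev : IsEvaluation pd ω ev) {T : Matrix (Fin 4) (Fin 4) K} (hT : T ∈ symTraceless ω) :
    ev (FormalTheory.killingRow pd ω T) = 0 := by
  have hs (a : K) (p : Fin 4 → DiffOp pd) : ev (a • p) = a • ev p := hev.ofK_mul a p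
  change ev (∑ i, ∑ j, (1 / 2 * T i j) • FormalTheory.lieRow pd ω i j) = 0
  simp only [map_sum, hs, hev.lieRow hω hdet, smul_smul, ← Finset.sum_smul]
  have h0 : ∑ i, ∑ j, 1 / 2 * T i j * (-2 * ω i j) = 0 := by
    have h : ∑ i, ∑ j, T i j * ω j i = 0 := hT.2
    rw [← neg_eq_zero, ← Finset.sum_neg_distrib] at h
    rw [← h]
    refine Finset.sum_congr rfl fun i _ => ?_
    rw [← Finset.sum_neg_distrib]
    refine Finset.sum_congr rfl fun j _ => ?_
    rw [hω.apply j i]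
    ring
  rw [h0, zero_smul]

/-- Every combination of the equations lies in the kernel of the evaluation. If its order is at most
2, its parts of order 2, 1 and 0 are removed in turn, with coefficients of order at most 1
throughout. -/
theorem exists_order_two_reduction [CharZero K] (hcomm : ∀ i j a, pd i (pd j a) = pd j (pd i a))
    (hω : ω.IsSymm) (hdet : ω.det ≠ 0) (hW : ∀ k l i j, weylTensor pd ω k l i j = 0)
    (b : Module.Basis (Fin 9) K (killingSymbols ω)) (c : Fin 9 → DiffOp pd)
    (hc : RowLT 3 (c ᵥ* killingOperator pd b)) :
    ∃ c', RowLT 2 c' ∧ c' ᵥ* killingOperator pd b = c ᵥ* killingOperator pd b := by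
  obtain ⟨ev, hev⟩ := exists_evaluation hcomm hω hdet hW
  have h0 : ev (c ᵥ* killingOperator pd b) = 0 := hev.vecMul_eq_zero (fun a =>
    hev.killingRow hω hdet (killingBivector_mem hω hdet (b a))) c
  generalize c ᵥ* killingOperator pd b = p at hc h0
  obtain ⟨T, hT, h2⟩ := hev.exists_sub_rowLT_two hω hdet hcomm hc h0
  have h3 : ev (∑ j, fun r => dOp pd j * killingRow pd ω (T j) r) = 0 := by
    rw [map_sum]
    refine Finset.sum_eq_zero fun j _ => hev.mul_eq_zero _ ?_
    exact hev.killingRow hω hdet (hT j)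
  have h4 : ev (p - ∑ j, fun r => dOp pd j * killingRow pd ω (T j) r) = 0 := by
    rw [map_sub, h0, h3, sub_zero]
  obtain ⟨U, hU, h5⟩ := hev.exists_sub_rowLT_one hω hdet hcomm h2 h4
  have h6 := hev.eq_zero hdet hcomm h5 (by
    rw [map_sub, h4, hev.killingRow hω hdet hU, sub_zero])
  choose x hx hxT using fun j => exists_vecMul_killingOperator (pd := pd) hω hdet b (hT j)
  obtain ⟨y, hy, hyU⟩ := exists_vecMul_killingOperator (pd := pd) hω hdet b hU
  refine ⟨∑ j, (fun a => dOp pd j * x j a) + y, RowLT.add (fun a => ?_) (hy.mono one_le_two), ?_⟩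
  · rw [Finset.sum_apply, map_sum]
    refine Submodule.sum_mem _ fun j _ => ?_
    have h7 := (hasSymbol_dOp (pd := pd) j).mul hcomm (hasSymbol_of_mem (hx j a))
    exact h7.mem
  · have h8 (j) : (fun a => dOp pd j * x j a) ᵥ* killingOperator pd b
        = fun r => dOp pd j * killingRow pd ω (T j) r := by
      funext r
      rw [← hxT j]
      simp only [Matrix.vecMul, dotProduct, Finset.mul_sum, mul_assoc]
    rw [Matrix.add_vecMul, Matrix.sum_vecMul, hyU, Finset.sum_congr rfl fun j _ => h8 j]
    rw [sub_eq_zero, sub_eq_iff_eq_add] at h6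
    rw [h6, add_comm]

end KillingOperator

/-! ### The differential sequence -/

section Sequence

variable {K : Type*} [Field K] {pd : Fin 4 → Derivation ℤ K K} {ω : Matrix (Fin 4) (Fin 4) K}

theorem eq_zero_of_compat_eq_bot {p m : ℕ} {P : Matrix (Fin p) (Fin m) (DiffOp pd)}
    (h : compat P 0 = ⊥) {c : Fin p → DiffOp pd} (hc : RowLT 1 c) (hcP : c ᵥ* P = 0) : c = 0 := by
  have : c ∈ compat P 0 := mem_compat_iff.2 ⟨hc, hcP⟩
  rwa [h] at this

theorem eq_zero_of_symbol_injective (hcomm : ∀ i j a, pd i (pd j a) = pd j (pd i a))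
    {p m d : ℕ} {P : Matrix (Fin p) (Fin m) (DiffOp pd)}
    {A : Matrix (Fin p) (Fin m) (MvPolynomial (Fin 4) K)} (hP : ∀ i j, HasSymbol (P i j) d (A i j))
    (hA : ∀ x, x ᵥ* A = 0 → x = 0) {c : Fin p → DiffOp pd} (hc : c ᵥ* P = 0) : c = 0 := by
  -- Exactness with a matrix of zero rows expresses that there are no nonzero CC.
  have h : StrictlyGenerates P (0 : Matrix (Fin 0) (Fin p) (DiffOp pd)) 0 :=
    strictlyGenerates_of_symbol hcomm hP (B := 0) (fun i => i.elim0)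
      (fun b => by rw [Matrix.vecMul_zero, Matrix.zero_vecMul])
      fun x hx => ⟨0, by rw [hA x hx, Matrix.vecMul_zero]⟩
  obtain ⟨k, hk⟩ := exists_rowLT c
  obtain ⟨b, -, rfl⟩ := h k c hk hc
  exact Matrix.vecMul_zero b

/-- Lifting and strict exactness alternate: `s₁` for `CKilling` supplies the integrability needed to
lift `Bianchi`, and `s₂` the one needed to lift the last operator. Conformal flatness enters only in
the first lift. -/
theorem exists_conformal_sequence [CharZero K] (hcomm : ∀ i j a, pd i (pd j a) = pd j (pd i a))
    (hω : ω.IsSymm) (hdet : ω.det ≠ 0) (hW : ∀ k l i j, weylTensor pd ω k l i j = 0) :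
    ∃ (CKilling : Matrix (Fin 9) (Fin 4) (DiffOp pd)) (Weyl : Matrix (Fin 10) (Fin 9) (DiffOp pd))
      (Bianchi : Matrix (Fin 9) (Fin 10) (DiffOp pd)) (Last : Matrix (Fin 4) (Fin 9) (DiffOp pd)),
      IsRowBasis CKilling (confKillingEqs pd ω) ∧
      IsGeneratingCC CKilling Weyl 2 ∧ compat CKilling 1 = ⊥ ∧
      IsGeneratingCC Weyl Bianchi 2 ∧ compat Weyl 1 = ⊥ ∧
      IsGeneratingCC Bianchi Last 1 ∧ compat Bianchi 0 = ⊥ ∧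
      ∀ c : Fin 4 → DiffOp pd, c ᵥ* Last = 0 → c = 0 := by
  have : Module.Free K (killingSymbols ω) := Module.Free.of_divisionRing K (killingSymbols ω)
  have : Module.Finite K (killingSymbols ω) :=
    Module.finite_of_finrank_pos (by rw [finrank_killingSymbols hω hdet]; norm_num)
  let b := Module.finBasisOfFinrankEq K (killingSymbols ω) (finrank_killingSymbols hω hdet)
  obtain ⟨A₂, A₃, A₄, h₂, h₃, h₄, e₁, e₂, e₃, e₄⟩ := exists_symbol_resolution hω hdet b
  have hC := hasSymbol_killingOperator (pd := pd) hω hdet b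
  obtain ⟨W, hWs, hWC⟩ := exists_lift_of_symbol hcomm hC h₂ (fun y => (e₁ _).2 ⟨y, rfl⟩)
    (exists_order_two_reduction hcomm hω hdet hW b)
  have s₁ := strictlyGenerates_of_symbol hcomm hC hWs hWC fun x => (e₁ x).1
  -- A combination of the rows of `W` of order less than `2 + 2` is a CC of `CKilling`, so by `s₁`
  -- it has coefficients of order less than `4 - 2`.
  obtain ⟨B, hBs, hBW⟩ := exists_lift_of_symbol hcomm hWs h₃ (fun y => (e₂ _).2 ⟨y, rfl⟩)
    fun c hc => s₁ _ _ hc (hWC c)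
  have s₂ := strictlyGenerates_of_symbol hcomm hWs hBs hBW fun x => (e₂ x).1
  obtain ⟨L, hLs, hLB⟩ := exists_lift_of_symbol hcomm hBs h₄ (fun y => (e₃ _).2 ⟨y, rfl⟩)
    fun c hc => s₂ _ _ hc (hBW c)
  have s₃ := strictlyGenerates_of_symbol hcomm hBs hLs hLB fun x => (e₃ x).1
  have s₄ (c) (hc : c ᵥ* L = 0) : c = 0 := eq_zero_of_symbol_injective hcomm hLs e₄ hc
  have z₂ : compat W 0 = ⊥ := s₂.compat_eq_bot hcomm (by norm_num)
  have z₃ : compat B 0 = ⊥ := s₃.compat_eq_bot hcomm (by norm_num)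
  exact ⟨killingOperator pd b, W, B, L, isRowBasis_killingOperator hω hdet b,
    s₁.isGeneratingCC hcomm (fun i j => (hWs i j).mem) hWC fun c => eq_zero_of_compat_eq_bot z₂,
    s₁.compat_eq_bot hcomm (by norm_num),
    s₂.isGeneratingCC hcomm (fun i j => (hBs i j).mem) hBW fun c => eq_zero_of_compat_eq_bot z₃,
    s₂.compat_eq_bot hcomm (by norm_num),
    s₃.isGeneratingCC hcomm (fun i j => (hLs i j).mem) hLB fun c _ => s₄ c, z₃, s₄⟩

end Sequence

/-! ### Acyclicity of the conformal Killing symbol -/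

section Acyclicity

variable {K : Type*} [Field K] {n : ℕ}

/-- Contracting the symmetry with `i_q` gives `(n - t - 2) B_p = -dx^p ∧ τ`, where `τ` is the trace
of `B`. Contracting once more gives `2 (n - t - 1) τ = 0`. Both factors are nonzero exactly in the
range needed. -/
theorem eq_zero_of_wedge_symm [CharZero K] {t : ℕ} (ht : t + 2 < n)
    {B : Fin n → Finset (Fin n) → K} (hB : ∀ p, B p ∈ extPow K n K (t + 1))
    (h : ∀ p q, wedge K K p (B q) = wedge K K q (B p)) (p : Fin n) : B p = 0 := by
  set τ : Finset (Fin n) → K := ∑ q, contr K K q (B q) with hτ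
  have hτm : τ ∈ extPow K n K t := Submodule.sum_mem _ fun q _ => contr_mem q (hB q)
  have h1 (p) : ((n : K) - (t + 1 : ℕ)) • B p = B p - wedge K K p τ := by
    rw [← sum_contr_wedge (hB p), Finset.sum_congr rfl fun q _ => congrArg _ (h q p), hτ, map_sum]
    have h2 (q) : contr K K q (wedge K K p (B q))
        = (if q = p then B q else 0) - wedge K K p (contr K K q (B q)) :=
      eq_sub_of_add_eq (contr_wedge q p (B q))
    rw [Finset.sum_congr rfl fun q _ => h2 q, Finset.sum_sub_distrib, Finset.sum_ite_eq',
      if_pos (Finset.mem_univ p)]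
  have h3 : τ = 0 := by
    have h4 : ((n : K) - (t + 1 : ℕ)) • τ = τ - ((n : K) - t) • τ := by
      rw [← sum_contr_wedge hτm, hτ, Finset.smul_sum, ← hτ, ← Finset.sum_sub_distrib]
      refine Finset.sum_congr rfl fun q _ => ?_
      rw [← map_smul, h1, map_sub]
    have h5 : (2 * ((n : K) - (t + 1 : ℕ))) • τ = 0 := by
      have : (2 * ((n : K) - (t + 1 : ℕ))) • τ
          = ((n : K) - (t + 1 : ℕ)) • τ - (τ - ((n : K) - t) • τ) := by
        rw [← one_smul K τ, smul_smul, smul_smul, smul_smul, mul_one, one_smul]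
        push_cast
        module
      rw [this, h4, sub_self]
    refine (smul_eq_zero.1 h5).resolve_left (mul_ne_zero two_ne_zero (sub_ne_zero.2 ?_))
    exact_mod_cast (by omega : n ≠ t + 1)
  have h6 : ((n : K) - (t + 2 : ℕ)) • B p = 0 := by
    have h7 := h1 p
    rw [h3, map_zero, sub_zero] at h7
    have : ((n : K) - (t + 2 : ℕ)) • B p = ((n : K) - (t + 1 : ℕ)) • B p - B p := by
      push_cast
      module
    rw [this, h7, sub_self]
  refine (smul_eq_zero.1 h6).resolve_left (sub_ne_zero.2 ?_)
  exact_mod_cast (by omega : n ≠ t + 2)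

theorem exists_single_add (q : ℕ) (μ : Fin n →₀ ℕ) (hμ : μ.degree = q + 1) :
    ∃ (i : Fin n) (ν : Fin n →₀ ℕ), ν.degree = q ∧ μ = ν + Finsupp.single i 1 := by
  have h0 : μ ≠ 0 := by
    rintro rfl
    simp at hμ
  obtain ⟨i, hi⟩ := Finsupp.ne_iff.1 h0
  have e : μ - Finsupp.single i 1 + Finsupp.single i 1 = μ := tsub_add_cancel_of_le (by
    rw [Finsupp.single_le_iff]
    exact Nat.one_le_iff_ne_zero.2 hi)
  refine ⟨i, μ - Finsupp.single i 1, ?_, e.symm⟩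
  have := congrArg Finsupp.degree e
  rw [map_add, Finsupp.degree_single] at this
  omega

theorem exists_single_add_single (μ : Fin n →₀ ℕ) (hμ : μ.degree = 2) :
    ∃ i m : Fin n, μ = Finsupp.single i 1 + Finsupp.single m 1 := by
  obtain ⟨m, ν, hν, rfl⟩ := exists_single_add 1 μ hμ
  obtain ⟨i, ν', hν', rfl⟩ := exists_single_add 0 ν hν
  rw [(Finsupp.degree_eq_zero_iff ν').1 hν', zero_add]
  exact ⟨i, m, rfl⟩

theorem mem_confSymbolTwo_iff {ω : Matrix (Fin n) (Fin n) K} {v : Jets K n n} :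
    v ∈ confSymbolTwo ω ↔ v ∈ symSpace K n n 2 ∧ ∀ m i j,
      ∑ r, ω r j * v (Finsupp.single i 1 + Finsupp.single m 1) r
        + ∑ r, ω i r * v (Finsupp.single j 1 + Finsupp.single m 1) r
        - 2 / (n : K) * ω i j * ∑ r, v (Finsupp.single r 1 + Finsupp.single m 1) r = 0 := by
  rw [confSymbolTwo, prolong, Submodule.mem_inf, Submodule.mem_iInf]
  refine and_congr_right fun hv => ?_
  simp only [Submodule.mem_iInf, Submodule.mem_comap]
  constructor
  · exact fun h m => (h (Finsupp.single m 1) (Finsupp.degree_single m 1)).2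
  · intro h ν hν
    obtain ⟨m, ν', hν', rfl⟩ := exists_single_add 0 ν hν
    rw [(Finsupp.degree_eq_zero_iff ν').1 hν', zero_add]
    refine ⟨fun μ hμ => hv _ ?_, h m⟩
    rw [map_add, Finsupp.degree_single]
    omega

/-- The trace of an element of the symbol of order two. -/
def symbolTrace (l : Fin n) : Jets K n n →ₗ[K] K where
  toFun v := 1 / (n : K) * ∑ r, v (Finsupp.single r 1 + Finsupp.single l 1) r
  map_add' v w := by simp [mul_add, Finset.sum_add_distrib]
  map_smul' c v := by
    simp only [Pi.smul_apply, smul_eq_mul, ← Finset.mul_sum, RingHom.id_apply]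
    ring

/-- As for the Levi-Civita connection, the first-order equations in three permutations of the
indices determine the lowered tensor completely by its trace part. -/
theorem confSymbolTwo_apply [CharZero K] {ω : Matrix (Fin n) (Fin n) K} (hω : ω.IsSymm)
    (hdet : ω.det ≠ 0) {v : Jets K n n} (hv : v ∈ confSymbolTwo ω) (i m k : Fin n) :
    v (Finsupp.single i 1 + Finsupp.single m 1) k
      = (if k = i then symbolTrace m v else 0) + (if k = m then symbolTrace i v else 0)
        - ω i m * ∑ j, ω⁻¹ k j * symbolTrace j v := by
  have hb (j i m : Fin n) : ∑ r, ω j r * v (Finsupp.single i 1 + Finsupp.single m 1) r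
      = ω j i * symbolTrace m v + ω j m * symbolTrace i v - ω i m * symbolTrace j v := by
    have h (m i j : Fin n) : ∑ r, ω j r * v (Finsupp.single i 1 + Finsupp.single m 1) r
        + ∑ r, ω i r * v (Finsupp.single j 1 + Finsupp.single m 1) r
        = 2 * ω i j * symbolTrace m v := by
      have h1 := (mem_confSymbolTwo_iff.1 hv).2 m i j
      have h2 : ∑ r, ω r j * v (Finsupp.single i 1 + Finsupp.single m 1) r
          = ∑ r, ω j r * v (Finsupp.single i 1 + Finsupp.single m 1) r :=
        Finset.sum_congr rfl fun r _ => by rw [hω.apply]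
      rw [h2] at h1
      change _ = 2 * ω i j * (1 / (n : K) * _)
      linear_combination h1
    have hs (j i m : Fin n) : ∑ r, ω j r * v (Finsupp.single i 1 + Finsupp.single m 1) r
        = ∑ r, ω j r * v (Finsupp.single m 1 + Finsupp.single i 1) r := by
      rw [add_comm (Finsupp.single i 1)]
    rw [hω.apply i j, ← hω.apply j m, ← hω.apply i m]
    -- Two permutations minus the third, with `hs` supplying the symmetry of second derivatives.
    linear_combination (1 / 2 : K) * (h m i j + h i m j - h j m i + hs j i m - hs i j m - hs m j i)
  have h := sum_inv_mul_sum hdet (v (Finsupp.single i 1 + Finsupp.single m 1)) k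
  rw [← h]
  simp only [hb]
  have e1 (i : Fin n) (a : K) : ∑ j, ω⁻¹ k j * (ω j i * a) = if k = i then a else 0 := by
    simp only [← mul_assoc]
    rw [← Finset.sum_mul, sum_inv_mul hdet, ite_mul, one_mul, zero_mul]
  simp only [mul_sub, mul_add, Finset.sum_sub_distrib, Finset.sum_add_distrib, e1]
  rw [Finset.mul_sum]
  congr 1
  exact Finset.sum_congr rfl fun j _ => mul_left_comm _ _ _

theorem eq_zero_of_symbolTrace [CharZero K] {ω : Matrix (Fin n) (Fin n) K} (hω : ω.IsSymm)
    (hdet : ω.det ≠ 0) {v : Jets K n n} (hv : v ∈ confSymbolTwo ω)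
    (h : ∀ l, symbolTrace l v = 0) : v = 0 := by
  funext μ k
  by_cases hμ : μ.degree = 2
  · obtain ⟨i, m, rfl⟩ := exists_single_add_single μ hμ
    rw [confSymbolTwo_apply hω hdet hv]
    simp [h]
  · rw [(mem_confSymbolTwo_iff.1 hv).1 μ hμ]
    rfl

theorem delta_apply {m : ℕ} (α : Forms K n m) (J : Finset (Fin n)) (μ : Fin n →₀ ℕ) (k : Fin m) :
    delta K n m α J μ k
      = ∑ i, wedge K K i (fun I => α I (μ + Finsupp.single i 1) k) J := by
  simp only [wedge_apply]
  rw [Finset.sum_ite_mem, Finset.univ_inter]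
  change (∑ i ∈ J, moveSign K i J • shift (Finsupp.single i 1) (α (J.erase i))) μ k = _
  rw [Finset.sum_apply, Finset.sum_apply]
  rfl

theorem delta_eq_zero_iff {t : ℕ} {ω : Matrix (Fin n) (Fin n) K} {α : Forms K n n}
    (hα : α ∈ formsIn t (confSymbolTwo ω)) : delta K n n α = 0 ↔
      ∀ m k, ∑ i, wedge K K i (fun I => α I (Finsupp.single i 1 + Finsupp.single m 1) k) = 0 := by
  constructor
  · intro h m k
    funext J
    have h1 := delta_apply α J (Finsupp.single m 1) k
    rw [h] at h1
    rw [Finset.sum_apply]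
    simp only [add_comm (Finsupp.single _ 1) (Finsupp.single m 1)]
    exact h1.symm
  · intro h
    funext J μ k
    rw [delta_apply, ← Finset.sum_apply]
    by_cases hμ : μ.degree = 1
    · obtain ⟨m, ν, hν, rfl⟩ := exists_single_add 0 μ hμ
      rw [(Finsupp.degree_eq_zero_iff ν).1 hν, zero_add]
      simp only [add_comm (Finsupp.single m 1)]
      rw [h]
      rfl
    · have h1 (i : Fin n) : (fun I => α I (μ + Finsupp.single i 1) k) = 0 := funext fun I => by
        rw [(mem_confSymbolTwo_iff.1 (hα I).1).1 _ (by
          rw [map_add, Finsupp.degree_single]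
          omega)]
        rfl
      simp only [h1, map_zero, Finset.sum_const_zero]
      rfl

/-- The `δ`-closed forms with values in the symbol of order two, in terms of their traces. -/
theorem sum_wedge_confSymbolTwo [CharZero K] {ω : Matrix (Fin n) (Fin n) K}
    (hω : ω.IsSymm) (hdet : ω.det ≠ 0) {α : Forms K n n}
    (hα : ∀ I, α I ∈ confSymbolTwo ω) (m k : Fin n) :
    ∑ i, wedge K K i (fun I => α I (Finsupp.single i 1 + Finsupp.single m 1) k)
      = wedge K K k (fun I => symbolTrace m (α I))
        + (if k = m then ∑ i, wedge K K i (fun I => symbolTrace i (α I)) else 0)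
        - ∑ i, ω i m • wedge K K i (∑ j, ω⁻¹ k j • fun I => symbolTrace j (α I)) := by
  have h (i : Fin n) : (fun I => α I (Finsupp.single i 1 + Finsupp.single m 1) k)
      = (if k = i then fun I => symbolTrace m (α I) else 0)
        + (if k = m then fun I => symbolTrace i (α I) else 0)
        - ω i m • ∑ j, ω⁻¹ k j • fun I => symbolTrace j (α I) := by
    funext I
    rw [confSymbolTwo_apply hω hdet (hα I), Pi.sub_apply, Pi.add_apply, Pi.smul_apply,
      Finset.sum_apply]
    congr 1
    split_ifs <;> rfl
  simp only [h, map_sub, map_add, map_smul, Finset.sum_sub_distrib, Finset.sum_add_distrib,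
    apply_ite (wedge K K _), map_zero, Finset.sum_ite_eq, Finset.mem_univ, if_true]
  congr 2
  split_ifs
  · rfl
  · exact Finset.sum_const_zero

/-- For the raised traces `B` the closure equation is `dx^k ∧ B^q - dx^q ∧ B^k` plus a multiple of
`ω^{qk}`. Its skew part in `q, k` eliminates the latter, leaving the symmetry treated by
`eq_zero_of_wedge_symm`. -/
theorem eq_zero_of_delta_eq_zero [CharZero K] {t : ℕ} (ht : t + 2 < n)
    {ω : Matrix (Fin n) (Fin n) K} (hω : ω.IsSymm) (hdet : ω.det ≠ 0) {α : Forms K n n}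
    (hα : α ∈ formsIn (t + 1) (confSymbolTwo ω)) (h : delta K n n α = 0) : α = 0 := by
  let A (j : Fin n) : Finset (Fin n) → K := fun I => symbolTrace j (α I)
  let B (k : Fin n) : Finset (Fin n) → K := ∑ j, ω⁻¹ k j • A j
  have hA (j) : A j ∈ extPow K n K (t + 1) := fun J hJ => by
    change symbolTrace j (α J) = 0
    rw [(hα J).2 hJ, map_zero]
  have h1 (m k) := (sum_wedge_confSymbolTwo hω hdet (fun I => (hα I).1) m k).symm.trans
    ((delta_eq_zero_iff hα).1 h m k)
  have h2 (q k) : wedge K K k (B q) + ω⁻¹ q k • (∑ i, wedge K K i (A i)) - wedge K K q (B k) = 0 := by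
    have h3 : ∑ m, ω⁻¹ q m • (wedge K K k (A m) + (if k = m then ∑ i, wedge K K i (A i) else 0)
        - ∑ i, ω i m • wedge K K i (B k)) = 0 :=
      Finset.sum_eq_zero fun m _ => by rw [h1, smul_zero]
    have h4 : ∑ m, ω⁻¹ q m • ∑ i, ω i m • wedge K K i (B k) = wedge K K q (B k) := by
      simp only [Finset.smul_sum, smul_smul]
      rw [Finset.sum_comm]
      simp only [← Finset.sum_smul]
      have e (i) : ∑ m, ω⁻¹ q m * ω i m = if q = i then 1 else 0 := by
        rw [← sum_inv_mul hdet]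
        exact Finset.sum_congr rfl fun m _ => by rw [hω.apply]
      simp only [e, ite_smul, one_smul, zero_smul, Finset.sum_ite_eq, Finset.mem_univ, if_true]
    simp only [smul_sub, smul_add, Finset.sum_sub_distrib, Finset.sum_add_distrib, h4, smul_ite,
      smul_zero, Finset.sum_ite_eq, Finset.mem_univ, if_true] at h3
    rw [← h3]
    simp only [B, map_sum, map_smul]
  have hB (k) : B k = 0 := by
    refine eq_zero_of_wedge_symm ht
      (fun p => Submodule.sum_mem _ fun j _ => Submodule.smul_mem _ _ (hA j)) (fun p q => ?_) k
    have h3 := congrArg₂ (· - ·) (h2 q p) (h2 p q)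
    simp only [inv_symm hω p q, sub_self] at h3
    rw [← sub_eq_zero]
    refine (smul_eq_zero.1 (?_ : (2 : K) • (wedge K K p (B q) - wedge K K q (B p)) = 0)).resolve_left
      two_ne_zero
    rw [← h3]
    module
  have hA0 (m) : A m = 0 := by
    have h3 : A m = ∑ k, ω m k • B k := by
      funext I
      have := sum_mul_sum_inv hdet (fun j => A j I) m
      rw [Finset.sum_apply, ← this]
      refine Finset.sum_congr rfl fun k _ => ?_
      have e : B k I = ∑ j, ω⁻¹ k j * A j I := Finset.sum_apply I _ _
      rw [Pi.smul_apply, e, smul_eq_mul]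
    rw [h3]
    exact Finset.sum_eq_zero fun k _ => by rw [hB, smul_zero]
  exact funext fun I => eq_zero_of_symbolTrace hω hdet (hα I).1 fun j => congrFun (hA0 j) I

theorem prolong_confSymbolTwo_zero (ω : Matrix (Fin n) (Fin n) K) :
    prolong 2 (confSymbolTwo ω) 0 = confSymbolTwo ω := by
  ext v
  rw [prolong, Submodule.mem_inf]
  simp only [Submodule.mem_iInf, Submodule.mem_comap]
  have h0 : shift (0 : Fin n →₀ ℕ) v = v := funext fun μ => congrArg v (add_zero μ)
  constructor
  · intro h
    have := h.2 0 (map_zero _)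
    rwa [h0] at this
  · refine fun h => ⟨(mem_confSymbolTwo_iff.1 h).1, fun ν hν => ?_⟩
    rwa [(Finsupp.degree_eq_zero_iff ν).1 hν, h0]

/-- The first shifts of an element of a higher prolongation form a one-form with values in `ĝ_2`,
closed by the symmetry of mixed derivatives; closed one-forms vanish. -/
theorem prolong_confSymbolTwo_succ [CharZero K] (hn : 2 < n) {ω : Matrix (Fin n) (Fin n) K}
    (hω : ω.IsSymm) (hdet : ω.det ≠ 0) (r : ℕ) : prolong 2 (confSymbolTwo ω) (r + 1) = ⊥ := by
  rw [eq_bot_iff]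
  intro v hv
  rw [prolong, Submodule.mem_inf] at hv
  simp only [Submodule.mem_iInf, Submodule.mem_comap] at hv
  have h1 (ν : Fin n →₀ ℕ) (hν : ν.degree = r) (i : Fin n) :
      shift (Finsupp.single i 1) (shift ν v) = 0 := by
    let u (i : Fin n) : Jets K n n := shift (Finsupp.single i 1) (shift ν v)
    have hu (i) : u i ∈ confSymbolTwo ω := by
      have e : u i = shift (Finsupp.single i 1 + ν) v :=
        funext fun μ => congrArg v (add_assoc μ _ _)
      rw [e]
      refine hv.2 _ ?_
      rw [map_add, Finsupp.degree_single]
      omega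
    -- The one-form `∑ dx^i u_i`, written as a family on finite sets.
    let α : Forms K n n := fun J => ∑ i, if J = {i} then u i else 0
    have hα : α ∈ formsIn (0 + 1) (confSymbolTwo ω) := by
      refine fun J => ⟨Submodule.sum_mem _ fun i _ => ?_, fun hJ => Finset.sum_eq_zero fun i _ =>
        if_neg fun h => hJ (by rw [h, Finset.card_singleton])⟩
      split_ifs
      · exact hu i
      · exact Submodule.zero_mem _
    have hδ : delta K n n α = 0 := by
      refine (delta_eq_zero_iff hα).2 fun m k => ?_
      let c (j i : Fin n) : Finset (Fin n) → K :=
        fun I => if I = ∅ then u j (Finsupp.single i 1 + Finsupp.single m 1) k else 0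
      have hc (i j) : c j i = c i j := by
        have : u j (Finsupp.single i 1 + Finsupp.single m 1)
            = u i (Finsupp.single j 1 + Finsupp.single m 1) :=
          congrArg v (by abel)
        simp only [c, this]
      have h1 (i : Fin n) : (fun I => α I (Finsupp.single i 1 + Finsupp.single m 1) k)
          = ∑ j, wedge K K j (c j i) := by
        funext I
        rw [Finset.sum_apply]
        simp only [α, Finset.sum_apply]
        refine Finset.sum_congr rfl fun j _ => ?_
        rw [wedge_apply]
        by_cases hI : I = {j}
        · have : moveSign K j {j} = 1 := by simp [moveSign, Finset.filter_singleton]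
          simp [hI, c, this]
        · rw [if_neg hI]
          by_cases hj : j ∈ I
          · have : I.erase j ≠ ∅ := fun h => hI (by
              rw [← Finset.insert_erase hj, h, insert_empty_eq])
            simp [hj, c, this]
          · rw [if_neg hj]
            rfl
      simp only [h1, map_sum]
      refine (smul_eq_zero.1 (?_ : (2 : K) • (∑ i, ∑ j, wedge K K i (wedge K K j (c j i))) = 0)
        ).resolve_left two_ne_zero
      rw [two_smul]
      conv_lhs => enter [2]; rw [Finset.sum_comm]
      simp only [← Finset.sum_add_distrib]
      refine Finset.sum_eq_zero fun i _ => Finset.sum_eq_zero fun j _ => ?_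
      rw [hc j i, wedge_wedge, neg_add_cancel]
    have h0 := congrFun (eq_zero_of_delta_eq_zero (by omega) hω hdet hα hδ) {i}
    simpa [α] using h0
  rw [Submodule.mem_bot]
  funext μ
  by_cases hμ : μ.degree = 2 + (r + 1)
  · obtain ⟨i, ν, hν, rfl⟩ := exists_single_add (r + 2) μ (by omega)
    obtain ⟨j, ν, hν', rfl⟩ := exists_single_add (r + 1) ν hν
    obtain ⟨k, ν, hν'', rfl⟩ := exists_single_add r ν hν'
    have h2 := congrFun (h1 ν hν'' i) (Finsupp.single k 1 + Finsupp.single j 1)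
    have h3 : ν + Finsupp.single k 1 + Finsupp.single j 1 + Finsupp.single i 1
        = Finsupp.single k 1 + Finsupp.single j 1 + Finsupp.single i 1 + ν := by abel
    rw [h3]
    exact h2
  · exact hv.1 μ hμ

/-- Already the cocycles vanish: for `r = 0` by injectivity of `δ` in form degrees 1 and 2, for `r >
0` because the prolongations are zero. -/
theorem acyclic_two [CharZero K] {ω : Matrix (Fin 4) (Fin 4) K} (hω : ω.IsSymm)
    (hdet : ω.det ≠ 0) : Acyclic 2 (confSymbolTwo ω) 2 := by
  intro t ht1 ht2 r
  have h : cocycles 2 (confSymbolTwo ω) t r = ⊥ := by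
    rw [eq_bot_iff]
    rintro α ⟨hα, hδ⟩
    rw [Submodule.mem_bot]
    cases r with
    | zero =>
      rw [prolong_confSymbolTwo_zero] at hα
      obtain ⟨s, rfl⟩ := Nat.exists_eq_add_of_le' ht1
      exact eq_zero_of_delta_eq_zero (by omega) hω hdet hα hδ
    | succ r =>
      rw [prolong_confSymbolTwo_succ (by norm_num) hω hdet] at hα
      exact funext fun I => (hα I).1
  have : Subsingleton (cocycles 2 (confSymbolTwo ω) t r) := by
    rw [h]
    infer_instance
  exact (Submodule.mkQ_surjective _).subsingleton

theorem exists_quadratic_jet [CharZero K] (s : Fin n → Fin n → Fin n → K)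
    (hs : ∀ i m, s i m = s m i) : ∃ v ∈ symSpace K n n 2,
      ∀ i m, v (Finsupp.single i 1 + Finsupp.single m 1) = s i m := by
  -- Jets are indexed by multi-indices, so the array `s` is read off by a quadratic polynomial in
  -- `μ`; the subtracted diagonal term makes it correct for `μ = 2 · 1_i` as well.
  refine ⟨fun μ k => if μ.degree = 2 then 1 / 2 * ∑ l, ∑ p,
    (((μ l : K) * μ p) - if l = p then (μ l : K) else 0) * s l p k else 0,
    fun μ hμ => funext fun k => if_neg hμ, fun i m => funext fun k => ?_⟩
  have hd : (Finsupp.single i 1 + Finsupp.single m 1 : Fin n →₀ ℕ).degree = 2 := by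
    rw [map_add, Finsupp.degree_single, Finsupp.degree_single]
  refine (if_pos hd).trans ?_
  have h (l p : Fin n) : (((Finsupp.single i 1 + Finsupp.single m 1 : Fin n →₀ ℕ) l : K)
      * ((Finsupp.single i 1 + Finsupp.single m 1 : Fin n →₀ ℕ) p : K)
      - if l = p then ((Finsupp.single i 1 + Finsupp.single m 1 : Fin n →₀ ℕ) l : K) else 0)
      = (if i = l then 1 else 0) * (if m = p then 1 else 0)
        + (if m = l then 1 else 0) * (if i = p then 1 else 0) := by
    have e1 (a : Fin n) : ((Finsupp.single i 1 + Finsupp.single m 1 : Fin n →₀ ℕ) a : K)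
        = (if i = a then 1 else 0) + if m = a then 1 else 0 := by
      simp [Finsupp.single_apply]
    rw [e1, e1]
    by_cases hlp : l = p
    · subst hlp
      rw [if_pos rfl]
      split_ifs <;> norm_num
    · have hx (a : Fin n) : (if a = l then (1 : K) else 0) * (if a = p then 1 else 0) = 0 := by
        by_cases ha : a = l
        · rw [if_neg fun h => hlp (ha.symm.trans h), mul_zero]
        · rw [if_neg ha, zero_mul]
      rw [if_neg hlp]
      linear_combination hx i + hx m
  simp only [h, add_mul, Finset.sum_add_distrib, ite_mul, one_mul, zero_mul, Finset.sum_ite_irrel,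
    Finset.sum_const_zero, Finset.sum_ite_eq, Finset.mem_univ, if_true]
  rw [hs m i]
  ring

/-- The explicit formula of `confSymbolTwo_apply` does satisfy the equations, so `ĝ_2` is isomorphic
to the space of covectors. -/
theorem exists_confSymbolTwo_of_trace [CharZero K] (hn : n ≠ 0) {ω : Matrix (Fin n) (Fin n) K}
    (hω : ω.IsSymm) (hdet : ω.det ≠ 0) (a : Fin n → K) :
    ∃ v ∈ confSymbolTwo ω, ∀ l, symbolTrace l v = a l := by
  obtain ⟨v, hv, hvs⟩ := exists_quadratic_jet (fun i m k => (if k = i then a m else 0)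
      + (if k = m then a i else 0) - ω i m * ∑ j, ω⁻¹ k j * a j) (fun i m => by
    funext k
    rw [hω.apply i m]
    ring)
  have hn' : (n : K) ≠ 0 := Nat.cast_ne_zero.2 hn
  have e1 (i m j) : ∑ r, ω j r * v (Finsupp.single i 1 + Finsupp.single m 1) r
      = ω j i * a m + ω j m * a i - ω i m * a j := by
    simp only [hvs, mul_sub, mul_add, mul_ite, mul_zero, Finset.sum_sub_distrib,
      Finset.sum_add_distrib, Finset.sum_ite_eq', Finset.mem_univ, if_true]
    congr 1
    rw [← sum_mul_sum_inv hdet a j, Finset.mul_sum]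
    exact Finset.sum_congr rfl fun r _ => mul_left_comm _ _ _
  have e2 (m) : ∑ r, v (Finsupp.single r 1 + Finsupp.single m 1) r = n * a m := by
    have e3 : ∑ r, ω r m * ∑ j, ω⁻¹ r j * a j = a m := by
      rw [← sum_mul_sum_inv hdet a m]
      exact Finset.sum_congr rfl fun r _ => by rw [hω.apply]
    simp only [hvs, Finset.sum_sub_distrib, Finset.sum_add_distrib, if_true, e3,
      Finset.sum_ite_eq', Finset.mem_univ, Finset.sum_const, Finset.card_univ, Fintype.card_fin,
      nsmul_eq_mul, add_sub_cancel_right]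
  refine ⟨v, mem_confSymbolTwo_iff.2 ⟨hv, fun m i j => ?_⟩, fun l => ?_⟩
  · have e4 : ∑ r, ω r j * v (Finsupp.single i 1 + Finsupp.single m 1) r
        = ∑ r, ω j r * v (Finsupp.single i 1 + Finsupp.single m 1) r :=
      Finset.sum_congr rfl fun r _ => by rw [hω.apply]
    rw [e4, e1, e1, e2, hω.apply i j]
    field_simp
    ring
  · change 1 / (n : K) * _ = _
    rw [e2]
    field_simp

/-- Since `ĝ_3 = 0`, any nonzero cocycle will do. A symmetric trace-free bivector `T ≠ 0` gives one,
because four-forms in dimension four are multiples of the volume form and closure becomes algebra in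
`T`. -/
theorem not_acyclic_three [CharZero K] {ω : Matrix (Fin 4) (Fin 4) K} (hω : ω.IsSymm)
    (hdet : ω.det ≠ 0) : ¬ Acyclic 2 (confSymbolTwo ω) 3 := by
  intro h
  have : Module.Free K (killingSymbols ω) := Module.Free.of_divisionRing K (killingSymbols ω)
  have : Nontrivial (killingSymbols ω) := Module.nontrivial_of_finrank_pos (R := K) (by
    rw [finrank_killingSymbols hω hdet]
    norm_num)
  obtain ⟨u, hu⟩ := exists_ne (0 : killingSymbols ω)
  obtain ⟨hT, hTω⟩ := killingBivector_mem hω hdet u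
  have hT0 : killingBivector ω u ≠ 0 := fun h0 =>
    hu ((injective_iff_map_eq_zero _).1 (killingBivector_injective hdet) u h0)
  generalize killingBivector ω u = T at hT hTω hT0
  let vol : Finset (Fin 4) → K := fun J => if J = Finset.univ then 1 else 0
  have hvol : vol ∈ extPow K 4 K 4 := fun J hJ => if_neg fun h => hJ (by rw [h]; rfl)
  have hw (j i) : wedge K K j (contr K K i vol) = if i = j then vol else 0 := by
    have h1 := contr_wedge (K := K) i j vol
    rwa [extPow_eq_zero (K := K) (by norm_num : 4 < 5) (wedge_mem j hvol), map_zero, zero_add] at h1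
  -- Chosen so that `dx^j ∧ B^k = T^{kj} vol`. Symmetry of `T` cancels the two outer terms of the
  -- closure equation, and vanishing trace kills the middle one.
  let B (k : Fin 4) : Finset (Fin 4) → K := ∑ i, T k i • contr K K i vol
  let A (m : Fin 4) : Finset (Fin 4) → K := ∑ k, ω m k • B k
  have hwB (j k) : wedge K K j (B k) = T k j • vol := by
    simp only [B, map_sum, map_smul, hw, smul_ite, smul_zero, Finset.sum_ite_eq', Finset.mem_univ,
      if_true]
  have hwA (j m) : wedge K K j (A m) = (∑ q, ω m q * T q j) • vol := by
    simp only [A, map_sum, map_smul, hwB, smul_smul, Finset.sum_smul]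
  have hAB (k) : ∑ j, ω⁻¹ k j • A j = B k := by
    funext I
    refine Eq.trans ?_ (sum_inv_mul_sum hdet (fun k => B k I) k)
    simp only [Finset.sum_apply, Pi.smul_apply, smul_eq_mul, A]
  have hA (m) : A m ∈ extPow K 4 K 3 := Submodule.sum_mem _ fun k _ => Submodule.smul_mem _ _
    (Submodule.sum_mem _ fun i _ => Submodule.smul_mem _ _ (contr_mem i hvol))
  choose α hα hαA using fun I => exists_confSymbolTwo_of_trace (by norm_num) hω hdet fun m => A m I
  have hαf : α ∈ formsIn 3 (confSymbolTwo ω) := fun I => ⟨hα I, fun hI =>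
    eq_zero_of_symbolTrace hω hdet (hα I) fun l => by rw [hαA, hA l I hI]⟩
  have hδ : delta K 4 4 α = 0 := by
    refine (delta_eq_zero_iff hαf).2 fun m k => ?_
    rw [sum_wedge_confSymbolTwo hω hdet hα]
    simp only [hαA]
    change wedge K K k (A m) + (if k = m then ∑ i, wedge K K i (A i) else 0)
      - ∑ i, ω i m • wedge K K i (∑ j, ω⁻¹ k j • A j) = 0
    have h1 : ∑ i, ω i m • wedge K K i (B k) = (∑ i, ω m i * T i k) • vol := by
      rw [Finset.sum_smul]
      exact Finset.sum_congr rfl fun i _ => by rw [hwB, smul_smul, hω.apply m i, hT.apply i k]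
    have h2 : ∑ i, wedge K K i (A i) = 0 := by
      simp only [hwA, ← Finset.sum_smul]
      have : ∑ i, ∑ q, ω i q * T q i = 0 := by
        rw [← hTω, Matrix.trace_mul_comm]
        rfl
      rw [this, zero_smul]
    rw [hAB, h1, hwA, h2, ite_self, add_zero, sub_self]
  have hmem : α ∈ cocycles 2 (confSymbolTwo ω) 3 0 := by
    refine ⟨?_, hδ⟩
    rwa [prolong_confSymbolTwo_zero]
  have hzero : α = 0 := by
    have h1 := h 3 (by norm_num) le_rfl 0
    have h2 := (Submodule.Quotient.mk_eq_zero _).1 (h1.elim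
      (Submodule.Quotient.mk (p := (coboundaries 2 (confSymbolTwo ω) 3 0).submoduleOf
        (cocycles 2 (confSymbolTwo ω) 3 0)) ⟨α, hmem⟩) 0)
    obtain ⟨β, hβ, hβα⟩ := h2
    rw [prolong_confSymbolTwo_succ (by norm_num) hω hdet] at hβ
    have hβ0 : β = 0 := funext fun I => (hβ I).1
    rw [hβ0, map_zero] at hβα
    exact hβα.symm
  have hA0 (m) : A m = 0 := funext fun I => by
    rw [← hαA I m, hzero]
    exact map_zero (symbolTrace m)
  refine hT0 (Matrix.ext fun k i => ?_)
  have h1 := congrFun (hwB i k) Finset.univ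
  rw [← hAB, Finset.sum_eq_zero fun j _ => by rw [hA0, smul_zero], map_zero] at h1
  simpa [vol] using h1.symm

end Acyclicity

end

end FormalTheory

theorem mainTheorem5 {K : Type*} [Field K] [CharZero K]
    (pd : Fin 4 → Derivation ℤ K K)
    (hcomm : ∀ i j a, pd i (pd j a) = pd j (pd i a))
    (ω : Matrix (Fin 4) (Fin 4) K) (hsymm : ω.IsSymm) (hdet : ω.det ≠ 0) :
    FormalTheory.Acyclic 2 (FormalTheory.confSymbolTwo ω) 2 ∧
    ¬ FormalTheory.Acyclic 2 (FormalTheory.confSymbolTwo ω) 3 ∧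
    ((∀ k l i j, FormalTheory.weylTensor pd ω k l i j = 0) →
      ∃ (CKilling : Matrix (Fin 9) (Fin 4) (FormalTheory.DiffOp pd))
        (Weyl : Matrix (Fin 10) (Fin 9) (FormalTheory.DiffOp pd))
        (Bianchi : Matrix (Fin 9) (Fin 10) (FormalTheory.DiffOp pd))
        (Last : Matrix (Fin 4) (Fin 9) (FormalTheory.DiffOp pd)),
        FormalTheory.IsRowBasis CKilling (FormalTheory.confKillingEqs pd ω) ∧
        FormalTheory.IsGeneratingCC CKilling Weyl 2 ∧ FormalTheory.compat CKilling 1 = ⊥ ∧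
        FormalTheory.IsGeneratingCC Weyl Bianchi 2 ∧ FormalTheory.compat Weyl 1 = ⊥ ∧
        FormalTheory.IsGeneratingCC Bianchi Last 1 ∧ FormalTheory.compat Bianchi 0 = ⊥ ∧
        ∀ c : Fin 4 → FormalTheory.DiffOp pd, c ᵥ* Last = 0 → c = 0) := by
  refine ⟨FormalTheory.acyclic_two hsymm hdet, FormalTheory.not_acyclic_three hsymm hdet,
    fun hW => ?_⟩
  exact FormalTheory.exists_conformal_sequence hcomm hsymm hdet hW
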